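/- **Setting.** Let $\Omega\subset\mathbb R^3$ be a bounded Lipschitz domain, $\tau>0$, $M\in\mathbb N$, $T=M\tau$, $t_m=m\tau$. Write $(\cdot,\cdot)$ and $(\cdot,\cdot)_{\partial\Omega}$ for the inner products of $L^2(\Omega)$ (for scalar, vector or matrix fields) and $L^2(\partial\Omega)$; on the boundary, functions in $H^1(\Omega)$ are understood as traces. Let $$H_\sigma=\Big\{v\in H^1_0(\Omega)^3:\ (\operatorname{div}v,q)=0\ \ \forall q\in L^2(\Omega),\ \int_\Omega q\,dx=0\Big\},\qquad Dv=\tfrac12(\nabla v+\nabla v^t),$$ $$a(u,v,w)=\tfrac12\int_\Omega((u\cdot\nabla)v)\cdot w\,dx-\tfrac12\int_\Omega((u\cdot\nabla)w)\cdot v\,dx .$$ Let $b,\epsilon,c_W,\sigma_{lg}>0$, $r\ge0$, $S_\gamma,\theta_{eq}\in\mathbb R$ and $g\in\mathbb R^3$ be constants, $\sigma=c_W\sigma_{lg}$. Let $\rho\in C^2(\mathbb R)$ and $\eta\in C^1(\mathbb R)$ be positive, bounded and globally Lipschitz continuous, and let $\rho$ attain its minimum $\rho_{\min}$. Let $W_+,W_-\in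 C^2(\mathbb R)$, $W_+$ convex with $W_+'(0)=0$, $W_-$ concave, both satisfying $F(s)\le C(1+|s|^4)$, $|F'(s)|\le C(1+|s|^3)$, $|F''(s)|\le C(1+|s|^2)$ for some constant $C$. Let $\vartheta\in C^2(\mathbb R)$ have bounded second derivative, $\vartheta=-\frac12$ on $(-\infty,-1]$ and $\vartheta=\frac12$ on $[1,\infty)$. Let $U$ be a real normed space, $B:U\to L^2(0,T;L^2(\partial\Omega))$ linear and continuous, and let $u\in U$ be admissible, i.e. $-1\le\cos\theta_{eq}+Bu\le1$ almost everywhere. Put $$B_mu=\frac1\tau\int_{t_{m-1}}^{t_m}(Bu)(t)\,dt$$ and, whenever the argument is a phase field at time index $m-1$, $$\gamma_u'(\varphi^{m-1})=\sigma_{lg}(\cos\theta_{eq}+B_mu)\,\vartheta'(\varphi^{m-1}),\qquad \gamma_u''(\varphi^{m-1})=\sigma_{lg}(\cos\theta_{eq}+B_mu)\,\vartheta''(\varphi^{m-1}).$$ Let $v^0=v_0\in H_\sigma$ and $\varphi^0=\varphi_0\in H^1(\Omega)\cap L^\infty(\Omega)$ be given initial data. Let $$Y=\big(H_\sigma\times(H^1(\Omega)\cap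 L^\infty(\Omega))\times W^{1,3}(\Omega)\big)^M,\qquad Z=\big((H_\sigma\times H^1(\Omega)\times H^1(\Omega))^\star\big)^M,$$ $$\|(v,\varphi,\mu)\|_Y=\max_m\|v^m\|_{H^1}+\max_m\|\varphi^m\|_{H^1}+\max_m\|\varphi^m\|_{L^\infty}+\max_m\|\mu^m\|_{W^{1,3}} .$$ For $y=(v^m,\varphi^m,\mu^m)_{m=1}^M\in Y$ write $\rho^m=\rho(\varphi^m)$, $\eta^m=\eta(\varphi^m)$, $J^m=-b\rho'(\varphi^m)\nabla\mu^m$, and for $z=(w^m,\Psi^m,\Phi^m)_{m=1}^M\in(H_\sigma\times H^1(\Omega)\times H^1(\Omega))^M$ put $$\begin{aligned}E(y,z)=\sum_{m=1}^M\Big\{&\Big[\big(\tfrac{\rho^m+\rho^{m-1}}2v^m-\rho^{m-1}v^{m-1},w^m\big)+\tau a(\rho^{m-1}v^{m-1}+J^m,v^m,w^m)\\&\quad+\tau(2\eta^mDv^m,Dw^m)+\tau(\varphi^{m-1}\nabla\mu^m,w^m)-\tau(g\rho^m,w^m)\Big]\\ &+\Big[(\varphi^m-\varphi^{m-1},\Psi^m)-\tau(\varphi^{m-1}v^{m-1},\nabla\Psi^m)+\tfrac{\tau^2}{\rho_{\min}}(|\varphi^{m-1}|^2\nabla\mu^m,\nabla\Psi^m)+\tau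 b(\nabla\mu^m,\nabla\Psi^m)\Big]\\ &+\Big[\tau\sigma\epsilon(\nabla\varphi^m,\nabla\Phi^m)+\tfrac{\tau\sigma}{\epsilon}(W_+'(\varphi^m)+W_-'(\varphi^{m-1}),\Phi^m)-\tau(\mu^m,\Phi^m)\\&\quad+r(\varphi^m-\varphi^{m-1},\Phi^m)_{\partial\Omega}+\tau\big(\tfrac{S_\gamma}2(\varphi^m-\varphi^{m-1})+\gamma_u'(\varphi^{m-1}),\Phi^m\big)_{\partial\Omega}\Big]\Big\}.\end{aligned}$$ **Theorem.** There is exactly one operator $e(\cdot,u):Y\to Z$ with $\langle z,e(y,u)\rangle=E(y,z)$ for all $y$ and $z$. It is Fréchet differentiable at every $y\in Y$, and its derivative $e_y(y,u):Y\to Z$ in the direction $d=(d_v^m,d_\varphi^m,d_\mu^m)_{m=1}^M\in Y$ is given, for all $z$, by (all quantities with time index $M+1$ are zero) $$\begin{aligned}\langle e_y(y,u)d,z\rangle=\sum_{m=1}^M\Big\{&\Big[\tfrac12(\rho'(\varphi^m)d_\varphi^m,v^m\cdot w^m+v^{m+1}\cdot w^{m+1})+\tfrac12((\rho^m+\rho^{m-1})d_v^m,w^m)\\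 &-(\rho'(\varphi^m)d_\varphi^mv^m+\rho^md_v^m,w^{m+1})+\tau a(\rho'(\varphi^m)d_\varphi^mv^m+\rho^md_v^m,v^{m+1},w^{m+1})\\ &+\tau a(-b\rho''(\varphi^m)d_\varphi^m\nabla\mu^m-b\rho'(\varphi^m)\nabla d_\mu^m,v^m,w^m)+\tau a(\rho^{m-1}v^{m-1}+J^m,d_v^m,w^m)\\ &+\tau(2\eta'(\varphi^m)d_\varphi^mDv^m,Dw^m)+\tau(2\eta^mDd_v^m,Dw^m)\\ &+\tau(d_\varphi^m\nabla\mu^{m+1},w^{m+1})+\tau(\varphi^{m-1}\nabla d_\mu^m,w^m)-\tau(g\rho'(\varphi^m)d_\varphi^m,w^m)\Big]\\ &+\Big[(d_\varphi^m,\Psi^m-\Psi^{m+1})-\tau(d_\varphi^mv^m+\varphi^md_v^m,\nabla\Psi^{m+1})+\tfrac{\tau^2}{\rho_{\min}}(2\varphi^md_\varphi^m\nabla\mu^{m+1},\nabla\Psi^{m+1})\\ &\quad+\tfrac{\tau^2}{\rho_{\min}}(|\varphi^{m-1}|^2\nabla d_\mu^m,\nabla\Psi^m)+\tau b(\nabla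 d_\mu^m,\nabla\Psi^m)\Big]\\ &+\Big[\tau\sigma\epsilon(\nabla d_\varphi^m,\nabla\Phi^m)+\tfrac{\tau\sigma}\epsilon(W_+''(\varphi^m)d_\varphi^m,\Phi^m)+\tfrac{\tau\sigma}\epsilon(W_-''(\varphi^m)d_\varphi^m,\Phi^{m+1})-\tau(d_\mu^m,\Phi^m)\\ &\quad+r(d_\varphi^m,\Phi^m-\Phi^{m+1})_{\partial\Omega}+\tau\tfrac{S_\gamma}2(d_\varphi^m,\Phi^m-\Phi^{m+1})_{\partial\Omega}+\tau(\gamma_u''(\varphi^m)d_\varphi^m,\Phi^{m+1})_{\partial\Omega}\Big]\Big\}.\end{aligned}$$ (Here $\gamma_u''(\varphi^m)$ contains $B_{m+1}u$.) The derivative is lower block triangular in time: the $m$-th component $(e_y(y,u)d)_m\in(H_\sigma\times H^1(\Omega)\times H^1(\Omega))^\star$ depends on $d$ only through its values at the time indices $m$ and $m-1$. The diagonal blocks are block triangular as well: the restriction of $(e_y(y,u)d)_m$ to test triples $(0,\Psi,\Phi)$ does not depend on $d_v^m$. -/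

import Mathlib

open MeasureTheory Set Filter Topology
open scoped ENNReal NNReal

noncomputable section

namespace CHNS

/-- Three-dimensional Euclidean space. -/
abbrev Space := EuclideanSpace ℝ (Fin 3)

instance factOneLeThree : Fact ((1 : ℝ≥0∞) ≤ 3) := ⟨by norm_num⟩

/-- Bounded Lipschitz domains: bounded, open, connected, and near every boundary point, after
a rotation `R` of the coordinates, equal to the set above the graph of a Lipschitz function. -/
structure IsBoundedLipschitzDomain (Ω : Set Space) : Prop where
  isOpen : IsOpen Ω
  isConnected : IsConnected Ω
  isBounded : Bornology.IsBounded Ω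
  graph : ∀ x₀ ∈ frontier Ω, ∃ (R : Space ≃ₗᵢ[ℝ] Space) (h : EuclideanSpace ℝ (Fin 2) → ℝ)
    (K : ℝ≥0) (δ : ℝ), LipschitzWith K h ∧ 0 < δ ∧
      ∀ x ∈ Metric.ball x₀ δ,
        (x ∈ Ω ↔ h (WithLp.toLp 2 fun i : Fin 2 => R x i.castSucc) < R x (Fin.last 2))

/-- Lebesgue measure on `Ω`. -/
abbrev vol (Ω : Set Space) : Measure Space := volume.restrict Ω

/-- Surface measure on the boundary of `Ω`. -/
abbrev surf (Ω : Set Space) : Measure Space := (μHE[2]).restrict (frontier Ω)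

/-- Test functions: smooth functions with compact support in `Ω`. -/
def IsTestFun (Ω : Set Space) (ψ : Space → ℝ) : Prop :=
  ContDiff ℝ (⊤ : ℕ∞) ψ ∧ HasCompactSupport ψ ∧ tsupport ψ ⊆ Ω

/-- `G` is the weak gradient of `f` on `Ω`. -/
def HasWeakGradient (Ω : Set Space) (f : Space → ℝ) (G : Space → Space) : Prop :=
  ∀ ψ : Space → ℝ, IsTestFun Ω ψ → ∀ i : Fin 3,
    ∫ x in Ω, f x * fderiv ℝ ψ x (EuclideanSpace.single i 1) = - ∫ x in Ω, ψ x * G x i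

section WeakGradient

variable {p : ℝ≥0∞} [hp : Fact (1 ≤ p)] {Ω : Set Space}

theorem integrable_mul_testDeriv {f : Space → ℝ} (hf : MemLp f p (vol Ω)) {ψ : Space → ℝ}
    (hψ : IsTestFun Ω ψ) (i : Fin 3) :
    Integrable (fun x => f x * fderiv ℝ ψ x (EuclideanSpace.single i 1)) (vol Ω) := by
  have h1 : LocallyIntegrable f (vol Ω) := hf.locallyIntegrable hp.out
  have hc : Continuous (fun x => fderiv ℝ ψ x (EuclideanSpace.single i 1)) :=
    (hψ.1.continuous_fderiv (by simp)).clm_apply continuous_const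
  have hs : HasCompactSupport (fun x => fderiv ℝ ψ x (EuclideanSpace.single i 1)) :=
    hψ.2.1.fderiv_apply (𝕜 := ℝ) _
  simpa using h1.integrable_smul_right_of_hasCompactSupport hc hs

theorem integrable_test_mul {G : Space → Space} (hG : MemLp G p (vol Ω)) {ψ : Space → ℝ}
    (hψ : IsTestFun Ω ψ) (i : Fin 3) : Integrable (fun x => ψ x * G x i) (vol Ω) := by
  have h1 : LocallyIntegrable G (vol Ω) := hG.locallyIntegrable hp.out
  have h2 := h1.integrable_smul_left_of_hasCompactSupport hψ.1.continuous hψ.2.1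
  simpa using (EuclideanSpace.proj (𝕜 := ℝ) i).integrable_comp h2

end WeakGradient

/-- The Sobolev space `W^{1,p}(Ω)`: pairs of a function in `L^p` and its weak gradient in `L^p`,
with norm `(‖f‖_p ^ p + ‖∇f‖_p ^ p) ^ (1/p)`. -/
def W1 (p : ℝ≥0∞) [hp : Fact (1 ≤ p)] (Ω : Set Space) :
    Submodule ℝ (WithLp p (Lp ℝ p (vol Ω) × Lp Space p (vol Ω))) where
  carrier := {f | HasWeakGradient Ω f.fst f.snd}
  zero_mem' := by
    intro ψ hψ i
    have h1 : (fun x => ((0 : Lp ℝ p (vol Ω)) x) * fderiv ℝ ψ x (EuclideanSpace.single i 1))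
        =ᵐ[vol Ω] fun _ => 0 := by
      filter_upwards [Lp.coeFn_zero ℝ p (vol Ω)] with x hx
      rw [hx, Pi.zero_apply, zero_mul]
    have h2 : (fun x => ψ x * ((0 : Lp Space p (vol Ω)) x) i) =ᵐ[vol Ω] fun _ => 0 := by
      filter_upwards [Lp.coeFn_zero Space p (vol Ω)] with x hx
      rw [hx, Pi.zero_apply, PiLp.zero_apply, mul_zero]
    simp only [WithLp.zero_fst, WithLp.zero_snd]
    rw [integral_congr_ae h1, integral_congr_ae h2]
    simp
  add_mem' := by
    intro f g hf hg ψ hψ i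
    have h1 : (fun x => ((f.fst + g.fst : Lp ℝ p (vol Ω)) x) *
        fderiv ℝ ψ x (EuclideanSpace.single i 1))
        =ᵐ[vol Ω] fun x => f.fst x * fderiv ℝ ψ x (EuclideanSpace.single i 1) +
          g.fst x * fderiv ℝ ψ x (EuclideanSpace.single i 1) := by
      filter_upwards [Lp.coeFn_add f.fst g.fst] with x hx
      rw [hx, Pi.add_apply, add_mul]
    have h2 : (fun x => ψ x * ((f.snd + g.snd : Lp Space p (vol Ω)) x) i)
        =ᵐ[vol Ω] fun x => ψ x * f.snd x i + ψ x * g.snd x i := by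
      filter_upwards [Lp.coeFn_add f.snd g.snd] with x hx
      rw [hx, Pi.add_apply, PiLp.add_apply, mul_add]
    simp only [WithLp.add_fst, WithLp.add_snd]
    rw [integral_congr_ae h1, integral_congr_ae h2,
      integral_add (integrable_mul_testDeriv (Lp.memLp _) hψ i)
        (integrable_mul_testDeriv (Lp.memLp _) hψ i),
      integral_add (integrable_test_mul (Lp.memLp _) hψ i)
        (integrable_test_mul (Lp.memLp _) hψ i), hf ψ hψ i, hg ψ hψ i]
    ring
  smul_mem' := by
    intro c f hf ψ hψ i
    have h1 : (fun x => ((c • f.fst : Lp ℝ p (vol Ω)) x) *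
        fderiv ℝ ψ x (EuclideanSpace.single i 1))
        =ᵐ[vol Ω] fun x => c * (f.fst x * fderiv ℝ ψ x (EuclideanSpace.single i 1)) := by
      filter_upwards [Lp.coeFn_smul c f.fst] with x hx
      rw [hx, Pi.smul_apply, smul_eq_mul, mul_assoc]
    have h2 : (fun x => ψ x * ((c • f.snd : Lp Space p (vol Ω)) x) i)
        =ᵐ[vol Ω] fun x => c * (ψ x * f.snd x i) := by
      filter_upwards [Lp.coeFn_smul c f.snd] with x hx
      rw [hx, Pi.smul_apply, PiLp.smul_apply, smul_eq_mul]
      ring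
    simp only [WithLp.smul_fst, WithLp.smul_snd]
    rw [integral_congr_ae h1, integral_congr_ae h2, integral_const_mul, integral_const_mul,
      hf ψ hψ i]
    ring

instance W1.normedAddCommGroup (p : ℝ≥0∞) [Fact (1 ≤ p)] (Ω : Set Space) :
    NormedAddCommGroup (W1 p Ω) := Submodule.normedAddCommGroup _

instance W1.normedSpace (p : ℝ≥0∞) [Fact (1 ≤ p)] (Ω : Set Space) :
    NormedSpace ℝ (W1 p Ω) := Submodule.normedSpace _

/-- The function underlying an element of `W^{1,p}(Ω)`. -/
def fn {p : ℝ≥0∞} [Fact (1 ≤ p)] {Ω : Set Space} (f : W1 p Ω) : Space → ℝ := f.1.fst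

/-- The weak gradient of an element of `W^{1,p}(Ω)`. -/
def grad {p : ℝ≥0∞} [Fact (1 ≤ p)] {Ω : Set Space} (f : W1 p Ω) : Space → Space := f.1.snd

/-- `H¹(Ω)`. -/
abbrev H1 (Ω : Set Space) := W1 2 Ω

/-- `H¹₀(Ω)`, the closure of the test functions in `H¹(Ω)`. -/
def H10 (Ω : Set Space) : Submodule ℝ (H1 Ω) :=
  (Submodule.span ℝ {f : H1 Ω | ∃ ψ, IsTestFun Ω ψ ∧ fn f =ᵐ[vol Ω] ψ}).topologicalClosure

/-- `H¹(Ω)³`. -/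
abbrev VH1 (Ω : Set Space) := PiLp 2 fun _ : Fin 3 => H1 Ω

/-- The vector field underlying an element of `H¹(Ω)³`. -/
def vec {Ω : Set Space} (v : VH1 Ω) (x : Space) : Space := WithLp.toLp 2 fun i => fn (v i) x

/-- The weak divergence of an element of `H¹(Ω)³`. -/
def divergence {Ω : Set Space} (v : VH1 Ω) (x : Space) : ℝ := ∑ i, grad (v i) x i

/-- The symmetric gradient `Dv = (∇v + (∇v)ᵗ) / 2`; the inner product of the codomain is the
Frobenius inner product of matrices. -/
def symGrad {Ω : Set Space} (v : VH1 Ω) (x : Space) : EuclideanSpace ℝ (Fin 3 × Fin 3) :=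
  WithLp.toLp 2 fun ij => (grad (v ij.1) x ij.2 + grad (v ij.2) x ij.1) / 2

theorem memLp_divergence {Ω : Set Space} (v : VH1 Ω) : MemLp (divergence v) 2 (vol Ω) := by
  have : divergence v = ∑ i, fun x => grad (v i) x i := by
    ext x; simp [divergence]
  rw [this]
  refine memLp_finsetSum' _ fun i _ => ?_
  exact (EuclideanSpace.proj (𝕜 := ℝ) i).comp_memLp' (Lp.memLp (v i).1.snd)

theorem divergence_add {Ω : Set Space} (v w : VH1 Ω) :
    divergence (v + w) =ᵐ[vol Ω] fun x => divergence v x + divergence w x := by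
  have h : ∀ i : Fin 3, ∀ᵐ x ∂(vol Ω), grad ((v + w) i) x = grad (v i) x + grad (w i) x :=
    fun i => Lp.coeFn_add (v i).1.snd (w i).1.snd
  filter_upwards [ae_all_iff.2 h] with x hx
  unfold divergence
  rw [← Finset.sum_add_distrib]
  exact Finset.sum_congr rfl fun i _ => by rw [hx i, PiLp.add_apply]

theorem divergence_smul {Ω : Set Space} (c : ℝ) (v : VH1 Ω) :
    divergence (c • v) =ᵐ[vol Ω] fun x => c * divergence v x := by
  have h : ∀ i : Fin 3, ∀ᵐ x ∂(vol Ω), grad ((c • v) i) x = c • grad (v i) x :=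
    fun i => Lp.coeFn_smul c (v i).1.snd
  filter_upwards [ae_all_iff.2 h] with x hx
  unfold divergence
  rw [Finset.mul_sum]
  exact Finset.sum_congr rfl fun i _ => by rw [hx i, PiLp.smul_apply, smul_eq_mul]

/-- `H_σ(Ω)`: fields in `H¹₀(Ω)³` whose divergence is orthogonal to all square integrable
functions of mean zero. -/
def Hsig (Ω : Set Space) : Submodule ℝ (VH1 Ω) where
  carrier := {v | (∀ i, v i ∈ H10 Ω) ∧
    ∀ q : Lp ℝ 2 (vol Ω), ∫ x in Ω, q x = 0 → ∫ x in Ω, divergence v x * q x = 0}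
  zero_mem' := by
    refine ⟨fun i => (H10 Ω).zero_mem, fun q _ => ?_⟩
    have h := divergence_smul (0 : ℝ) (0 : VH1 Ω)
    rw [zero_smul] at h
    have h2 : (fun x => divergence (0 : VH1 Ω) x * q x) =ᵐ[vol Ω] fun _ => 0 := by
      filter_upwards [h] with x hx
      rw [hx]; simp
    rw [integral_congr_ae h2]; simp
  add_mem' := by
    rintro v w ⟨hv, hv'⟩ ⟨hw, hw'⟩
    refine ⟨fun i => (H10 Ω).add_mem (hv i) (hw i), fun q hq => ?_⟩
    have h2 : (fun x => divergence (v + w) x * q x) =ᵐ[vol Ω]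
        fun x => divergence v x * q x + divergence w x * q x := by
      filter_upwards [divergence_add v w] with x hx
      rw [hx, add_mul]
    rw [integral_congr_ae h2, integral_add, hv' q hq, hw' q hq, add_zero]
    · exact (memLp_divergence v).integrable_mul (Lp.memLp q)
    · exact (memLp_divergence w).integrable_mul (Lp.memLp q)
  smul_mem' := by
    rintro c v ⟨hv, hv'⟩
    refine ⟨fun i => (H10 Ω).smul_mem c (hv i), fun q hq => ?_⟩
    have h2 : (fun x => divergence (c • v) x * q x) =ᵐ[vol Ω]
        fun x => c * (divergence v x * q x) := by
      filter_upwards [divergence_smul c v] with x hx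
      rw [hx, mul_assoc]
    rw [integral_congr_ae h2, integral_const_mul, hv' q hq, mul_zero]

instance Hsig.normedAddCommGroup (Ω : Set Space) : NormedAddCommGroup (Hsig Ω) :=
  Submodule.normedAddCommGroup _

instance Hsig.normedSpace (Ω : Set Space) : NormedSpace ℝ (Hsig Ω) := Submodule.normedSpace _

/-- `g` is the boundary trace of `f`: some sequence of smooth functions converges to `f` in
`H¹(Ω)` while its restrictions to the boundary converge to `g` in `L²(∂Ω)`. -/
def IsTrace {Ω : Set Space} (f : H1 Ω) (g : Lp ℝ 2 (surf Ω)) : Prop :=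
  ∃ F : ℕ → Space → ℝ, (∀ k, ContDiff ℝ (⊤ : ℕ∞) (F k)) ∧
    Tendsto (fun k => eLpNorm (fun x => F k x - fn f x) 2 (vol Ω)) atTop (𝓝 0) ∧
    Tendsto (fun k => eLpNorm (fun x => gradient (F k) x - grad f x) 2 (vol Ω)) atTop (𝓝 0) ∧
    Tendsto (fun k => eLpNorm (fun x => F k x - g x) 2 (surf Ω)) atTop (𝓝 0)

open Classical in
/-- The trace operator `H¹(Ω) → L²(∂Ω)`. On a bounded Lipschitz domain every element of `H¹(Ω)`
has exactly one trace, so that the default value `0` does not occur. -/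
def tr {Ω : Set Space} (f : H1 Ω) : Lp ℝ 2 (surf Ω) :=
  if h : ∃ g, IsTrace f g then h.choose else 0

/-- The constants and nonlinearities of the model. -/
structure ModelData where
  /-- density -/
  ρ : ℝ → ℝ
  /-- minimum of the density -/
  ρmin : ℝ
  /-- viscosity -/
  η : ℝ → ℝ
  /-- convex part of the free energy potential -/
  Wp : ℝ → ℝ
  /-- concave part of the free energy potential -/
  Wm : ℝ → ℝ
  /-- interpolation function of the contact line energy -/
  θ : ℝ → ℝ
  /-- gravitational acceleration -/
  g : Space
  /-- mobility -/
  b : ℝ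
  /-- interface width -/
  ε : ℝ
  /-- relaxation parameter of the contact line -/
  r : ℝ
  /-- scaling constant of the potential -/
  cW : ℝ
  /-- liquid-gas surface tension -/
  σlg : ℝ
  /-- equilibrium contact angle -/
  θeq : ℝ
  /-- stabilization parameter -/
  Sγ : ℝ
  /-- time step -/
  τ : ℝ
  ρ_contDiff : ContDiff ℝ 2 ρ
  ρ_pos : ∀ s, 0 < ρ s
  ρ_bounded : ∃ C, ∀ s, |ρ s| ≤ C
  ρ_lipschitz : ∃ K, LipschitzWith K ρ
  ρmin_isLeast : IsLeast (range ρ) ρmin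
  η_contDiff : ContDiff ℝ 1 η
  η_pos : ∀ s, 0 < η s
  η_bounded : ∃ C, ∀ s, |η s| ≤ C
  η_lipschitz : ∃ K, LipschitzWith K η
  Wp_contDiff : ContDiff ℝ 2 Wp
  Wp_convex : ConvexOn ℝ univ Wp
  Wp_deriv_zero : deriv Wp 0 = 0
  Wm_contDiff : ContDiff ℝ 2 Wm
  Wm_concave : ConcaveOn ℝ univ Wm
  W_growth : ∃ C, ∀ F ∈ ({Wp, Wm} : Set (ℝ → ℝ)), ∀ s,
    F s ≤ C * (1 + |s| ^ 4) ∧ |deriv F s| ≤ C * (1 + |s| ^ 3) ∧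
      |deriv (deriv F) s| ≤ C * (1 + |s| ^ 2)
  θ_contDiff : ContDiff ℝ 2 θ
  θ_bounded : ∃ L, ∀ s, |deriv (deriv θ) s| ≤ L
  θ_left : ∀ s ≤ -1, θ s = -1 / 2
  θ_right : ∀ s, 1 ≤ s → θ s = 1 / 2
  b_pos : 0 < b
  ε_pos : 0 < ε
  r_nonneg : 0 ≤ r
  cW_pos : 0 < cW
  σlg_pos : 0 < σlg
  τ_pos : 0 < τ

/-- `σ = c_W σ_lg`. -/
def ModelData.σ (P : ModelData) : ℝ := P.cW * P.σlg

/-- `L²(0,T;L²(∂Ω))`. -/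
abbrev BdryL2 (Ω : Set Space) (T : ℝ) := Lp (Lp ℝ 2 (surf Ω)) 2 (volume.restrict (Ioo 0 T))

/-- The set of admissible controls, `-1 ≤ cos θ_eq + Bu ≤ 1`. -/
def Uad (P : ModelData) {Ω : Set Space} {T : ℝ} {U : Type*} [NormedAddCommGroup U]
    [NormedSpace ℝ U] (B : U →L[ℝ] BdryL2 Ω T) : Set U :=
  {u | ∀ᵐ t ∂(volume.restrict (Ioo 0 T)), ∀ᵐ x ∂(surf Ω),
    -1 ≤ Real.cos P.θeq + (B u t) x ∧ Real.cos P.θeq + (B u t) x ≤ 1}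

/-- The mean `B_m u` of the control action over `(t_{m-1}, t_m)`. -/
def meanControl (P : ModelData) {Ω : Set Space} {T : ℝ} (β : BdryL2 Ω T) (m : ℕ) :
    Lp ℝ 2 (surf Ω) :=
  P.τ⁻¹ • ∫ t in (((m : ℝ) - 1) * P.τ)..((m : ℝ) * P.τ), β t

/-- Quadruples `(v, φ, φ', μ)` of sequences of length `M`, with norm
`max ‖v^m‖_{H¹} + (max ‖φ^m‖_{H¹} + (max ‖φ'^m‖_{L^∞} + max ‖μ^m‖_{W^{1,3}}))`. -/
def YAmbient (Ω : Set Space) (M : ℕ) : Type :=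
  WithLp 1 ((Fin M → Hsig Ω) × WithLp 1 ((Fin M → H1 Ω) ×
    WithLp 1 ((Fin M → Lp ℝ ⊤ (vol Ω)) × (Fin M → W1 3 Ω))))

instance YAmbient.normedAddCommGroup (Ω : Set Space) (M : ℕ) :
    NormedAddCommGroup (YAmbient Ω M) :=
  inferInstanceAs (NormedAddCommGroup (WithLp 1 ((Fin M → Hsig Ω) × WithLp 1 ((Fin M → H1 Ω) ×
    WithLp 1 ((Fin M → Lp ℝ ⊤ (vol Ω)) × (Fin M → W1 3 Ω))))))

instance YAmbient.normedSpace (Ω : Set Space) (M : ℕ) : NormedSpace ℝ (YAmbient Ω M) :=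
  inferInstanceAs (NormedSpace ℝ (WithLp 1 ((Fin M → Hsig Ω) × WithLp 1 ((Fin M → H1 Ω) ×
    WithLp 1 ((Fin M → Lp ℝ ⊤ (vol Ω)) × (Fin M → W1 3 Ω))))))

/-- The state space `Y = (H_σ × (H¹ ∩ L^∞) × W^{1,3})^M`, with elements `(v, φ, φ', μ)` where `φ'`
is `φ` regarded as an element of `(L^∞)^M`. -/
def Y (Ω : Set Space) (M : ℕ) : Submodule ℝ (YAmbient Ω M) where
  carrier := {y | ∀ m, fn (y.snd.fst m) =ᵐ[vol Ω] y.snd.snd.fst m}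
  zero_mem' := by
    intro m
    exact (Lp.coeFn_zero ℝ 2 (vol Ω)).trans (Lp.coeFn_zero ℝ ⊤ (vol Ω)).symm
  add_mem' := by
    intro y y' hy hy' m
    refine (Lp.coeFn_add (y.snd.fst m).1.fst (y'.snd.fst m).1.fst).trans ?_
    refine EventuallyEq.trans ?_ (Lp.coeFn_add (y.snd.snd.fst m) (y'.snd.snd.fst m)).symm
    exact (hy m).add (hy' m)
  smul_mem' := by
    intro c y hy m
    refine (Lp.coeFn_smul c (y.snd.fst m).1.fst).trans ?_
    refine EventuallyEq.trans ?_ (Lp.coeFn_smul c (y.snd.snd.fst m)).symm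
    exact (hy m).const_smul c

instance Y.normedAddCommGroup (Ω : Set Space) (M : ℕ) : NormedAddCommGroup (Y Ω M) :=
  Submodule.normedAddCommGroup _

instance Y.normedSpace (Ω : Set Space) (M : ℕ) : NormedSpace ℝ (Y Ω M) := Submodule.normedSpace _

section Components

variable {Ω : Set Space} {M : ℕ}

/-- The velocities of a state. -/
def Y.v (y : Y Ω M) : Fin M → Hsig Ω := y.1.fst

/-- The phase fields of a state. -/
def Y.φ (y : Y Ω M) : Fin M → H1 Ω := y.1.snd.fst

/-- The chemical potentials of a state. -/
def Y.μ (y : Y Ω M) : Fin M → W1 3 Ω := y.1.snd.snd.snd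

end Components

/-- Test triples `(w, Ψ, Φ)` of one time step. -/
abbrev TestSpace (Ω : Set Space) := Hsig Ω × H1 Ω × H1 Ω

/-- The space `Z = ((H_σ × H¹ × H¹)^*)^M`. -/
abbrev Z (Ω : Set Space) (M : ℕ) := Fin M → StrongDual ℝ (TestSpace Ω)

/-- The sequence with initial value `a₀` at time index `0`, values `a` at the time indices
`1, …, M`, and the value zero at all later indices. -/
def timeSeq {X : Type*} [Zero X] {M : ℕ} (a₀ : X) (a : Fin M → X) : ℕ → X
  | 0 => a₀
  | k + 1 => if h : k < M then a ⟨k, h⟩ else 0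

/-- The `L²` pairing with respect to the measure `ν`. -/
def pair {F : Type*} [NormedAddCommGroup F] [InnerProductSpace ℝ F] (ν : Measure Space)
    (f h : Space → F) : ℝ := ∫ x, inner ℝ (f x) (h x) ∂ν

/-- The directional derivative `(u · ∇) v`. -/
def conv {Ω : Set Space} (u : Space → Space) (v : VH1 Ω) (x : Space) : Space :=
  WithLp.toLp 2 fun i => inner ℝ (u x) (grad (v i) x)

/-- The trilinear form `a(u, v, w)`. -/
def tri {Ω : Set Space} (u : Space → Space) (v w : VH1 Ω) : ℝ :=
  1 / 2 * pair (vol Ω) (conv u v) (vec w) - 1 / 2 * pair (vol Ω) (conv u w) (vec v)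

section Scheme

variable (P : ModelData) {Ω : Set Space} {M : ℕ}

/-- The flux `J = -b ρ'(φ) ∇μ`. -/
def flux (φ : H1 Ω) (μ : W1 3 Ω) (x : Space) : Space :=
  (-P.b * deriv P.ρ (fn φ x)) • grad μ x

/-- The function `γ_u'(φ)` on the boundary, with `β` the control action. -/
def dγ (β : Lp ℝ 2 (surf Ω)) (φ : H1 Ω) (x : Space) : ℝ :=
  P.σlg * (Real.cos P.θeq + β x) * deriv P.θ (tr φ x)

/-- The function `γ_u''(φ)` on the boundary, with `β` the control action. -/
def ddγ (β : Lp ℝ 2 (surf Ω)) (φ : H1 Ω) (x : Space) : ℝ :=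
  P.σlg * (Real.cos P.θeq + β x) * deriv (deriv P.θ) (tr φ x)

/-- The value `⟨z, e(y,u)⟩` for the control action `β = Bu` and the initial data `v₀`, `φ₀`. -/
def schemePairing (β : BdryL2 Ω (M * P.τ)) (v₀ : Hsig Ω) (φ₀ : H1 Ω) (y : Y Ω M)
    (z : Fin M → TestSpace Ω) : ℝ :=
  let v : ℕ → VH1 Ω := fun m => (timeSeq v₀ (Y.v y) m).1
  let φ : ℕ → H1 Ω := timeSeq φ₀ (Y.φ y)
  let μ : ℕ → W1 3 Ω := timeSeq 0 (Y.μ y)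
  let w : ℕ → VH1 Ω := fun m => (timeSeq 0 (fun k => (z k).1) m).1
  let Ψ : ℕ → H1 Ω := timeSeq 0 fun k => (z k).2.1
  let Φ : ℕ → H1 Ω := timeSeq 0 fun k => (z k).2.2
  let ρ : ℕ → Space → ℝ := fun m x => P.ρ (fn (φ m) x)
  let η : ℕ → Space → ℝ := fun m x => P.η (fn (φ m) x)
  ∑ m ∈ Finset.Icc 1 M,
    ((pair (vol Ω) (fun x => ((ρ m x + ρ (m - 1) x) / 2) • vec (v m) x
            - ρ (m - 1) x • vec (v (m - 1)) x) (vec (w m))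
        + P.τ * tri (fun x => ρ (m - 1) x • vec (v (m - 1)) x + flux P (φ m) (μ m) x) (v m) (w m)
        + P.τ * pair (vol Ω) (fun x => (2 * η m x) • symGrad (v m) x) (symGrad (w m))
        + P.τ * pair (vol Ω) (fun x => fn (φ (m - 1)) x • grad (μ m) x) (vec (w m))
        - P.τ * pair (vol Ω) (fun x => ρ m x • P.g) (vec (w m)))
      + (pair (vol Ω) (fun x => fn (φ m) x - fn (φ (m - 1)) x) (fn (Ψ m))
        - P.τ * pair (vol Ω) (fun x => fn (φ (m - 1)) x • vec (v (m - 1)) x) (grad (Ψ m))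
        + P.τ ^ 2 / P.ρmin *
            pair (vol Ω) (fun x => (|fn (φ (m - 1)) x| ^ 2) • grad (μ m) x) (grad (Ψ m))
        + P.τ * P.b * pair (vol Ω) (grad (μ m)) (grad (Ψ m)))
      + (P.τ * P.σ * P.ε * pair (vol Ω) (grad (φ m)) (grad (Φ m))
        + P.τ * (P.σ / P.ε) * pair (vol Ω)
            (fun x => deriv P.Wp (fn (φ m) x) + deriv P.Wm (fn (φ (m - 1)) x)) (fn (Φ m))
        - P.τ * pair (vol Ω) (fn (μ m)) (fn (Φ m))
        + P.r * pair (surf Ω) (fun x => tr (φ m) x - tr (φ (m - 1)) x) (tr (Φ m))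
        + P.τ * pair (surf Ω) (fun x => P.Sγ / 2 * (tr (φ m) x - tr (φ (m - 1)) x)
            + dγ P (meanControl P β m) (φ (m - 1)) x) (tr (Φ m))))

/-- The value `⟨e_y(y,u) d, z⟩` of the derivative at `y` in the direction `d`. Directions vanish
at time index `0`, and all sequences vanish at time index `M + 1`. -/
def derivPairing (β : BdryL2 Ω (M * P.τ)) (v₀ : Hsig Ω) (φ₀ : H1 Ω) (y d : Y Ω M)
    (z : Fin M → TestSpace Ω) : ℝ :=
  let v : ℕ → VH1 Ω := fun m => (timeSeq v₀ (Y.v y) m).1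
  let φ : ℕ → H1 Ω := timeSeq φ₀ (Y.φ y)
  let μ : ℕ → W1 3 Ω := timeSeq 0 (Y.μ y)
  let dv : ℕ → VH1 Ω := fun m => (timeSeq 0 (Y.v d) m).1
  let dφ : ℕ → H1 Ω := timeSeq 0 (Y.φ d)
  let dμ : ℕ → W1 3 Ω := timeSeq 0 (Y.μ d)
  let w : ℕ → VH1 Ω := fun m => (timeSeq 0 (fun k => (z k).1) m).1
  let Ψ : ℕ → H1 Ω := timeSeq 0 fun k => (z k).2.1
  let Φ : ℕ → H1 Ω := timeSeq 0 fun k => (z k).2.2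
  let ρ : ℕ → Space → ℝ := fun m x => P.ρ (fn (φ m) x)
  let ρ' : ℕ → Space → ℝ := fun m x => deriv P.ρ (fn (φ m) x)
  let ρ'' : ℕ → Space → ℝ := fun m x => deriv (deriv P.ρ) (fn (φ m) x)
  let η : ℕ → Space → ℝ := fun m x => P.η (fn (φ m) x)
  let η' : ℕ → Space → ℝ := fun m x => deriv P.η (fn (φ m) x)
  ∑ m ∈ Finset.Icc 1 M,
    ((1 / 2 * pair (vol Ω) (fun x => ρ' m x * fn (dφ m) x)
            (fun x => inner ℝ (vec (v m) x) (vec (w m) x)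
              + inner ℝ (vec (v (m + 1)) x) (vec (w (m + 1)) x))
        + 1 / 2 * pair (vol Ω) (fun x => (ρ m x + ρ (m - 1) x) • vec (dv m) x) (vec (w m))
        - pair (vol Ω) (fun x => (ρ' m x * fn (dφ m) x) • vec (v m) x + ρ m x • vec (dv m) x)
            (vec (w (m + 1)))
        + P.τ * tri (fun x => (ρ' m x * fn (dφ m) x) • vec (v m) x + ρ m x • vec (dv m) x)
            (v (m + 1)) (w (m + 1))
        + P.τ * tri (fun x => (-P.b * ρ'' m x * fn (dφ m) x) • grad (μ m) x
            + (-P.b * ρ' m x) • grad (dμ m) x) (v m) (w m)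
        + P.τ * tri (fun x => ρ (m - 1) x • vec (v (m - 1)) x + flux P (φ m) (μ m) x)
            (dv m) (w m)
        + P.τ * pair (vol Ω) (fun x => (2 * η' m x * fn (dφ m) x) • symGrad (v m) x)
            (symGrad (w m))
        + P.τ * pair (vol Ω) (fun x => (2 * η m x) • symGrad (dv m) x) (symGrad (w m))
        + P.τ * pair (vol Ω) (fun x => fn (dφ m) x • grad (μ (m + 1)) x) (vec (w (m + 1)))
        + P.τ * pair (vol Ω) (fun x => fn (φ (m - 1)) x • grad (dμ m) x) (vec (w m))
        - P.τ * pair (vol Ω) (fun x => (ρ' m x * fn (dφ m) x) • P.g) (vec (w m)))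
      + (pair (vol Ω) (fn (dφ m)) (fun x => fn (Ψ m) x - fn (Ψ (m + 1)) x)
        - P.τ * pair (vol Ω) (fun x => fn (dφ m) x • vec (v m) x + fn (φ m) x • vec (dv m) x)
            (grad (Ψ (m + 1)))
        + P.τ ^ 2 / P.ρmin * pair (vol Ω)
            (fun x => (2 * fn (φ m) x * fn (dφ m) x) • grad (μ (m + 1)) x) (grad (Ψ (m + 1)))
        + P.τ ^ 2 / P.ρmin *
            pair (vol Ω) (fun x => (|fn (φ (m - 1)) x| ^ 2) • grad (dμ m) x) (grad (Ψ m))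
        + P.τ * P.b * pair (vol Ω) (grad (dμ m)) (grad (Ψ m)))
      + (P.τ * P.σ * P.ε * pair (vol Ω) (grad (dφ m)) (grad (Φ m))
        + P.τ * P.σ / P.ε * pair (vol Ω)
            (fun x => deriv (deriv P.Wp) (fn (φ m) x) * fn (dφ m) x) (fn (Φ m))
        + P.τ * P.σ / P.ε * pair (vol Ω)
            (fun x => deriv (deriv P.Wm) (fn (φ m) x) * fn (dφ m) x) (fn (Φ (m + 1)))
        - P.τ * pair (vol Ω) (fn (dμ m)) (fn (Φ m))
        + P.r * pair (surf Ω) (tr (dφ m)) (fun x => tr (Φ m) x - tr (Φ (m + 1)) x)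
        + P.τ * (P.Sγ / 2 * pair (surf Ω) (tr (dφ m)) (fun x => tr (Φ m) x - tr (Φ (m + 1)) x)
          + pair (surf Ω) (fun x => ddγ P (meanControl P β (m + 1)) (φ m) x * tr (dφ m) x)
              (tr (Φ (m + 1))))))

end Scheme

end CHNS

end

/-!
The residual of the scheme at time index `m` involves only the states at the indices `m` and
`m - 1`, so the operator is a family of copies of one map of two consecutive states, composed with
the affine maps which send the unknown to its states; the initial state is a constant. Existence
and differentiability therefore reduce to a single time step (`isStepForm_step`,
`exists_timeStepping`). Uniqueness holds because the test triples at different time indices are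
independent (`eq_of_sum_apply_eq`).

A single step is a sum of terms, each of which pairs a field with a linear expression in the test
triple. The fields are products of functions in Lebesgue spaces whose exponents match by Hölder's
inequality, and the nonlinear coefficients are superposition operators of `C¹` functions on `L^∞`,
which are Fréchet differentiable there (`hasFDerivAt_nem`). The predicates `IsStepField` and
`IsStepForm` record a differentiable map together with pointwise formulas for its values and its two
partial derivatives; they are closed under sums, products, superposition and pairing, so that every
term is handled by a few combinators.

Three facts about Sobolev spaces are needed.

* In `a(u, v, w)` the field `u` is in `L³`, since gradients of chemical potentials are in `L³`;
  hence `v` and `w` must be in `L⁶`. This is the Gagliardo-Nirenberg-Sobolev inequality for test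
  functions, extended to their closure by Fatou's lemma (`exists_eLpNorm_six_le`).
* The trace has to be a bounded operator from `H¹(Ω)` to `L²(∂Ω)` (`trL`). On graph pieces of the
  boundary the fundamental theorem of calculus in the direction transversal to the graph bounds the
  surface integral of `|F|` by the volume integral of `|F| + |∇F|`, because the surface measure of a
  Lipschitz graph is controlled by the Lebesgue measure of its base (`exists_trace_inequality`).
  Applied to squares this is the `L²` estimate for smooth functions, which are dense in `H¹(Ω)`:
  near each point `Ω` contains a cone of directions, so that mollification with a kernel shifted
  into the cone uses only values inside `Ω` (`dense_smoothH1`).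
* The control enters through an `L²(∂Ω)` factor multiplied by `ϑ'` of the trace of the phase field,
  so traces of bounded functions have to be bounded with the same bound (`abs_tr_le`). Then the
  trace is also a bounded operator from `H¹(Ω) ∩ L^∞(Ω)` to `L^∞(∂Ω)` (`trTopL`), on which
  superposition operators are differentiable.

In the derivative, the variation of the state at index `m` appears in the steps `m` and `m + 1`.
Collecting both contributions at the index `m` is a shift of the summation index, whose boundary
terms vanish because directions vanish at index `0` and test triples at index `M + 1`
(`stepCurrent_add_stepPrevious`, `sum_residualDeriv_eq`). The block triangular structure is read
off the formulas for the two partial derivatives: they vanish for vanishing directions, and the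
equations for the phase field and the chemical potential do not contain the current velocity
(`stepCurrent_eq_zero`).
-/


noncomputable section

namespace CHNS

/-! ### Weak gradients -/

theorem gradient_apply (F : Space → ℝ) (x : Space) (i : Fin 3) :
    gradient F x i = fderiv ℝ F x (EuclideanSpace.single i 1) := by
  rw [← inner_gradient_left (f := F) (x := x), EuclideanSpace.inner_single_right]
  simp

theorem norm_gradient (F : Space → ℝ) (x : Space) : ‖gradient F x‖ = ‖fderiv ℝ F x‖ := by
  simp [gradient]

theorem continuous_gradient {F : Space → ℝ} (hF : ContDiff ℝ (⊤ : ℕ∞) F) :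
    Continuous (gradient F) :=
  (InnerProductSpace.toDual ℝ Space).symm.continuous.comp (hF.continuous_fderiv (by simp))

theorem IsTestFun.mul_left {Ω : Set Space} {χ ψ : Space → ℝ} (hχ : ContDiff ℝ (⊤ : ℕ∞) χ)
    (hψ : IsTestFun Ω ψ) : IsTestFun Ω (fun x => χ x * ψ x) :=
  ⟨hχ.mul hψ.1, hψ.2.1.mul_left, (tsupport_mul_subset_right (f := χ) (g := ψ)).trans hψ.2.2⟩

theorem isFiniteMeasure_vol {Ω : Set Space} (hb : Bornology.IsBounded Ω) :
    IsFiniteMeasure (vol Ω) := ⟨by simpa using hb.measure_lt_top⟩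

theorem HasWeakGradient.congr {Ω : Set Space} {f f' : Space → ℝ} {G G' : Space → Space}
    (h : HasWeakGradient Ω f G) (hf : f =ᵐ[vol Ω] f') (hG : G =ᵐ[vol Ω] G') :
    HasWeakGradient Ω f' G' := by
  intro ψ hψ i
  have h1 : (fun x => f' x * fderiv ℝ ψ x (EuclideanSpace.single i 1)) =ᵐ[vol Ω]
      fun x => f x * fderiv ℝ ψ x (EuclideanSpace.single i 1) := by
    filter_upwards [hf] with x hx; rw [hx]
  have h2 : (fun x => ψ x * G' x i) =ᵐ[vol Ω] fun x => ψ x * G x i := by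
    filter_upwards [hG] with x hx; rw [hx]
  rw [integral_congr_ae h1, integral_congr_ae h2, h ψ hψ i]

theorem HasWeakGradient.ae_unique {p : ℝ≥0∞} [hp : Fact (1 ≤ p)] {Ω : Set Space} (hΩ : IsOpen Ω)
    {f : Space → ℝ} {G G' : Space → Space} (h : HasWeakGradient Ω f G)
    (h' : HasWeakGradient Ω f G') (hG : MemLp G p (vol Ω)) (hG' : MemLp G' p (vol Ω)) :
    G =ᵐ[vol Ω] G' := by
  have key : ∀ i : Fin 3, ∀ᵐ x ∂(vol Ω), G x i - G' x i = 0 := by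
    intro i
    rw [ae_restrict_iff' hΩ.measurableSet]
    refine hΩ.ae_eq_zero_of_integral_contDiff_smul_eq_zero (f := fun x => G x i - G' x i) ?_ ?_
    · have h1 : LocallyIntegrable (fun x => (G - G') x i) (vol Ω) := by
        have := ((EuclideanSpace.proj (𝕜 := ℝ) i).comp_memLp' (hG.sub hG'))
        exact this.locallyIntegrable hp.out
      exact locallyIntegrableOn_of_locallyIntegrable_restrict h1
    · intro g hg1 hg2 hg3
      have hg : IsTestFun Ω g := ⟨hg1, hg2, hg3⟩
      have e1 := h g hg i
      rw [h' g hg i] at e1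
      have e2 : ∫ x in Ω, g x * (G x i - G' x i) = 0 := by
        simp_rw [mul_sub]
        rw [integral_sub (integrable_test_mul hG hg i) (integrable_test_mul hG' hg i)]
        linarith
      rw [← e2]
      refine (setIntegral_eq_integral_of_forall_compl_eq_zero fun x hx => ?_).symm
      have : g x = 0 := image_eq_zero_of_notMem_tsupport fun h => hx (hg3 h)
      simp [this]
  filter_upwards [ae_all_iff.2 key] with x hx
  ext i
  exact sub_eq_zero.1 (hx i)

theorem hasWeakGradient_of_contDiff {Ω : Set Space} {F : Space → ℝ}
    (hF : ContDiff ℝ (⊤ : ℕ∞) F) : HasWeakGradient Ω F (gradient F) := by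
  intro ψ hψ i
  have hz : ∀ x ∉ Ω, ψ x = 0 := fun x hx =>
    image_eq_zero_of_notMem_tsupport fun h => hx (hψ.2.2 h)
  have hz' : ∀ x ∉ Ω, fderiv ℝ ψ x = 0 := fun x hx =>
    image_eq_zero_of_notMem_tsupport fun h => hx (hψ.2.2 (tsupport_fderiv_subset ℝ h))
  have hcF := hF.continuous
  have hcψ := hψ.1.continuous
  have hdF : Continuous fun x => fderiv ℝ F x (EuclideanSpace.single i 1) :=
    (hF.continuous_fderiv (by simp)).clm_apply continuous_const
  have hdψ : Continuous fun x => fderiv ℝ ψ x (EuclideanSpace.single i 1) :=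
    (hψ.1.continuous_fderiv (by simp)).clm_apply continuous_const
  have hsψ : HasCompactSupport fun x => fderiv ℝ ψ x (EuclideanSpace.single i 1) :=
    hψ.2.1.fderiv_apply (𝕜 := ℝ) _
  rw [setIntegral_eq_integral_of_forall_compl_eq_zero (fun x hx => by simp [hz' x hx]),
    setIntegral_eq_integral_of_forall_compl_eq_zero (fun x hx => by simp [hz x hx])]
  simp_rw [gradient_apply]
  rw [integral_mul_fderiv_eq_neg_fderiv_mul_of_integrable]
  · simp_rw [mul_comm]
  · exact (hdF.mul hcψ).integrable_of_hasCompactSupport hψ.2.1.mul_left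
  · exact (hcF.mul hdψ).integrable_of_hasCompactSupport hsψ.mul_left
  · exact (hcF.mul hcψ).integrable_of_hasCompactSupport hψ.2.1.mul_left
  · exact fun x _ => hF.differentiable (by simp) x
  · exact fun x _ => hψ.1.differentiable (by simp) x

theorem HasWeakGradient.mul_left {p : ℝ≥0∞} [hp : Fact (1 ≤ p)] {Ω : Set Space} {f : Space → ℝ}
    {G : Space → Space} (h : HasWeakGradient Ω f G) (hf : MemLp f p (vol Ω))
    (hG : MemLp G p (vol Ω)) {χ : Space → ℝ} (hχ : ContDiff ℝ (⊤ : ℕ∞) χ) :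
    HasWeakGradient Ω (fun x => χ x * f x) (fun x => χ x • G x + f x • gradient χ x) := by
  intro ψ hψ i
  set e : Space := EuclideanSpace.single i 1
  have hχψ := hψ.mul_left hχ
  have hd : ∀ x, fderiv ℝ (fun x => χ x * ψ x) x e =
      χ x * fderiv ℝ ψ x e + ψ x * fderiv ℝ χ x e := by
    intro x
    rw [fderiv_fun_mul (hχ.differentiable (by simp) x) (hψ.1.differentiable (by simp) x)]
    simp
  have hL : LocallyIntegrable f (vol Ω) := hf.locallyIntegrable hp.out
  have hdχ : Continuous fun x => fderiv ℝ χ x e :=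
    (hχ.continuous_fderiv (by simp)).clm_apply continuous_const
  have i2 : Integrable (fun x => f x * (ψ x * fderiv ℝ χ x e)) (vol Ω) := by
    simpa using hL.integrable_smul_right_of_hasCompactSupport (hψ.1.continuous.mul hdχ)
      hψ.2.1.mul_right
  have i1 := integrable_mul_testDeriv hf hχψ i
  have hkey := h _ hχψ i
  have e1 : ∫ x in Ω, χ x * f x * fderiv ℝ ψ x e =
      (∫ x in Ω, f x * fderiv ℝ (fun x => χ x * ψ x) x e) -
        ∫ x in Ω, f x * (ψ x * fderiv ℝ χ x e) := by
    rw [← integral_sub i1 i2]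
    refine integral_congr_ae (Eventually.of_forall fun x => ?_)
    change _ = f x * fderiv ℝ (fun x => χ x * ψ x) x e - _
    rw [hd x]; ring
  rw [e1, hkey]
  have hI := integrable_test_mul hG hχψ i
  rw [← neg_add', ← integral_add hI i2]
  congr 1
  refine integral_congr_ae (Eventually.of_forall fun x => ?_)
  simp only [PiLp.add_apply, PiLp.smul_apply, gradient_apply, smul_eq_mul, e]; ring

/-! ### Elements of Sobolev spaces -/

section Sobolev

variable {p : ℝ≥0∞} [hp : Fact (1 ≤ p)] {Ω : Set Space}

/-- The element of `W^{1,p}(Ω)` with given representatives of the function and its gradient. -/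
def mkW1 (f : Space → ℝ) (G : Space → Space) (hf : MemLp f p (vol Ω)) (hG : MemLp G p (vol Ω))
    (h : HasWeakGradient Ω f G) : W1 p Ω :=
  ⟨WithLp.toLp p (hf.toLp f, hG.toLp G), h.congr hf.coeFn_toLp.symm hG.coeFn_toLp.symm⟩

theorem fn_mkW1 {f : Space → ℝ} {G : Space → Space} (hf : MemLp f p (vol Ω))
    (hG : MemLp G p (vol Ω)) (h : HasWeakGradient Ω f G) :
    fn (mkW1 f G hf hG h) =ᵐ[vol Ω] f := hf.coeFn_toLp

theorem grad_mkW1 {f : Space → ℝ} {G : Space → Space} (hf : MemLp f p (vol Ω))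
    (hG : MemLp G p (vol Ω)) (h : HasWeakGradient Ω f G) :
    grad (mkW1 f G hf hG h) =ᵐ[vol Ω] G := hG.coeFn_toLp

variable (p Ω) in
/-- The inclusion of `W^{1,p}(Ω)` into `L^p(Ω)`. -/
def fnL : W1 p Ω →L[ℝ] Lp ℝ p (vol Ω) :=
  (WithLp.fstL p ℝ (Lp ℝ p (vol Ω)) (Lp Space p (vol Ω))).comp (W1 p Ω).subtypeL

variable (p Ω) in
/-- The weak gradient as an operator from `W^{1,p}(Ω)` to `L^p(Ω)³`. -/
def gradL : W1 p Ω →L[ℝ] Lp Space p (vol Ω) :=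
  (WithLp.sndL p ℝ (Lp ℝ p (vol Ω)) (Lp Space p (vol Ω))).comp (W1 p Ω).subtypeL

theorem memLp_fn (f : W1 p Ω) : MemLp (fn f) p (vol Ω) := Lp.memLp (fnL p Ω f)

theorem memLp_grad (f : W1 p Ω) : MemLp (grad f) p (vol Ω) := Lp.memLp (gradL p Ω f)

theorem hasWeakGradient_fn (f : W1 p Ω) : HasWeakGradient Ω (fn f) (grad f) := f.2

theorem norm_fnL_le (f : W1 p Ω) : ‖fnL p Ω f‖ ≤ ‖f‖ := WithLp.norm_fst_le _ f.1

theorem norm_gradL_le (f : W1 p Ω) : ‖gradL p Ω f‖ ≤ ‖f‖ := WithLp.norm_snd_le _ f.1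

theorem tendsto_W1_iff {ι : Type*} {l : Filter ι} {f : ι → W1 p Ω} {f₀ : W1 p Ω} :
    Tendsto f l (𝓝 f₀) ↔ Tendsto (fun k => fnL p Ω (f k)) l (𝓝 (fnL p Ω f₀)) ∧
      Tendsto (fun k => gradL p Ω (f k)) l (𝓝 (gradL p Ω f₀)) := by
  refine ⟨fun h => ⟨((fnL p Ω).continuous.tendsto _).comp h,
    ((gradL p Ω).continuous.tendsto _).comp h⟩, fun h => ?_⟩
  rw [tendsto_subtype_rng]
  exact ((WithLp.prod_continuous_toLp p _ _).tendsto _).comp (h.1.prodMk_nhds h.2)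

theorem fn_add (f g : W1 p Ω) : fn (f + g) =ᵐ[vol Ω] fun x => fn f x + fn g x :=
  Lp.coeFn_add _ _

theorem grad_add (f g : W1 p Ω) : grad (f + g) =ᵐ[vol Ω] fun x => grad f x + grad g x :=
  Lp.coeFn_add _ _

theorem fn_sub (f g : W1 p Ω) : fn (f - g) =ᵐ[vol Ω] fun x => fn f x - fn g x :=
  Lp.coeFn_sub _ _

theorem fn_smul (c : ℝ) (f : W1 p Ω) : fn (c • f) =ᵐ[vol Ω] fun x => c * fn f x :=
  Lp.coeFn_smul _ _

theorem fn_zero : fn (0 : W1 p Ω) =ᵐ[vol Ω] fun _ => 0 := Lp.coeFn_zero _ _ _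

theorem grad_zero : grad (0 : W1 p Ω) =ᵐ[vol Ω] fun _ => 0 := Lp.coeFn_zero _ _ _

theorem W1_ext {f g : W1 p Ω} (h1 : fn f =ᵐ[vol Ω] fn g) (h2 : grad f =ᵐ[vol Ω] grad g) :
    f = g :=
  Subtype.ext ((WithLp.ofLp_injective p) (Prod.ext (Lp.ext h1) (Lp.ext h2)))

theorem eq_zero_of_fn_ae_eq_zero (hΩ : IsOpen Ω) {f : W1 p Ω} (h : fn f =ᵐ[vol Ω] fun _ => 0) :
    f = 0 := by
  refine W1_ext (h.trans fn_zero.symm) ?_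
  exact (hasWeakGradient_fn f).ae_unique (p := p) hΩ ((hasWeakGradient_fn (0 : W1 p Ω)).congr
    (fn_zero.trans h.symm) EventuallyEq.rfl) (memLp_grad f) (memLp_grad _)

theorem memLp_of_continuous_of_isBounded {E : Type*} [NormedAddCommGroup E]
    {p : ℝ≥0∞} (hb : Bornology.IsBounded Ω) {F : Space → E} (hF : Continuous F)
    [SecondCountableTopology E] :
    MemLp F p (vol Ω) := by
  have := isFiniteMeasure_vol hb
  obtain ⟨C, hC⟩ := hb.isCompact_closure.exists_bound_of_continuousOn hF.continuousOn
  refine MemLp.of_bound hF.aestronglyMeasurable C ?_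
  have hm : ∀ᵐ x ∂(vol Ω), x ∈ closure Ω :=
    (ae_mono (Measure.restrict_mono subset_closure le_rfl))
      (ae_restrict_mem isClosed_closure.measurableSet)
  filter_upwards [hm] with x hx using hC x hx

/-- The restriction to `Ω` of a smooth function on the whole space. -/
def ofSmooth (hb : Bornology.IsBounded Ω) (F : Space → ℝ) (hF : ContDiff ℝ (⊤ : ℕ∞) F) : W1 p Ω :=
  mkW1 F (gradient F) (memLp_of_continuous_of_isBounded hb hF.continuous)
    (memLp_of_continuous_of_isBounded hb (continuous_gradient hF)) (hasWeakGradient_of_contDiff hF)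

theorem memLp_bdd_mul {p : ℝ≥0∞} {Ω : Set Space} {χ f : Space → ℝ} (hχ : Continuous χ) (hc : HasCompactSupport χ)
    (hf : MemLp f p (vol Ω)) : MemLp (fun x => χ x * f x) p (vol Ω) := by
  obtain ⟨C, hC⟩ := hc.exists_bound_of_continuous hχ
  exact hf.of_le_mul (c := C) (hχ.aestronglyMeasurable.mul hf.1)
    (Eventually.of_forall fun x => by rw [norm_mul]; gcongr; exact hC x)

theorem memLp_smul_add_smul_gradient {p : ℝ≥0∞} {Ω : Set Space} {χ f : Space → ℝ} {G : Space → Space}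
    (hχ : ContDiff ℝ (⊤ : ℕ∞) χ) (hc : HasCompactSupport χ)
    (hf : MemLp f p (vol Ω)) (hG : MemLp G p (vol Ω)) :
    MemLp (fun x => χ x • G x + f x • gradient χ x) p (vol Ω) := by
  refine MemLp.add ?_ ?_
  · obtain ⟨C, hC⟩ := hc.exists_bound_of_continuous hχ.continuous
    exact hG.of_le_mul (c := C) (hχ.continuous.aestronglyMeasurable.smul hG.1)
      (Eventually.of_forall fun x => by rw [norm_smul]; gcongr; exact hC x)
  · obtain ⟨C, hC⟩ := (hc.fderiv (𝕜 := ℝ)).exists_bound_of_continuous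
      (hχ.continuous_fderiv (by simp))
    refine hf.of_le_mul (c := C) (hf.1.smul (continuous_gradient hχ).aestronglyMeasurable)
      (Eventually.of_forall fun x => ?_)
    rw [norm_smul, mul_comm, norm_gradient]; gcongr; exact hC x

theorem fn_ofSmooth (hb : Bornology.IsBounded Ω) {F : Space → ℝ} (hF : ContDiff ℝ (⊤ : ℕ∞) F) :
    fn (ofSmooth hb F hF : W1 p Ω) =ᵐ[vol Ω] F := fn_mkW1 _ _ _

theorem grad_ofSmooth (hb : Bornology.IsBounded Ω) {F : Space → ℝ} (hF : ContDiff ℝ (⊤ : ℕ∞) F) :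
    grad (ofSmooth hb F hF : W1 p Ω) =ᵐ[vol Ω] gradient F := grad_mkW1 _ _ _

/-- The product of a smooth compactly supported function and an element of `W^{1,p}(Ω)`. -/
def mulSmooth (χ : Space → ℝ) (hχ : ContDiff ℝ (⊤ : ℕ∞) χ) (hc : HasCompactSupport χ)
    (f : W1 p Ω) : W1 p Ω :=
  mkW1 _ _ (memLp_bdd_mul hχ.continuous hc (memLp_fn f))
    (memLp_smul_add_smul_gradient hχ hc (memLp_fn f) (memLp_grad f))
    ((hasWeakGradient_fn f).mul_left (memLp_fn f) (memLp_grad f) hχ)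

theorem fn_mulSmooth {χ : Space → ℝ} (hχ : ContDiff ℝ (⊤ : ℕ∞) χ) (hc : HasCompactSupport χ)
    (f : W1 p Ω) : fn (mulSmooth χ hχ hc f) =ᵐ[vol Ω] fun x => χ x * fn f x := fn_mkW1 _ _ _

theorem grad_mulSmooth {χ : Space → ℝ} (hχ : ContDiff ℝ (⊤ : ℕ∞) χ) (hc : HasCompactSupport χ)
    (f : W1 p Ω) : grad (mulSmooth χ hχ hc f) =ᵐ[vol Ω]
      fun x => χ x • grad f x + fn f x • gradient χ x := grad_mkW1 _ _ _

end Sobolev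

/-! ### The trace inequality for continuously differentiable functions -/

/-- The point of `ℝ³` with first two coordinates `y` and last coordinate `t`. -/
def joinLast (y : EuclideanSpace ℝ (Fin 2)) (t : ℝ) : Space :=
  WithLp.toLp 2 (Fin.snoc (α := fun _ : Fin 3 => ℝ) y.ofLp t)

/-- The first two coordinates of a point of `ℝ³`. -/
def dropLast (x : Space) : EuclideanSpace ℝ (Fin 2) := WithLp.toLp 2 fun i => x i.castSucc

@[simp] theorem joinLast_castSucc (y : EuclideanSpace ℝ (Fin 2)) (t : ℝ) (i : Fin 2) :
    joinLast y t i.castSucc = y i := by simp [joinLast, Fin.snoc_castSucc (α := fun _ : Fin 3 => ℝ)]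

@[simp] theorem joinLast_last (y : EuclideanSpace ℝ (Fin 2)) (t : ℝ) :
    joinLast y t (Fin.last 2) = t := Fin.snoc_last (α := fun _ : Fin 3 => ℝ) t y.ofLp

@[simp] theorem dropLast_joinLast (y : EuclideanSpace ℝ (Fin 2)) (t : ℝ) :
    dropLast (joinLast y t) = y := by
  ext i; exact joinLast_castSucc y t i

theorem joinLast_dropLast (x : Space) : joinLast (dropLast x) (x (Fin.last 2)) = x := by
  ext i
  refine Fin.lastCases ?_ (fun j => ?_) i
  · exact joinLast_last _ _
  · exact joinLast_castSucc _ _ _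

theorem joinLast_add (y y' : EuclideanSpace ℝ (Fin 2)) (t t' : ℝ) :
    joinLast (y + y') (t + t') = joinLast y t + joinLast y' t' := by
  ext i
  refine Fin.lastCases ?_ (fun j => ?_) i
  · rw [PiLp.add_apply, joinLast_last, joinLast_last, joinLast_last]
  · rw [PiLp.add_apply, joinLast_castSucc, joinLast_castSucc, joinLast_castSucc, PiLp.add_apply]

theorem joinLast_smul (c : ℝ) (y : EuclideanSpace ℝ (Fin 2)) (t : ℝ) :
    joinLast (c • y) (c * t) = c • joinLast y t := by
  ext i
  refine Fin.lastCases ?_ (fun j => ?_) i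
  · rw [PiLp.smul_apply, joinLast_last, joinLast_last, smul_eq_mul]
  · rw [PiLp.smul_apply, joinLast_castSucc, joinLast_castSucc, PiLp.smul_apply]

theorem joinLast_sub (y y' : EuclideanSpace ℝ (Fin 2)) (t t' : ℝ) :
    joinLast (y - y') (t - t') = joinLast y t - joinLast y' t' := by
  rw [eq_sub_iff_add_eq, ← joinLast_add, sub_add_cancel, sub_add_cancel]

theorem norm_joinLast_sq (y : EuclideanSpace ℝ (Fin 2)) (t : ℝ) :
    ‖joinLast y t‖ ^ 2 = ‖y‖ ^ 2 + t ^ 2 := by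
  rw [EuclideanSpace.norm_sq_eq, EuclideanSpace.norm_sq_eq, Fin.sum_univ_castSucc]
  simp only [joinLast_castSucc, joinLast_last, Real.norm_eq_abs, sq_abs]

theorem norm_joinLast_le (y : EuclideanSpace ℝ (Fin 2)) (t : ℝ) :
    ‖joinLast y t‖ ≤ ‖y‖ + |t| := by
  refine abs_le_of_sq_le_sq' ?_ (by positivity) |>.2
  rw [norm_joinLast_sq, add_sq, sq_abs]
  have := mul_nonneg (norm_nonneg y) (abs_nonneg t)
  linarith

theorem norm_dropLast_le (x : Space) : ‖dropLast x‖ ≤ ‖x‖ := by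
  refine abs_le_of_sq_le_sq' ?_ (by positivity) |>.2
  conv_rhs => rw [← joinLast_dropLast x, norm_joinLast_sq]
  nlinarith [sq_nonneg (x (Fin.last 2))]

theorem dropLast_sub (x y : Space) : dropLast (x - y) = dropLast x - dropLast y := by
  ext i; rfl

theorem norm_joinLast_zero_one : ‖joinLast 0 1‖ = 1 := by
  have := norm_joinLast_sq 0 1
  rw [norm_zero] at this
  nlinarith [norm_nonneg (joinLast 0 1)]

theorem measurePreserving_joinLast :
    MeasurePreserving (fun q : EuclideanSpace ℝ (Fin 2) × ℝ => joinLast q.1 q.2)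
      (volume.prod volume) volume := by
  have h1 := (volume_preserving_piFinSuccAbove (fun _ : Fin 3 => ℝ) (Fin.last 2)).symm
  have h2 := (PiLp.volume_preserving_toLp (Fin 3))
  have h3 : MeasurePreserving (fun q : EuclideanSpace ℝ (Fin 2) × ℝ => (q.2, q.1.ofLp))
      (volume.prod volume) (volume.prod volume) :=
    ((MeasurePreserving.id volume).prod (PiLp.volume_preserving_ofLp (Fin 2))).comp
      Measure.measurePreserving_swap
  have h4 := h2.comp (h1.comp h3)
  have h5 : (fun q : EuclideanSpace ℝ (Fin 2) × ℝ => joinLast q.1 q.2) = WithLp.toLp 2 ∘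
      (MeasurableEquiv.piFinSuccAbove (fun _ : Fin 3 => ℝ) (Fin.last 2)).symm ∘
        fun q => (q.2, q.1.ofLp) := by
    funext q
    ext i
    refine Fin.lastCases ?_ (fun j => ?_) i
    · rw [joinLast_last]
      simp [MeasurableEquiv.piFinSuccAbove, -Fin.reduceLast]
    · rw [joinLast_castSucc]
      simp [MeasurableEquiv.piFinSuccAbove, -Fin.reduceLast]
  rw [h5]
  exact h4

/-- Integration over `ℝ³` along vertical lines in rotated coordinates, each line being shifted
by a measurable height. -/
theorem lintegral_joinLast_shift (R : Space ≃ₗᵢ[ℝ] Space) {h : EuclideanSpace ℝ (Fin 2) → ℝ}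
    {G : Space → ℝ≥0∞} (hG : Measurable G) :
    ∫⁻ y, ∫⁻ t, G (R.symm (joinLast y (h y + t))) = ∫⁻ x, G x := by
  have h1 : ∀ y, ∫⁻ t, G (R.symm (joinLast y (h y + t))) = ∫⁻ t, G (R.symm (joinLast y t)) :=
    fun y => lintegral_add_left_eq_self (fun t => G (R.symm (joinLast y t))) (h y)
  simp_rw [h1]
  have hG' : Measurable fun x => G (R.symm x) := hG.comp R.symm.continuous.measurable
  rw [← R.symm.measurePreserving.lintegral_comp hG, ← measurePreserving_joinLast.lintegral_comp hG',
    lintegral_prod]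
  exact (hG'.comp measurePreserving_joinLast.measurable).aemeasurable

section Graph

variable (R : Space ≃ₗᵢ[ℝ] Space) (h : EuclideanSpace ℝ (Fin 2) → ℝ)

/-- The parametrization of the graph of `h` in the coordinates rotated by `R`. -/
def graphMap (y : EuclideanSpace ℝ (Fin 2)) : Space := R.symm (joinLast y (h y))

variable {h} {K : ℝ≥0}

theorem lipschitzWith_graphMap (hh : LipschitzWith K h) : LipschitzWith (1 + K) (graphMap R h) := by
  refine LipschitzWith.of_dist_le_mul fun y y' => ?_
  rw [dist_eq_norm, graphMap, graphMap, ← map_sub, LinearIsometryEquiv.norm_map, ← joinLast_sub]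
  refine (norm_joinLast_le _ _).trans ?_
  have := hh.dist_le_mul y y'
  rw [Real.dist_eq] at this
  rw [← dist_eq_norm]
  push_cast
  linarith

/-- The surface measure of a graph is bounded by a multiple of Lebesgue measure in the
parameter plane. -/
theorem setLIntegral_graph_le (hh : LipschitzWith K h) {S : Set Space} (hS : MeasurableSet S)
    (hSr : S ⊆ range (graphMap R h)) {G : Space → ℝ≥0∞} (hG : Measurable G) :
    ∫⁻ x in S, G x ∂μHE[2] ≤
      (1 + K : ℝ≥0) ^ 2 * ∫⁻ y in graphMap R h ⁻¹' S, G (graphMap R h y) := by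
  have hl := lipschitzWith_graphMap R hh
  have hm := hl.continuous.measurable
  have key : (μHE[2]).restrict S ≤
      (((1 + K : ℝ≥0) ^ 2 : ℝ≥0) : ℝ≥0∞) • (Measure.map (graphMap R h) volume).restrict S := by
    refine Measure.le_iff.2 fun E hE => ?_
    rw [Measure.restrict_apply hE, Measure.smul_apply, Measure.restrict_apply hE,
      Measure.map_apply hm (hE.inter hS), smul_eq_mul]
    have h1 : E ∩ S = graphMap R h '' (graphMap R h ⁻¹' (E ∩ S)) := by
      rw [image_preimage_eq_inter_range, inter_eq_left.2 (inter_subset_right.trans hSr)]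
    conv_lhs => rw [h1]
    rw [← EuclideanSpace.euclideanHausdorffMeasure_eq_volume, Measure.euclideanHausdorffMeasure_def,
      Measure.euclideanHausdorffMeasure_def, Measure.smul_apply, Measure.smul_apply]
    have h2 := (hl.lipschitzOnWith (s := graphMap R h ⁻¹' (E ∩ S))).hausdorffMeasure_image_le
      (d := 2) (by norm_num)
    simp only [ENNReal.smul_def, smul_eq_mul]
    rw [mul_left_comm]
    gcongr
    simpa using h2
  refine (lintegral_mono' key le_rfl).trans_eq ?_
  rw [lintegral_smul_measure, setLIntegral_map hS hG hm, smul_eq_mul, ENNReal.coe_pow]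

end Graph

/-- The value of a function at an endpoint is controlled by the mean of the function and its
derivative over an interval. -/
theorem enorm_le_lintegral_segment {f : ℝ → ℝ} (hf : ContDiff ℝ 1 f) {s : ℝ} (hs : 0 < s) :
    ‖f 0‖ₑ ≤ ∫⁻ t in Ioc 0 s, (ENNReal.ofReal s⁻¹ * ‖f t‖ₑ + ‖deriv f t‖ₑ) := by
  have hd : Continuous (deriv f) := hf.continuous_deriv le_rfl
  have hc := hf.continuous
  set A := ∫ t in (0 : ℝ)..s, |deriv f t|
  have h1 : ∀ t ∈ Icc 0 s, |f 0| ≤ |f t| + A := by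
    intro t ht
    have e : ∫ r in (0 : ℝ)..t, deriv f r = f t - f 0 :=
      intervalIntegral.integral_deriv_eq_sub (fun x _ => hf.differentiable one_ne_zero x)
        (hd.intervalIntegrable _ _)
    have e2 : |f t - f 0| ≤ A := by
      rw [← e]
      refine (intervalIntegral.abs_integral_le_integral_abs ht.1).trans ?_
      exact intervalIntegral.integral_mono_interval le_rfl ht.1 ht.2
        (Eventually.of_forall fun x => abs_nonneg _) (hd.abs.intervalIntegrable _ _)
    have := abs_sub_abs_le_abs_sub (f 0) (f t)
    rw [abs_sub_comm] at this
    linarith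
  have h2 : |f 0| ≤ ∫ t in (0 : ℝ)..s, (s⁻¹ * |f t| + |deriv f t|) := by
    have e1 : ∫ t in (0 : ℝ)..s, |f 0| ≤ ∫ t in (0 : ℝ)..s, (|f t| + A) :=
      intervalIntegral.integral_mono_on hs.le (continuous_const.intervalIntegrable _ _)
        ((hc.abs.add continuous_const).intervalIntegrable _ _) h1
    rw [intervalIntegral.integral_add (hc.abs.intervalIntegrable _ _)
      (continuous_const.intervalIntegrable _ _), intervalIntegral.integral_const,
      intervalIntegral.integral_const, sub_zero, smul_eq_mul, smul_eq_mul] at e1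
    rw [intervalIntegral.integral_add ((hc.abs.const_mul _).intervalIntegrable _ _)
      (hd.abs.intervalIntegrable _ _), intervalIntegral.integral_const_mul]
    calc |f 0| = s⁻¹ * (s * |f 0|) := by field_simp
      _ ≤ s⁻¹ * ((∫ t in (0 : ℝ)..s, |f t|) + s * A) := by gcongr
      _ = _ := by rw [mul_add, inv_mul_cancel_left₀ hs.ne']
  rw [intervalIntegral.integral_of_le hs.le] at h2
  rw [← ofReal_norm, Real.norm_eq_abs]
  refine (ENNReal.ofReal_le_ofReal h2).trans ?_
  rw [ofReal_integral_eq_lintegral_ofReal]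
  · refine lintegral_mono fun t => ?_
    rw [ENNReal.ofReal_add (by positivity) (abs_nonneg _), ENNReal.ofReal_mul (by positivity),
      ← ofReal_norm, ← ofReal_norm]
    rfl
  · have : Continuous fun t => s⁻¹ * |f t| + |deriv f t| := by fun_prop
    exact (this.integrableOn_Icc (a := 0) (b := s)).mono_set Ioc_subset_Icc_self
  · exact Eventually.of_forall fun t => by positivity

/-- Near a boundary point, the boundary of `Ω` is the graph, and the points above it lie in `Ω`. -/
theorem frontier_eq_graph {Ω : Set Space} (hΩ : IsOpen Ω) {R : Space ≃ₗᵢ[ℝ] Space}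
    {h : EuclideanSpace ℝ (Fin 2) → ℝ} (hh : Continuous h) {x₀ : Space} {δ : ℝ}
    (H : ∀ x ∈ Metric.ball x₀ δ, (x ∈ Ω ↔ h (dropLast (R x)) < R x (Fin.last 2))) {x : Space}
    (hx : x ∈ Metric.ball x₀ δ) :
    (x ∈ closure Ω → h (dropLast (R x)) ≤ R x (Fin.last 2)) ∧
      (x ∈ frontier Ω → h (dropLast (R x)) = R x (Fin.last 2)) := by
  have hcl : x ∈ closure Ω → h (dropLast (R x)) ≤ R x (Fin.last 2) := by
    intro hc
    by_contra! hlt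
    have hd : Continuous dropLast := by unfold dropLast; fun_prop
    have hO : IsOpen {z : Space | R z (Fin.last 2) < h (dropLast (R z))} :=
      isOpen_lt ((EuclideanSpace.proj (𝕜 := ℝ) (Fin.last 2)).continuous.comp R.continuous)
        (hh.comp (hd.comp R.continuous))
    obtain ⟨z, ⟨hz1, hz2⟩, hz3⟩ := mem_closure_iff.1 hc _ (hO.inter Metric.isOpen_ball) ⟨hlt, hx⟩
    exact absurd ((H z hz2).1 hz3) (not_lt.2 (le_of_lt hz1))
  refine ⟨hcl, fun hf => le_antisymm (hcl (frontier_subset_closure hf)) ?_⟩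
  by_contra! hlt
  rw [hΩ.frontier_eq] at hf
  exact hf.2 ((H x hx).2 hlt)

theorem local_trace_inequality {Ω : Set Space} (hΩ : IsOpen Ω) {R : Space ≃ₗᵢ[ℝ] Space}
    {h : EuclideanSpace ℝ (Fin 2) → ℝ} {K : ℝ≥0} (hh : LipschitzWith K h) {x₀ : Space} {δ : ℝ}
    (hδ : 0 < δ)
    (H : ∀ x ∈ Metric.ball x₀ δ, (x ∈ Ω ↔ h (dropLast (R x)) < R x (Fin.last 2)))
    {F : Space → ℝ} (hF : ContDiff ℝ 1 F) :
    ∫⁻ x in frontier Ω ∩ Metric.ball x₀ (δ / 2), ‖F x‖ₑ ∂μHE[2] ≤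
      (1 + K : ℝ≥0) ^ 2 *
        ∫⁻ x in Ω, (ENNReal.ofReal (δ / 2)⁻¹ * ‖F x‖ₑ + ‖fderiv ℝ F x‖ₑ) := by
  set S := frontier Ω ∩ Metric.ball x₀ (δ / 2)
  set s := δ / 2
  have hs : 0 < s := half_pos hδ
  have hS : MeasurableSet S := isClosed_frontier.measurableSet.inter measurableSet_ball
  have hsub : Metric.ball x₀ s ⊆ Metric.ball x₀ δ := Metric.ball_subset_ball (by simp [s, hδ.le])
  have hdF := hF.continuous_fderiv one_ne_zero
  have hcF := hF.continuous
  have hSr : S ⊆ range (graphMap R h) := by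
    rintro x ⟨hx1, hx2⟩
    refine ⟨dropLast (R x), ?_⟩
    rw [graphMap, (frontier_eq_graph hΩ hh.continuous H (hsub hx2)).2 hx1, joinLast_dropLast,
      R.symm_apply_apply]
  refine (setLIntegral_graph_le R hh hS hSr hcF.measurable.enorm).trans ?_
  gcongr
  set G : Space → ℝ≥0∞ := Ω.indicator
    fun x => ENNReal.ofReal s⁻¹ * ‖F x‖ₑ + ‖fderiv ℝ F x‖ₑ
  have hGm : Measurable G := Measurable.indicator
    ((hcF.measurable.enorm.const_mul _).add hdF.measurable.enorm) hΩ.measurableSet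
  rw [← lintegral_indicator hΩ.measurableSet, ← lintegral_joinLast_shift R (h := h) hGm]
  have hgm : MeasurableSet (graphMap R h ⁻¹' S) :=
    (lipschitzWith_graphMap R hh).continuous.measurable hS
  refine (setLIntegral_mono' hgm fun y hy => ?_).trans (setLIntegral_le_lintegral _ _)
  set e : Space := R.symm (joinLast 0 1)
  have he : ‖e‖ = 1 := by rw [LinearIsometryEquiv.norm_map, norm_joinLast_zero_one]
  have hline : ∀ t : ℝ, R.symm (joinLast y (h y + t)) = graphMap R h y + t • e := by
    intro t
    rw [graphMap, ← map_smul, ← map_add, ← joinLast_smul, ← joinLast_add]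
    simp
  -- the vertical segment of length `s` above a boundary point stays inside `Ω`
  have hin : ∀ t ∈ Ioc 0 s, graphMap R h y + t • e ∈ Ω := by
    intro t ht
    have hb : graphMap R h y + t • e ∈ Metric.ball x₀ δ := by
      have h1 : dist (graphMap R h y) x₀ < s := hy.2
      have h2 : dist (graphMap R h y + t • e) (graphMap R h y) ≤ s := by
        rw [dist_eq_norm, add_sub_cancel_left, norm_smul, he, mul_one, Real.norm_eq_abs,
          abs_of_pos ht.1]
        exact ht.2
      have h3 := dist_triangle (graphMap R h y + t • e) (graphMap R h y) x₀
      have h4 : s + s = δ := add_halves δ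
      exact Metric.mem_ball.2 (by linarith)
    rw [H _ hb, ← hline, R.apply_symm_apply, dropLast_joinLast, joinLast_last]
    linarith [ht.1]
  have hf : ContDiff ℝ 1 fun t : ℝ => F (graphMap R h y + t • e) :=
    hF.comp (contDiff_const.add (contDiff_id.smul contDiff_const))
  have h1 := enorm_le_lintegral_segment hf hs
  simp only [zero_smul, add_zero] at h1
  refine h1.trans ?_
  refine (setLIntegral_mono' measurableSet_Ioc fun t ht => ?_).trans (setLIntegral_le_lintegral _ _)
  have hGt : G (graphMap R h y + t • e) = ENNReal.ofReal s⁻¹ * ‖F (graphMap R h y + t • e)‖ₑ +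
      ‖fderiv ℝ F (graphMap R h y + t • e)‖ₑ := indicator_of_mem (hin t ht) _
  rw [hline, hGt]
  gcongr
  have hdd : HasDerivAt (fun t : ℝ => F (graphMap R h y + t • e))
      (fderiv ℝ F (graphMap R h y + t • e) e) t := by
    have h2 : HasDerivAt (fun t : ℝ => graphMap R h y + t • e) e t := by
      simpa using ((hasDerivAt_id t).smul_const e).const_add (graphMap R h y)
    exact ((hF.differentiable one_ne_zero _).hasFDerivAt).comp_hasDerivAt t h2
  rw [hdd.deriv, enorm_le_iff_norm_le]
  simpa [he] using (fderiv ℝ F (graphMap R h y + t • e)).le_opNorm e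

/-- The trace inequality on a bounded Lipschitz domain, with values in `L¹`. -/
theorem exists_trace_inequality {Ω : Set Space} (hΩ : IsBoundedLipschitzDomain Ω) :
    ∃ C : ℝ≥0, ∀ F : Space → ℝ, ContDiff ℝ 1 F →
      ∫⁻ x, ‖F x‖ₑ ∂(surf Ω) ≤ C * ∫⁻ x in Ω, (‖F x‖ₑ + ‖fderiv ℝ F x‖ₑ) := by
  have hcomp : IsCompact (frontier Ω) :=
    hΩ.isBounded.isCompact_closure.of_isClosed_subset isClosed_frontier frontier_subset_closure
  suffices H : ∃ C : ℝ≥0, ∀ F : Space → ℝ, ContDiff ℝ 1 F →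
      ∫⁻ x in frontier Ω ∩ frontier Ω, ‖F x‖ₑ ∂μHE[2] ≤
        C * ∫⁻ x in Ω, (‖F x‖ₑ + ‖fderiv ℝ F x‖ₑ) by simpa using H
  refine hcomp.induction_on (p := fun S => ∃ C : ℝ≥0, ∀ F : Space → ℝ, ContDiff ℝ 1 F →
      ∫⁻ x in frontier Ω ∩ S, ‖F x‖ₑ ∂μHE[2] ≤ C * ∫⁻ x in Ω, (‖F x‖ₑ + ‖fderiv ℝ F x‖ₑ))
    ⟨0, by simp⟩ ?_ ?_ ?_
  · rintro s t hst ⟨C, hC⟩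
    exact ⟨C, fun F hF => (lintegral_mono_set (by gcongr)).trans (hC F hF)⟩
  · rintro s t ⟨C, hC⟩ ⟨D, hD⟩
    refine ⟨C + D, fun F hF => ?_⟩
    rw [inter_union_distrib_left, ENNReal.coe_add, add_mul]
    exact (lintegral_union_le _ _ _).trans (add_le_add (hC F hF) (hD F hF))
  · intro x₀ hx₀
    obtain ⟨R, h, K, δ, hh, hδ, H⟩ := hΩ.graph x₀ hx₀
    refine ⟨Metric.ball x₀ (δ / 2), mem_nhdsWithin_of_mem_nhds (Metric.ball_mem_nhds _ (half_pos hδ)),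
      (1 + K) ^ 2 * (Real.toNNReal (δ / 2)⁻¹ + 1), fun F hF => ?_⟩
    refine (local_trace_inequality hΩ.isOpen hh hδ H hF).trans ?_
    rw [ENNReal.coe_mul, mul_assoc, ENNReal.coe_pow]
    refine mul_le_mul_right ?_ _
    rw [← lintegral_const_mul' _ _ ENNReal.coe_ne_top]
    refine lintegral_mono fun x => ?_
    rw [mul_add, ENNReal.coe_add]
    refine add_le_add ?_ ?_
    · refine mul_le_mul_left ?_ _
      exact le_self_add
    · exact le_mul_of_one_le_left zero_le le_add_self

/-! ### Mollification with off-centre kernels -/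

theorem tendsto_eLpNorm_translate {E : Type*} [NormedAddCommGroup E] {u : Space → E}
    (hu : MemLp u 2 volume) :
    Tendsto (fun z : Space => eLpNorm (fun x => u (x - z) - u x) 2 volume) (𝓝 0) (𝓝 0) := by
  have hz : ∀ z : Space, MemLp (fun x => u (x - z)) 2 volume := fun z =>
    hu.comp_measurePreserving (measurePreserving_sub_right volume z)
  have hc : Continuous fun z : Space => DomAddAct.mk (-z) +ᵥ hu.toLp u := by
    have : Fact ((2 : ℝ≥0∞) ≠ ∞) := ⟨by simp⟩
    have h1 : Continuous fun z : Space => DomAddAct.mk (-z) :=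
      DomAddAct.continuous_mk.comp continuous_neg
    exact h1.vadd continuous_const
  have he : ∀ z : Space, DomAddAct.mk (-z) +ᵥ hu.toLp u = (hz z).toLp _ := by
    intro z
    rw [DomAddAct.mk_vadd_toLp]
    refine (MemLp.toLp_eq_toLp_iff _ _).2 (Eventually.of_forall fun x => ?_)
    simp [sub_eq_neg_add]
  have h1 := hc.tendsto 0
  have h0 : DomAddAct.mk (-(0:Space)) +ᵥ hu.toLp u = hu.toLp u := by simp
  rw [h0] at h1
  simp_rw [he] at h1
  exact (Lp.tendsto_Lp_iff_tendsto_eLpNorm'' _ hz u hu).1 h1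

/-- The mollification of `u` with the kernel `κ`. -/
def mollify {E : Type*} [NormedAddCommGroup E] [NormedSpace ℝ E] (κ : Space → ℝ) (u : Space → E)
    (x : Space) : E := ∫ y, κ (x - y) • u y

theorem mollify_eq {E : Type*} [NormedAddCommGroup E] [NormedSpace ℝ E] (κ : Space → ℝ)
    (u : Space → E) (x : Space) : mollify κ u x = ∫ z, κ z • u (x - z) := by
  rw [mollify, ← integral_sub_left_eq_self (fun y => κ (x - y) • u y) volume x]
  simp

theorem enorm_integral_sq_le {α E : Type*} [MeasurableSpace α] [NormedAddCommGroup E]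
    [NormedSpace ℝ E] {ν : Measure α} [IsProbabilityMeasure ν] {w : α → E}
    (hw : AEStronglyMeasurable w ν) :
    ‖∫ z, w z ∂ν‖ₑ ^ (2 : ℝ) ≤ ∫⁻ z, ‖w z‖ₑ ^ (2 : ℝ) ∂ν := by
  have h1 : eLpNorm w 1 ν ≤ eLpNorm w (2 : ℝ≥0) ν :=
    eLpNorm_le_eLpNorm_of_exponent_le (by norm_num) hw
  have h2 := eLpNorm_nnreal_pow_eq_lintegral (f := w) (μ := ν) (p := 2) (by norm_num)
  rw [NNReal.coe_ofNat] at h2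
  rw [← h2]
  gcongr
  refine (enorm_integral_le_lintegral_enorm w).trans ?_
  rwa [← eLpNorm_one_eq_lintegral_enorm]

/-- The `L²` distance of a function to its mollification is bounded by the oscillation of the
function under translations by vectors in the support of the kernel. -/
theorem eLpNorm_mollify_sub_le {E : Type*} [NormedAddCommGroup E] [NormedSpace ℝ E]
    [CompleteSpace E] {κ : Space → ℝ} (hκ : Continuous κ) (hs : HasCompactSupport κ) (h0 : ∀ z, 0 ≤ κ z)
    (h1 : ∫ z, κ z = 1) {u : Space → E} (hum : StronglyMeasurable u) (hu : MemLp u 2 volume)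
    {ε : ℝ≥0∞} (hε : ∀ z, κ z ≠ 0 → eLpNorm (fun x => u (x - z) - u x) 2 volume ≤ ε) :
    eLpNorm (fun x => mollify κ u x - u x) 2 volume ≤ ε := by
  set ν : Measure Space := volume.withDensity fun z => ENNReal.ofReal (κ z)
  have hκi : Integrable κ volume := hκ.integrable_of_hasCompactSupport hs
  have hνu : ν univ = 1 := by
    rw [withDensity_apply _ MeasurableSet.univ, Measure.restrict_univ,
      ← ofReal_integral_eq_lintegral_ofReal hκi (Eventually.of_forall h0), h1, ENNReal.ofReal_one]
  have hν : IsProbabilityMeasure ν := ⟨hνu⟩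
  have hm : Measurable fun z => ENNReal.ofReal (κ z) := hκ.measurable.ennreal_ofReal
  have hνae : ∀ᵐ z ∂ν, κ z ≠ 0 := by
    rw [ae_withDensity_iff hm]
    refine Eventually.of_forall fun z hz h => hz (by simp [h])
  have hint : ∀ w : Space → E, ∫ z, w z ∂ν = ∫ z, κ z • w z := by
    intro w
    rw [integral_withDensity_eq_integral_toReal_smul hm (Eventually.of_forall fun _ => by simp)]
    simp [ENNReal.toReal_ofReal (h0 _)]
  have hloc : LocallyIntegrable u volume := hu.locallyIntegrable (by norm_num)
  have hshift : ∀ x, StronglyMeasurable fun z => u (x - z) := fun x =>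
    hum.comp_measurable (measurable_const.sub measurable_id)
  have hI : ∀ x, Integrable (fun z => u (x - z)) ν := by
    intro x
    rw [integrable_withDensity_iff_integrable_smul₀' hm.aemeasurable
      (Eventually.of_forall fun _ => by simp)]
    have h2 : Integrable (fun y => κ (x - y) • u y) volume :=
      hloc.integrable_smul_left_of_hasCompactSupport (by fun_prop)
        (hs.comp_homeomorph (Homeomorph.subLeft x))
    have h3 := h2.comp_sub_left x
    simpa [ENNReal.toReal_ofReal (h0 _)] using h3
  have hrep : ∀ x, mollify κ u x - u x = ∫ z, (u (x - z) - u x) ∂ν := by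
    intro x
    rw [integral_sub (hI x) (integrable_const _), hint, integral_const, mollify_eq]
    simp
  have hjm : StronglyMeasurable fun q : Space × Space => u (q.1 - q.2) - u q.1 :=
    (hum.comp_measurable (measurable_fst.sub measurable_snd)).sub
      (hum.comp_measurable measurable_fst)
  have h2 : ∀ f : Space → E, eLpNorm f 2 volume ^ (2 : ℝ) = ∫⁻ x, ‖f x‖ₑ ^ (2 : ℝ) := by
    intro f
    have := eLpNorm_nnreal_pow_eq_lintegral (f := f) (μ := volume) (p := 2) (by norm_num)
    rwa [NNReal.coe_ofNat] at this
  rw [← ENNReal.rpow_le_rpow_iff (z := 2) (by norm_num), h2]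
  calc ∫⁻ x, ‖mollify κ u x - u x‖ₑ ^ (2 : ℝ)
      ≤ ∫⁻ x, ∫⁻ z, ‖u (x - z) - u x‖ₑ ^ (2 : ℝ) ∂ν := by
        refine lintegral_mono fun x => ?_
        rw [hrep]
        exact enorm_integral_sq_le ((hshift x).sub stronglyMeasurable_const).aestronglyMeasurable
    _ = ∫⁻ z, (∫⁻ x, ‖u (x - z) - u x‖ₑ ^ (2 : ℝ)) ∂ν :=
        lintegral_lintegral_swap (hjm.enorm.pow_const _).aemeasurable
    _ ≤ ∫⁻ z, ε ^ (2 : ℝ) ∂ν := by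
        refine lintegral_mono_ae ?_
        filter_upwards [hνae] with z hz
        rw [← h2]
        gcongr
        exact hε z hz
    _ = ε ^ (2 : ℝ) := by rw [lintegral_const, hνu, mul_one]

section Smooth

open Convolution

variable {κ : Space → ℝ} {u : Space → ℝ}

theorem mollify_eq_convolution : mollify κ u = κ ⋆[ContinuousLinearMap.mul ℝ ℝ, volume] u := by
  funext x
  rw [convolution_eq_swap]
  rfl

theorem contDiff_mollify (hκ : ContDiff ℝ (⊤ : ℕ∞) κ) (hs : HasCompactSupport κ)
    (hu : LocallyIntegrable u volume) : ContDiff ℝ (⊤ : ℕ∞) (mollify κ u) := by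
  rw [mollify_eq_convolution]
  exact hs.contDiff_convolution_left _ hκ hu

theorem fderiv_mollify (hκ : ContDiff ℝ (⊤ : ℕ∞) κ) (hs : HasCompactSupport κ)
    (hu : LocallyIntegrable u volume) (x v : Space) :
    fderiv ℝ (mollify κ u) x v = ∫ y, fderiv ℝ κ (x - y) v * u y := by
  have h1 := (hs.hasFDerivAt_convolution_left (ContinuousLinearMap.mul ℝ ℝ)
    (hκ.of_le (by exact_mod_cast le_top)) hu x).fderiv
  rw [mollify_eq_convolution, h1]
  have h2 := ((hs.fderiv (𝕜 := ℝ)).convolutionExists_left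
    (ContinuousLinearMap.precompL Space (ContinuousLinearMap.mul ℝ ℝ))
    (hκ.continuous_fderiv (by simp)) hu x).integrable_swap
  rw [convolution_eq_swap, ContinuousLinearMap.integral_apply h2]
  rfl

end Smooth

/-- If the reflected kernel centred at `x` is a test function on `Ω`, then the gradient of the
mollification at `x` is the mollification of the weak gradient. -/
theorem gradient_mollify_of_tsupport_subset {Ω : Set Space} (hΩ : IsOpen Ω) {f : Space → ℝ}
    {G : Space → Space} (hw : HasWeakGradient Ω f G) (hf : MemLp f 2 (vol Ω))
    (hG : MemLp G 2 (vol Ω)) {κ : Space → ℝ}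
    (hκ : ContDiff ℝ (⊤ : ℕ∞) κ) (hs : HasCompactSupport κ) {x : Space}
    (hx : ∀ y, x - y ∈ tsupport κ → y ∈ Ω) :
    gradient (mollify κ (Ω.indicator f)) x = mollify κ (Ω.indicator G) x := by
  have hfi : MemLp (Ω.indicator f) 2 volume := (memLp_indicator_iff_restrict hΩ.measurableSet).2 hf
  have hGi : MemLp (Ω.indicator G) 2 volume := (memLp_indicator_iff_restrict hΩ.measurableSet).2 hG
  have hψ : IsTestFun Ω fun y => κ (x - y) := by
    refine ⟨hκ.comp (contDiff_const.sub contDiff_id),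
      hs.comp_homeomorph (Homeomorph.subLeft x), fun y hy => hx y ?_⟩
    exact tsupport_comp_subset_preimage κ (f := fun y => x - y) (by fun_prop) hy
  have hd : ∀ y v, fderiv ℝ (fun y => κ (x - y)) y v = - fderiv ℝ κ (x - y) v := by
    intro y v
    have h1 := ((hκ.differentiable (by simp) (x - y)).hasFDerivAt).comp y
      ((hasFDerivAt_id y).const_sub x)
    rw [HasFDerivAt.fderiv (f := fun y => κ (x - y)) h1]
    simp
  ext i
  rw [gradient_apply, fderiv_mollify hκ hs (hfi.locallyIntegrable (by norm_num))]
  have hw' := hw _ hψ i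
  simp_rw [hd, mul_neg] at hw'
  rw [integral_neg, neg_inj, ← integral_indicator hΩ.measurableSet,
    ← integral_indicator hΩ.measurableSet] at hw'
  have e1 : ∫ y, fderiv ℝ κ (x - y) (EuclideanSpace.single i 1) * Ω.indicator f y =
      ∫ y, Ω.indicator (fun y => f y * fderiv ℝ κ (x - y) (EuclideanSpace.single i 1)) y := by
    refine integral_congr_ae (Eventually.of_forall fun y => ?_)
    by_cases hy : y ∈ Ω <;> simp [hy, mul_comm]
  have e2 : Integrable (fun y => κ (x - y) • Ω.indicator G y) volume :=
    (hGi.locallyIntegrable (by norm_num)).integrable_smul_left_of_hasCompactSupport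
      hψ.1.continuous hψ.2.1
  have e3 : mollify κ (Ω.indicator G) x i = ∫ y, (κ (x - y) • Ω.indicator G y) i :=
    ((EuclideanSpace.proj (𝕜 := ℝ) i).integral_comp_comm e2).symm
  rw [e1, hw', e3]
  refine integral_congr_ae (Eventually.of_forall fun y => ?_)
  by_cases hy : y ∈ Ω <;> simp [hy]

/-- The gradient of the mollification vanishes where the kernel only sees zeros of the function. -/
theorem gradient_mollify_of_eq_zero {u : Space → ℝ} {κ : Space → ℝ}
    (hκ : ContDiff ℝ (⊤ : ℕ∞) κ) (hs : HasCompactSupport κ) (hu : LocallyIntegrable u volume)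
    {x : Space} (hx : ∀ᵐ y, x - y ∈ tsupport κ → u y = 0) :
    gradient (mollify κ u) x = 0 := by
  ext i
  rw [gradient_apply, fderiv_mollify hκ hs hu, PiLp.zero_apply]
  refine integral_eq_zero_of_ae ?_
  filter_upwards [hx] with y hy
  by_cases h : x - y ∈ tsupport κ
  · simp [hy h]
  · have : fderiv ℝ κ (x - y) = 0 :=
      image_eq_zero_of_notMem_tsupport fun h' => h (tsupport_fderiv_subset ℝ h')
    simp [this]

theorem mollify_eq_zero {E : Type*} [NormedAddCommGroup E] [NormedSpace ℝ E] {u : Space → E}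
    {κ : Space → ℝ} {x : Space} (hx : ∀ᵐ y, x - y ∈ tsupport κ → u y = 0) :
    mollify κ u x = 0 := by
  refine integral_eq_zero_of_ae ?_
  filter_upwards [hx] with y hy
  by_cases h : x - y ∈ tsupport κ
  · simp [hy h]
  · simp [image_eq_zero_of_notMem_tsupport h]

/-! ### Density of smooth functions in `H¹(Ω)` -/

/-- The restrictions to `Ω` of smooth functions on the whole space, as a subspace of `H¹(Ω)`. -/
def smoothH1 (Ω : Set Space) : Submodule ℝ (H1 Ω) where
  carrier := {f | ∃ F : Space → ℝ, ContDiff ℝ (⊤ : ℕ∞) F ∧ fn f =ᵐ[vol Ω] F ∧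
    grad f =ᵐ[vol Ω] gradient F}
  zero_mem' := by
    refine ⟨fun _ => 0, contDiff_const, fn_zero, grad_zero.trans ?_⟩
    exact Eventually.of_forall fun x => by rw [gradient_fun_const]
  add_mem' := by
    rintro f g ⟨F, hF, hF1, hF2⟩ ⟨G, hG, hG1, hG2⟩
    refine ⟨fun x => F x + G x, hF.add hG, ?_, ?_⟩
    · filter_upwards [fn_add f g, hF1, hG1] with x h h1 h2
      rw [h, h1, h2]
    · filter_upwards [grad_add f g, hF2, hG2] with x h h1 h2
      rw [h, h1, h2, gradient, gradient, gradient, fderiv_fun_add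
        (hF.differentiable (by simp) x) (hG.differentiable (by simp) x), map_add]
  smul_mem' := by
    rintro c f ⟨F, hF, hF1, hF2⟩
    refine ⟨fun x => c * F x, contDiff_const.mul hF, ?_, ?_⟩
    · filter_upwards [fn_smul c f, hF1] with x h h1
      rw [h, h1]
    · have h3 : grad (c • f) =ᵐ[vol Ω] fun x => c • grad f x := Lp.coeFn_smul _ _
      filter_upwards [h3, hF2] with x h h1
      rw [h, h1, gradient, gradient, fderiv_const_mul (hF.differentiable (by simp) x)]
      simp

theorem ofSmooth_mem_smoothH1 {Ω : Set Space} (hb : Bornology.IsBounded Ω) {F : Space → ℝ}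
    (hF : ContDiff ℝ (⊤ : ℕ∞) F) : ofSmooth hb F hF ∈ smoothH1 Ω :=
  ⟨F, hF, fn_ofSmooth hb hF, grad_ofSmooth hb hF⟩

/-- A function with weak gradient, both vanishing outside a small ball, is a limit of smooth
functions provided that near the ball small translates of `Ω` in the direction `-e`
keep a proportional distance from the complement of `Ω`. -/
theorem mem_closure_smoothH1_of_local {Ω : Set Space} (hΩ : IsOpen Ω)
    (hb : Bornology.IsBounded Ω) {x₀ e : Space} {δ c t₀ : ℝ} (hδ : 0 < δ) (hc : 0 < c)
    (ht₀ : 0 < t₀)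
    (H : ∀ x ∈ Ω ∩ Metric.ball x₀ δ, ∀ t ∈ Ioo 0 t₀, Metric.closedBall (x + t • e) (c * t) ⊆ Ω)
    {g : H1 Ω} (hg1 : ∀ᵐ x ∂(vol Ω), x ∉ Metric.ball x₀ (δ / 2) → fn g x = 0)
    (hg2 : ∀ᵐ x ∂(vol Ω), x ∉ Metric.ball x₀ (δ / 2) → grad g x = 0) :
    g ∈ (smoothH1 Ω).topologicalClosure := by
  set u : Space → ℝ := Ω.indicator (fn g)
  set D : Space → Space := Ω.indicator (grad g)
  have hum : StronglyMeasurable u := (Lp.stronglyMeasurable g.1.fst).indicator hΩ.measurableSet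
  have hDm : StronglyMeasurable D := (Lp.stronglyMeasurable g.1.snd).indicator hΩ.measurableSet
  have hu : MemLp u 2 volume := (memLp_indicator_iff_restrict hΩ.measurableSet).2 (memLp_fn g)
  have hD : MemLp D 2 volume := (memLp_indicator_iff_restrict hΩ.measurableSet).2 (memLp_grad g)
  have hul : LocallyIntegrable u volume := hu.locallyIntegrable (by norm_num)
  -- the kernels, supported in the balls of radius `c t` about `-t e`
  let bump : (t : ℝ) → 0 < t → ContDiffBump (-t • e) := fun t ht =>
    ⟨c * t / 2, c * t, by positivity, by have := mul_pos hc ht; linarith⟩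
  let κ : ℝ → Space → ℝ := fun t => if ht : 0 < t then (bump t ht).normed volume else 0
  have hκ : ∀ t, (ht : 0 < t) → κ t = (bump t ht).normed volume := fun t ht => dif_pos ht
  have hκd : ∀ t, ContDiff ℝ (⊤ : ℕ∞) (κ t) := by
    intro t
    by_cases ht : 0 < t
    · rw [hκ t ht]; exact (bump t ht).contDiff_normed
    · simp only [κ, dif_neg ht]; exact contDiff_const
  have hκs : ∀ t, HasCompactSupport (κ t) := by
    intro t
    by_cases ht : 0 < t
    · rw [hκ t ht]; exact (bump t ht).hasCompactSupport_normed
    · simp only [κ, dif_neg ht]; exact HasCompactSupport.zero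
  have hκt : ∀ t, 0 < t → tsupport (κ t) = Metric.closedBall (-t • e) (c * t) := by
    intro t ht
    rw [hκ t ht, ContDiffBump.tsupport_normed_eq]
  have hball : ∀ t, 0 < t → ∀ x y : Space, x - y ∈ tsupport (κ t) →
      y ∈ Metric.closedBall (x + t • e) (c * t) := by
    intro t ht x y hy
    rw [hκt t ht, mem_closedBall_iff_norm] at hy
    rw [mem_closedBall_iff_norm, ← norm_neg]
    have h1 : -(y - (x + t • e)) = x - y - -t • e := by module
    rwa [h1]
  -- convergence of the mollifications in `L²` of the whole space
  have hconv : ∀ {E : Type} [NormedAddCommGroup E] [NormedSpace ℝ E] [CompleteSpace E]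
      {w : Space → E}, StronglyMeasurable w → MemLp w 2 volume →
      Tendsto (fun t => eLpNorm (fun x => mollify (κ t) w x - w x) 2 volume) (𝓝[>] 0) (𝓝 0) := by
    intro E _ _ _ w hwm hw
    rw [ENNReal.tendsto_nhds_zero]
    intro ε hε
    obtain ⟨r, hr, hrε⟩ := Metric.eventually_nhds_iff_ball.1
      ((ENNReal.tendsto_nhds_zero.1 (tendsto_eLpNorm_translate hw)) ε hε)
    have hlim : Tendsto (fun t : ℝ => t * (‖e‖ + c)) (𝓝[>] 0) (𝓝 0) := by
      have : Tendsto (fun t : ℝ => t * (‖e‖ + c)) (𝓝 0) (𝓝 (0 * (‖e‖ + c))) :=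
        (continuous_id.mul continuous_const).tendsto 0
      rw [zero_mul] at this
      exact this.mono_left nhdsWithin_le_nhds
    filter_upwards [self_mem_nhdsWithin, hlim.eventually (gt_mem_nhds hr)] with t ht htr
    have ht : 0 < t := ht
    refine eLpNorm_mollify_sub_le (hκd t).continuous (hκs t) ?_ ?_ hwm hw fun z hz => hrε z ?_
    · intro z; rw [hκ t ht]; exact (bump t ht).nonneg_normed z
    · rw [hκ t ht]; exact (bump t ht).integral_normed
    · have h1 : z ∈ Metric.closedBall (-t • e) (c * t) := by
        rw [← hκt t ht]; exact subset_tsupport _ hz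
      rw [mem_closedBall_iff_norm] at h1
      rw [mem_ball_zero_iff]
      calc ‖z‖ = ‖(z - -t • e) + -t • e‖ := by rw [sub_add_cancel]
        _ ≤ c * t + t * ‖e‖ := by
          refine (norm_add_le _ _).trans (add_le_add h1 ?_)
          rw [norm_smul, norm_neg, Real.norm_eq_abs, abs_of_pos ht]
        _ < r := by linarith
  have hu0 : ∀ᵐ y, y ∉ Metric.ball x₀ (δ / 2) → u y = 0 := by
    filter_upwards [(ae_restrict_iff' hΩ.measurableSet).1 hg1] with y hy hy2
    by_cases h : y ∈ Ω
    · simp [u, h, hy h hy2]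
    · simp [u, h]
  have hD0 : ∀ᵐ y, y ∉ Metric.ball x₀ (δ / 2) → D y = 0 := by
    filter_upwards [(ae_restrict_iff' hΩ.measurableSet).1 hg2] with y hy hy2
    by_cases h : y ∈ Ω
    · simp [D, h, hy h hy2]
    · simp [D, h]
  -- on `Ω` the gradient of the mollification is the mollification of the weak gradient
  have hgrad : ∀ᶠ t in 𝓝[>] (0 : ℝ), ∀ x ∈ Ω, gradient (mollify (κ t) u) x = mollify (κ t) D x := by
    have hlim : Tendsto (fun t : ℝ => t * (‖e‖ + c)) (𝓝[>] 0) (𝓝 0) := by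
      have : Tendsto (fun t : ℝ => t * (‖e‖ + c)) (𝓝 0) (𝓝 (0 * (‖e‖ + c))) :=
        (continuous_id.mul continuous_const).tendsto 0
      rw [zero_mul] at this
      exact this.mono_left nhdsWithin_le_nhds
    filter_upwards [Ioo_mem_nhdsGT ht₀, hlim.eventually (gt_mem_nhds (half_pos hδ))]
      with t ht htδ x hx
    by_cases hxb : x ∈ Metric.ball x₀ δ
    · exact gradient_mollify_of_tsupport_subset hΩ (hasWeakGradient_fn g) (memLp_fn g)
        (memLp_grad g) (hκd t) (hκs t)
        fun y hy => H x ⟨hx, hxb⟩ t ht (hball t ht.1 x y hy)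
    · have hfar : ∀ y, x - y ∈ tsupport (κ t) → y ∉ Metric.ball x₀ (δ / 2) := by
        intro y hy hy2
        refine hxb ?_
        have h1 := mem_closedBall_iff_norm.1 (hball t ht.1 x y hy)
        have h2 : ‖t • e‖ = t * ‖e‖ := by
          rw [norm_smul, Real.norm_eq_abs, abs_of_pos ht.1]
        have h3 := mem_ball_iff_norm.1 hy2
        rw [mem_ball_iff_norm]
        calc ‖x - x₀‖ = ‖(y - x₀) - (y - (x + t • e)) - t • e‖ := by congr 1; abel
          _ ≤ ‖y - x₀‖ + ‖y - (x + t • e)‖ + ‖t • e‖ :=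
            (norm_sub_le _ _).trans (by gcongr; exact norm_sub_le _ _)
          _ < δ := by linarith
      rw [gradient_mollify_of_eq_zero (hκd t) (hκs t) hul (hu0.mono fun y hy h => hy (hfar y h)),
        mollify_eq_zero (hD0.mono fun y hy h => hy (hfar y h))]
  let F : ℝ → Space → ℝ := fun t => mollify (κ t) u
  have hF : ∀ t, ContDiff ℝ (⊤ : ℕ∞) (F t) := fun t => contDiff_mollify (hκd t) (hκs t) hul
  refine mem_closure_of_tendsto (f := fun t => (ofSmooth hb (F t) (hF t) : H1 Ω)) (b := 𝓝[>] 0) ?_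
    (Eventually.of_forall fun t => ofSmooth_mem_smoothH1 hb (hF t))
  rw [tendsto_W1_iff]
  constructor
  · rw [Lp.tendsto_Lp_iff_tendsto_eLpNorm']
    refine tendsto_of_tendsto_of_tendsto_of_le_of_le tendsto_const_nhds (hconv hum hu)
      (fun _ => zero_le) fun t => ?_
    have h1 : ((fnL 2 Ω (ofSmooth hb (F t) (hF t)) : Space → ℝ) - (fnL 2 Ω g : Space → ℝ)) =ᵐ[vol Ω]
        fun x => mollify (κ t) u x - u x := by
      filter_upwards [fn_ofSmooth (p := 2) hb (hF t), ae_restrict_mem hΩ.measurableSet] with x hx hxΩ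
      have hux : u x = fn g x := indicator_of_mem hxΩ _
      rw [Pi.sub_apply, hux]
      exact congrArg (· - fn g x) hx
    rw [eLpNorm_congr_ae h1]
    exact eLpNorm_restrict_le _ _ _ _
  · rw [Lp.tendsto_Lp_iff_tendsto_eLpNorm']
    refine tendsto_of_tendsto_of_tendsto_of_le_of_le' tendsto_const_nhds (hconv hDm hD)
      (Eventually.of_forall fun _ => zero_le) ?_
    filter_upwards [hgrad] with t ht
    have h1 : ((gradL 2 Ω (ofSmooth hb (F t) (hF t)) : Space → Space) - (gradL 2 Ω g : Space → Space)) =ᵐ[vol Ω]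
        fun x => mollify (κ t) D x - D x := by
      filter_upwards [grad_ofSmooth (p := 2) hb (hF t), ae_restrict_mem hΩ.measurableSet] with x hx hxΩ
      have hux : D x = grad g x := indicator_of_mem hxΩ _
      rw [Pi.sub_apply, hux, ← ht x hxΩ]
      exact congrArg (· - grad g x) hx
    rw [eLpNorm_congr_ae h1]
    exact eLpNorm_restrict_le _ _ _ _

theorem exists_cone_condition {Ω : Set Space} (hΩ : IsBoundedLipschitzDomain Ω) {x₀ : Space}
    (hx₀ : x₀ ∈ closure Ω) : ∃ (e : Space) (δ c t₀ : ℝ), 0 < δ ∧ 0 < c ∧ 0 < t₀ ∧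
      ∀ x ∈ Ω ∩ Metric.ball x₀ δ, ∀ t ∈ Ioo 0 t₀, Metric.closedBall (x + t • e) (c * t) ⊆ Ω := by
  by_cases hx : x₀ ∈ Ω
  · obtain ⟨r, hr, hrΩ⟩ := Metric.isOpen_iff.1 hΩ.isOpen x₀ hx
    refine ⟨0, r / 2, 1, r / 2, half_pos hr, one_pos, half_pos hr, fun x hx t ht y hy => hrΩ ?_⟩
    have h1 : dist x x₀ < r / 2 := hx.2
    have h2 : dist y x ≤ t := by simpa using hy
    have h3 := dist_triangle y x x₀
    exact Metric.mem_ball.2 (by linarith [ht.2])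
  · have hf : x₀ ∈ frontier Ω := by rw [hΩ.isOpen.frontier_eq]; exact ⟨hx₀, hx⟩
    obtain ⟨R, h, K, δ, hh, hδ, H⟩ := hΩ.graph x₀ hf
    have H' : ∀ x ∈ Metric.ball x₀ δ, (x ∈ Ω ↔ h (dropLast (R x)) < R x (Fin.last 2)) := H
    have hK : (0 : ℝ) ≤ K := K.2
    set e : Space := R.symm (joinLast 0 1)
    have he : ‖e‖ = 1 := by rw [LinearIsometryEquiv.norm_map, norm_joinLast_zero_one]
    -- the opening of the cone above the graph of a `K`-Lipschitz function
    set c : ℝ := 1 / (2 * (1 + K))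
    have hc : 0 < c := by positivity
    have hcK : c * (1 + K) = 1 / 2 := by simp only [c]; field_simp
    have hc1 : c ≤ 1 / 2 := by nlinarith [mul_nonneg hc.le hK]
    refine ⟨e, δ / 2, c, δ / 4, half_pos hδ, hc, by positivity, fun x hx t ht y hy => ?_⟩
    have hy' : ‖y - (x + t • e)‖ ≤ c * t := mem_closedBall_iff_norm.1 hy
    have hxb : ‖x - x₀‖ < δ / 2 := mem_ball_iff_norm.1 hx.2
    have hte : ‖t • e‖ = t := by rw [norm_smul, he, mul_one, Real.norm_eq_abs, abs_of_pos ht.1]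
    have hct : c * t ≤ 1 / 2 * t := mul_le_mul_of_nonneg_right hc1 ht.1.le
    have hyb : y ∈ Metric.ball x₀ δ := by
      rw [mem_ball_iff_norm]
      calc ‖y - x₀‖ = ‖(y - (x + t • e)) + t • e + (x - x₀)‖ := by congr 1; abel
        _ ≤ ‖y - (x + t • e)‖ + ‖t • e‖ + ‖x - x₀‖ :=
          (norm_add_le _ _).trans (by gcongr; exact norm_add_le _ _)
        _ < δ := by linarith [ht.2]
    rw [H' y hyb]
    have hxΩ := (H' x (Metric.ball_subset_ball (by linarith) hx.2)).1 hx.1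
    set z := y - (x + t • e)
    have hRy : R y = R x + t • joinLast 0 1 + R z := by
      have : y = x + t • e + z := by simp only [z]; abel
      conv_lhs => rw [this]
      rw [map_add, map_add, map_smul, R.apply_symm_apply]
    have hz3 : |R z (Fin.last 2)| ≤ c * t := by
      refine le_trans ?_ hy'
      rw [← R.norm_map z, ← Real.norm_eq_abs]
      exact PiLp.norm_apply_le _ _
    have hlast : R y (Fin.last 2) = R x (Fin.last 2) + t + R z (Fin.last 2) := by
      rw [hRy, PiLp.add_apply, PiLp.add_apply, PiLp.smul_apply, joinLast_last, smul_eq_mul, mul_one]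
    have hdrop : dropLast (R y) - dropLast (R x) = dropLast (R z) := by
      have e1 : R y - R x = joinLast 0 t + R z := by
        rw [hRy, ← joinLast_smul, smul_zero, mul_one]; abel
      rw [← dropLast_sub, e1, ← sub_neg_eq_add, dropLast_sub, dropLast_joinLast, zero_sub]
      ext i; simp [dropLast]
    have hh' := hh.dist_le_mul (dropLast (R y)) (dropLast (R x))
    rw [Real.dist_eq, dist_eq_norm, hdrop] at hh'
    have h1 : ‖dropLast (R z)‖ ≤ c * t := by
      refine (norm_dropLast_le _).trans ?_
      rwa [R.norm_map]
    have h2 : (K : ℝ) * ‖dropLast (R z)‖ ≤ K * (c * t) := mul_le_mul_of_nonneg_left h1 hK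
    have h3 := (abs_le.1 hz3).1
    have h4 := (abs_le.1 hh').2
    have h5 : K * (c * t) + c * t = 1 / 2 * t := by rw [← hcK]; ring
    rw [hlast]
    linarith [ht.1]

theorem exists_localizing_bump {Ω : Set Space} (hΩ : IsBoundedLipschitzDomain Ω) {x₀ : Space}
    (hx₀ : x₀ ∈ closure Ω) : ∃ (V : Set Space) (ψ : Space → ℝ) (hψ : ContDiff ℝ (⊤ : ℕ∞) ψ)
      (hc : HasCompactSupport ψ), V ∈ 𝓝 x₀ ∧ (∀ x ∈ V, ψ x = 1) ∧
      ∀ g : H1 Ω, mulSmooth ψ hψ hc g ∈ (smoothH1 Ω).topologicalClosure := by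
  obtain ⟨e, δ, c, t₀, hδ, hc, ht₀, H⟩ := exists_cone_condition hΩ hx₀
  let b : ContDiffBump x₀ := ⟨δ / 8, δ / 4, by positivity, by linarith⟩
  refine ⟨Metric.closedBall x₀ (δ / 8), b, b.contDiff, b.hasCompactSupport,
    Metric.closedBall_mem_nhds _ (by positivity), fun x hx => b.one_of_mem_closedBall hx,
    fun g => ?_⟩
  have hout : ∀ x, x ∉ Metric.ball x₀ (δ / 2) → x ∉ tsupport b := by
    intro x hx hx'
    rw [b.tsupport_eq] at hx'
    exact hx (Metric.closedBall_subset_ball (by change δ / 4 < δ / 2; linarith) hx')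
  refine mem_closure_smoothH1_of_local hΩ.isOpen hΩ.isBounded hδ hc ht₀ H ?_ ?_
  · filter_upwards [fn_mulSmooth b.contDiff b.hasCompactSupport g] with x h1 h2
    rw [h1]
    rw [image_eq_zero_of_notMem_tsupport (hout x h2), zero_mul]
  · filter_upwards [grad_mulSmooth b.contDiff b.hasCompactSupport g] with x h1 h2
    rw [h1]
    have h3 : fderiv ℝ b x = 0 :=
      image_eq_zero_of_notMem_tsupport fun h' => hout x h2 (tsupport_fderiv_subset ℝ h')
    rw [image_eq_zero_of_notMem_tsupport (hout x h2), gradient, h3]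
    simp

/-- Smooth functions are dense in `H¹(Ω)`: multiplying repeatedly with factors `1 - ψ`, each
change being a limit of smooth functions, a given element is deformed to zero. -/
theorem dense_smoothH1 {Ω : Set Space} (hΩ : IsBoundedLipschitzDomain Ω) (f : H1 Ω) :
    f ∈ (smoothH1 Ω).topologicalClosure := by
  have hcomp := hΩ.isBounded.isCompact_closure
  obtain ⟨g, hg1, hg2, -⟩ : ∃ g : H1 Ω, f - g ∈ (smoothH1 Ω).topologicalClosure ∧
      (∀ᵐ x ∂(vol Ω), x ∈ closure Ω → fn g x = 0) ∧
      (∀ᵐ x ∂(vol Ω), fn f x = 0 → fn g x = 0) := by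
    revert f
    refine hcomp.induction_on (p := fun S => ∀ f : H1 Ω, ∃ g : H1 Ω,
      f - g ∈ (smoothH1 Ω).topologicalClosure ∧ (∀ᵐ x ∂(vol Ω), x ∈ S → fn g x = 0) ∧
      (∀ᵐ x ∂(vol Ω), fn f x = 0 → fn g x = 0)) ?_ ?_ ?_ ?_
    · intro f
      exact ⟨f, by rw [sub_self]; exact Submodule.zero_mem _, by simp, by simp⟩
    · intro s t hst ht f
      obtain ⟨g, h1, h2, h3⟩ := ht f
      exact ⟨g, h1, h2.mono fun x hx hxs => hx (hst hxs), h3⟩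
    · intro s t hs ht f
      obtain ⟨g, h1, h2, h3⟩ := hs f
      obtain ⟨k, k1, k2, k3⟩ := ht g
      refine ⟨k, by rw [← sub_add_sub_cancel f g k]; exact Submodule.add_mem _ h1 k1, ?_, ?_⟩
      · filter_upwards [h2, k2, k3] with x a1 a2 a3 hx
        exact hx.elim (fun h => a3 (a1 h)) a2
      · filter_upwards [h3, k3] with x a1 a2 hx using a2 (a1 hx)
    · intro x₀ hx₀
      obtain ⟨V, ψ, hψ, hc, hV, hψV, hmem⟩ := exists_localizing_bump hΩ hx₀
      refine ⟨V, mem_nhdsWithin_of_mem_nhds hV, fun f => ⟨f - mulSmooth ψ hψ hc f, ?_, ?_, ?_⟩⟩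
      · rw [sub_sub_cancel]; exact hmem f
      all_goals
        filter_upwards [fn_sub f (mulSmooth ψ hψ hc f),
          fn_mulSmooth hψ hc f] with x h1 h3 hx
      · rw [h1, h3, hψV x hx, one_mul, sub_self]
      · rw [h1, h3, hx, mul_zero, sub_self]
  have hg0 : g = 0 := by
    refine eq_zero_of_fn_ae_eq_zero hΩ.isOpen ?_
    filter_upwards [hg2, ae_restrict_mem hΩ.isOpen.measurableSet] with x h1 h2
    exact h1 (subset_closure h2)
  rwa [hg0, sub_zero] at hg1

/-! ### The trace operator -/

theorem isFiniteMeasure_surf {Ω : Set Space} (hΩ : IsBoundedLipschitzDomain Ω) :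
    IsFiniteMeasure (surf Ω) := by
  have := isFiniteMeasure_vol hΩ.isBounded
  obtain ⟨C, hC⟩ := exists_trace_inequality hΩ
  refine ⟨?_⟩
  have h1 := hC (fun _ => 1) contDiff_const
  simp only [enorm_one, lintegral_const, one_mul, fderiv_fun_const, Pi.zero_apply] at h1
  exact h1.trans_lt (ENNReal.mul_lt_top ENNReal.coe_lt_top
    (ENNReal.mul_lt_top (by simp) (measure_lt_top (vol Ω) _)))

/-- The multiplicative trace inequality, with values in `L²`. -/
theorem exists_trace_inequality_L2 {Ω : Set Space} (hΩ : IsBoundedLipschitzDomain Ω) :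
    ∃ C : ℝ≥0, ∀ F : Space → ℝ, ContDiff ℝ (⊤ : ℕ∞) F →
      eLpNorm F 2 (surf Ω) ^ 2 ≤ C * (eLpNorm F 2 (vol Ω) *
        (eLpNorm F 2 (vol Ω) + 2 * eLpNorm (gradient F) 2 (vol Ω))) := by
  obtain ⟨C, hC⟩ := exists_trace_inequality hΩ
  refine ⟨C, fun F hF => ?_⟩
  have h2 : ∀ {E : Type} [NormedAddCommGroup E] (f : Space → E) (ν : Measure Space),
      eLpNorm f 2 ν ^ 2 = ∫⁻ x, ‖f x‖ₑ ^ 2 ∂ν := by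
    intro E _ f ν
    have := eLpNorm_nnreal_pow_eq_lintegral (f := f) (μ := ν) (p := 2) (by norm_num)
    rw [NNReal.coe_ofNat] at this
    simpa using this
  have h1 := hC (fun x => F x ^ 2) ((hF.of_le (by exact_mod_cast le_top)).pow 2)
  simp only [enorm_pow] at h1
  rw [h2]
  refine h1.trans ?_
  gcongr
  have hd : ∀ x, ‖fderiv ℝ (fun x => F x ^ 2) x‖ₑ = 2 * (‖F x‖ₑ * ‖gradient F x‖ₑ) := by
    intro x
    have h3 : fderiv ℝ (fun x => F x ^ 2) x = (2 * F x) • fderiv ℝ F x := by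
      rw [fderiv_fun_pow 2 (hF.differentiable (by simp) x)]; simp
    have h4 : ‖gradient F x‖ₑ = ‖fderiv ℝ F x‖ₑ := by
      rw [← ofReal_norm, ← ofReal_norm, norm_gradient]
    rw [h3, enorm_smul, enorm_mul, h4, mul_assoc]
    simp [Real.enorm_eq_ofReal]
  have hm := hF.continuous.measurable.enorm
  have hm' := (continuous_gradient hF).measurable.enorm
  simp_rw [hd]
  rw [lintegral_add_left (hm.pow_const 2), ← h2, lintegral_const_mul' _ _ (by simp), mul_add, sq,
    mul_left_comm (eLpNorm F 2 (vol Ω))]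
  gcongr
  have h5 := ENNReal.lintegral_mul_le_Lp_mul_Lq (vol Ω) Real.HolderConjugate.two_two
    hm.aemeasurable hm'.aemeasurable
  simp only [Pi.mul_apply] at h5
  rw [eLpNorm_eq_lintegral_rpow_enorm_toReal (by simp) (by simp),
    eLpNorm_eq_lintegral_rpow_enorm_toReal (by simp) (by simp)]
  simpa using h5

section TraceOperator

variable {Ω : Set Space}

theorem eLpNorm_eq_enorm_fnL_ofSmooth {p : ℝ≥0∞} [Fact (1 ≤ p)] (hb : Bornology.IsBounded Ω) {F : Space → ℝ}
    (hF : ContDiff ℝ (⊤ : ℕ∞) F) :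
    eLpNorm F p (vol Ω) = ‖fnL p Ω (ofSmooth hb F hF)‖ₑ :=
  (Lp.enorm_toLp (memLp_of_continuous_of_isBounded hb hF.continuous)).symm

theorem eLpNorm_eq_enorm_gradL_ofSmooth {p : ℝ≥0∞} [Fact (1 ≤ p)] (hb : Bornology.IsBounded Ω) {F : Space → ℝ}
    (hF : ContDiff ℝ (⊤ : ℕ∞) F) :
    eLpNorm (gradient F) p (vol Ω) = ‖gradL p Ω (ofSmooth hb F hF)‖ₑ :=
  (Lp.enorm_toLp (memLp_of_continuous_of_isBounded hb (continuous_gradient hF))).symm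

theorem memLp_surf (hΩ : IsBoundedLipschitzDomain Ω) {F : Space → ℝ}
    (hF : ContDiff ℝ (⊤ : ℕ∞) F) : MemLp F 2 (surf Ω) := by
  obtain ⟨C, hC⟩ := exists_trace_inequality_L2 hΩ
  refine ⟨hF.continuous.aestronglyMeasurable, ?_⟩
  have h := hC F hF
  rw [eLpNorm_eq_enorm_fnL_ofSmooth hΩ.isBounded hF,
    eLpNorm_eq_enorm_gradL_ofSmooth hΩ.isBounded hF] at h
  have h2 : eLpNorm F 2 (surf Ω) ^ 2 < ∞ := h.trans_lt (by finiteness)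
  by_contra h3
  rw [not_lt, top_le_iff] at h3
  simp [h3] at h2

/-- The restriction of a smooth function to the boundary. -/
def surfLp (hΩ : IsBoundedLipschitzDomain Ω) (F : Space → ℝ) (hF : ContDiff ℝ (⊤ : ℕ∞) F) :
    Lp ℝ 2 (surf Ω) := (memLp_surf hΩ hF).toLp F

theorem exists_norm_surfLp_le (hΩ : IsBoundedLipschitzDomain Ω) :
    ∃ C : ℝ, 0 ≤ C ∧ ∀ (F : Space → ℝ) (hF : ContDiff ℝ (⊤ : ℕ∞) F),
      ‖surfLp hΩ F hF‖ ≤ C * ‖(ofSmooth hΩ.isBounded F hF : H1 Ω)‖ := by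
  obtain ⟨C, hC⟩ := exists_trace_inequality_L2 hΩ
  refine ⟨√(3 * C), Real.sqrt_nonneg _, fun F hF => ?_⟩
  have h := hC F hF
  set f : H1 Ω := ofSmooth hΩ.isBounded F hF
  have h1 : eLpNorm F 2 (surf Ω) = ‖surfLp hΩ F hF‖ₑ := (Lp.enorm_toLp _).symm
  have ha : ‖fnL 2 Ω f‖ₑ ≤ ‖f‖ₑ := enorm_le_iff_norm_le.2 (norm_fnL_le f)
  have hb : ‖gradL 2 Ω f‖ₑ ≤ ‖f‖ₑ := enorm_le_iff_norm_le.2 (norm_gradL_le f)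
  rw [h1, eLpNorm_eq_enorm_fnL_ofSmooth hΩ.isBounded hF,
    eLpNorm_eq_enorm_gradL_ofSmooth hΩ.isBounded hF] at h
  have h2 : ‖surfLp hΩ F hF‖ₑ ^ 2 ≤ 3 * C * ‖f‖ₑ ^ 2 := by
    refine h.trans ?_
    calc (C : ℝ≥0∞) * (‖fnL 2 Ω f‖ₑ * (‖fnL 2 Ω f‖ₑ + 2 * ‖gradL 2 Ω f‖ₑ))
        ≤ C * (‖f‖ₑ * (‖f‖ₑ + 2 * ‖f‖ₑ)) := by gcongr
      _ = 3 * C * ‖f‖ₑ ^ 2 := by ring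
  have h3 : ‖surfLp hΩ F hF‖ ^ 2 ≤ 3 * C * ‖f‖ ^ 2 := by
    simp only [enorm_eq_nnnorm] at h2
    exact_mod_cast h2
  refine abs_le_of_sq_le_sq' ?_ (by positivity) |>.2
  rw [mul_pow, Real.sq_sqrt (by positivity)]
  exact h3

/-- Traces in terms of convergence in `H¹(Ω)` and `L²(∂Ω)`. -/
theorem isTrace_iff (hΩ : IsBoundedLipschitzDomain Ω) {f : H1 Ω} {g : Lp ℝ 2 (surf Ω)} :
    IsTrace f g ↔ ∃ (F : ℕ → Space → ℝ) (hF : ∀ k, ContDiff ℝ (⊤ : ℕ∞) (F k)),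
      Tendsto (fun k => (ofSmooth hΩ.isBounded (F k) (hF k) : H1 Ω)) atTop (𝓝 f) ∧
      Tendsto (fun k => surfLp hΩ (F k) (hF k)) atTop (𝓝 g) := by
  have key : ∀ (F : ℕ → Space → ℝ) (hF : ∀ k, ContDiff ℝ (⊤ : ℕ∞) (F k)),
      (Tendsto (fun k => eLpNorm (fun x => F k x - fn f x) 2 (vol Ω)) atTop (𝓝 0) ∧
      Tendsto (fun k => eLpNorm (fun x => gradient (F k) x - grad f x) 2 (vol Ω)) atTop (𝓝 0) ∧
      Tendsto (fun k => eLpNorm (fun x => F k x - g x) 2 (surf Ω)) atTop (𝓝 0)) ↔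
      (Tendsto (fun k => (ofSmooth hΩ.isBounded (F k) (hF k) : H1 Ω)) atTop (𝓝 f) ∧
      Tendsto (fun k => surfLp hΩ (F k) (hF k)) atTop (𝓝 g)) := by
    intro F hF
    rw [tendsto_W1_iff, Lp.tendsto_Lp_iff_tendsto_eLpNorm', Lp.tendsto_Lp_iff_tendsto_eLpNorm',
      Lp.tendsto_Lp_iff_tendsto_eLpNorm', and_assoc]
    refine and_congr (tendsto_congr fun k => ?_) (and_congr (tendsto_congr fun k => ?_)
      (tendsto_congr fun k => ?_))
    · refine eLpNorm_congr_ae (EventuallyEq.sub (EventuallyEq.symm ?_) EventuallyEq.rfl)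
      exact fn_ofSmooth hΩ.isBounded (hF k)
    · refine eLpNorm_congr_ae (EventuallyEq.sub (EventuallyEq.symm ?_) EventuallyEq.rfl)
      exact grad_ofSmooth hΩ.isBounded (hF k)
    · refine eLpNorm_congr_ae (EventuallyEq.sub (EventuallyEq.symm ?_) EventuallyEq.rfl)
      exact (memLp_surf hΩ (hF k)).coeFn_toLp
  constructor
  · rintro ⟨F, hF, h⟩
    exact ⟨F, hF, (key F hF).1 h⟩
  · rintro ⟨F, hF, h⟩
    exact ⟨F, hF, (key F hF).2 h⟩

theorem ofSmooth_add {p : ℝ≥0∞} [Fact (1 ≤ p)] (hb : Bornology.IsBounded Ω) {F G : Space → ℝ}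
    (hF : ContDiff ℝ (⊤ : ℕ∞) F)
    (hG : ContDiff ℝ (⊤ : ℕ∞) G) : (ofSmooth hb (fun x => F x + G x) (hF.add hG) : W1 p Ω) =
      ofSmooth hb F hF + ofSmooth hb G hG := by
  refine W1_ext ((fn_mkW1 _ _ _).trans ?_) ((grad_mkW1 _ _ _).trans ?_)
  · refine EventuallyEq.trans ?_ (fn_add _ _).symm
    exact EventuallyEq.add (fn_mkW1 _ _ _).symm (fn_mkW1 _ _ _).symm
  · have h : gradient (fun x => F x + G x) = fun x => gradient F x + gradient G x := by
      funext x
      rw [gradient, gradient, gradient, fderiv_fun_add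
        (hF.differentiable (by simp) x) (hG.differentiable (by simp) x), map_add]
    rw [h]
    refine EventuallyEq.trans ?_ (grad_add _ _).symm
    exact EventuallyEq.add (grad_mkW1 _ _ _).symm (grad_mkW1 _ _ _).symm

theorem ofSmooth_smul {p : ℝ≥0∞} [Fact (1 ≤ p)] (hb : Bornology.IsBounded Ω) {F : Space → ℝ}
    (hF : ContDiff ℝ (⊤ : ℕ∞) F) (c : ℝ) :
    (ofSmooth hb (fun x => c * F x) (contDiff_const.mul hF) : W1 p Ω) = c • ofSmooth hb F hF := by
  refine W1_ext ((fn_mkW1 _ _ _).trans ?_) ((grad_mkW1 _ _ _).trans ?_)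
  · refine EventuallyEq.trans ?_ (fn_smul c _).symm
    exact EventuallyEq.const_smul (fn_mkW1 _ _ _).symm c
  · have h : gradient (fun x => c * F x) = fun x => c • gradient F x := by
      funext x
      rw [gradient, gradient, fderiv_const_mul (hF.differentiable (by simp) x)]
      simp
    have h3 : grad (c • ofSmooth hb F hF : W1 p Ω) =ᵐ[vol Ω]
        fun x => c • grad (ofSmooth hb F hF : W1 p Ω) x := Lp.coeFn_smul _ _
    rw [h]
    refine EventuallyEq.trans ?_ h3.symm
    exact EventuallyEq.const_smul (grad_mkW1 _ _ _).symm c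

theorem IsTrace.add (hΩ : IsBoundedLipschitzDomain Ω) {f f' : H1 Ω} {g g' : Lp ℝ 2 (surf Ω)}
    (h : IsTrace f g) (h' : IsTrace f' g') : IsTrace (f + f') (g + g') := by
  obtain ⟨F, hF, h1, h2⟩ := (isTrace_iff hΩ).1 h
  obtain ⟨F', hF', h1', h2'⟩ := (isTrace_iff hΩ).1 h'
  refine (isTrace_iff hΩ).2 ⟨fun k x => F k x + F' k x, fun k => (hF k).add (hF' k), ?_, ?_⟩
  · exact (h1.add h1').congr fun k => (ofSmooth_add _ (hF k) (hF' k)).symm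
  · exact h2.add h2'

theorem IsTrace.smul (hΩ : IsBoundedLipschitzDomain Ω) {f : H1 Ω} {g : Lp ℝ 2 (surf Ω)}
    (h : IsTrace f g) (c : ℝ) : IsTrace (c • f) (c • g) := by
  obtain ⟨F, hF, h1, h2⟩ := (isTrace_iff hΩ).1 h
  refine (isTrace_iff hΩ).2 ⟨fun k x => c * F k x, fun k => contDiff_const.mul (hF k), ?_, ?_⟩
  · exact (h1.const_smul c).congr fun k => (ofSmooth_smul _ (hF k) c).symm
  · exact h2.const_smul c

theorem exists_norm_isTrace_le (hΩ : IsBoundedLipschitzDomain Ω) :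
    ∃ C : ℝ, 0 ≤ C ∧ ∀ (f : H1 Ω) (g : Lp ℝ 2 (surf Ω)), IsTrace f g → ‖g‖ ≤ C * ‖f‖ := by
  obtain ⟨C, hC0, hC⟩ := exists_norm_surfLp_le hΩ
  refine ⟨C, hC0, fun f g h => ?_⟩
  obtain ⟨F, hF, h1, h2⟩ := (isTrace_iff hΩ).1 h
  exact le_of_tendsto_of_tendsto' h2.norm (h1.norm.const_mul C) fun k => hC _ _

theorem IsTrace.unique (hΩ : IsBoundedLipschitzDomain Ω) {f : H1 Ω} {g g' : Lp ℝ 2 (surf Ω)}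
    (h : IsTrace f g) (h' : IsTrace f g') : g = g' := by
  obtain ⟨C, -, hC⟩ := exists_norm_isTrace_le hΩ
  have h1 := hC _ _ (h.add hΩ (h'.smul hΩ (-1)))
  rw [neg_one_smul, neg_one_smul, add_neg_cancel, norm_zero, mul_zero, ← sub_eq_add_neg] at h1
  exact sub_eq_zero.1 (norm_eq_zero.1 (le_antisymm h1 (norm_nonneg _)))

theorem exists_isTrace (hΩ : IsBoundedLipschitzDomain Ω) (f : H1 Ω) : ∃ g, IsTrace f g := by
  obtain ⟨C, hC0, hC⟩ := exists_norm_surfLp_le hΩ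
  obtain ⟨f', hf', hlim⟩ := mem_closure_iff_seq_limit.1 (dense_smoothH1 hΩ f)
  choose F hF hF1 hF2 using hf'
  have hrep : ∀ k, f' k = ofSmooth hΩ.isBounded (F k) (hF k) := fun k =>
    W1_ext ((hF1 k).trans (fn_mkW1 _ _ _).symm) ((hF2 k).trans (grad_mkW1 _ _ _).symm)
  have hdiff : ∀ k l, ‖surfLp hΩ (F k) (hF k) - surfLp hΩ (F l) (hF l)‖ ≤ C * ‖f' k - f' l‖ := by
    intro k l
    have hl : ContDiff ℝ (⊤ : ℕ∞) fun x => -1 * F l x := contDiff_const.mul (hF l)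
    have e1 : surfLp hΩ (F k) (hF k) - surfLp hΩ (F l) (hF l) =
        surfLp hΩ (fun x => F k x + -1 * F l x) ((hF k).add hl) := by
      rw [sub_eq_add_neg, ← neg_one_smul ℝ (surfLp hΩ (F l) (hF l))]
      rfl
    have e2 : f' k - f' l = ofSmooth hΩ.isBounded (fun x => F k x + -1 * F l x) ((hF k).add hl) := by
      rw [ofSmooth_add _ (hF k) hl, ofSmooth_smul _ (hF l), ← hrep, ← hrep, neg_one_smul, sub_eq_add_neg]
    rw [e1, e2]
    exact hC _ _
  have hcauchy : CauchySeq fun k => surfLp hΩ (F k) (hF k) := by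
    have h1 := Metric.cauchySeq_iff.1 hlim.cauchySeq
    refine Metric.cauchySeq_iff.2 fun ε hε => ?_
    obtain ⟨N, hN⟩ := h1 (ε / (C + 1)) (by positivity)
    refine ⟨N, fun m hm n hn => ?_⟩
    have h2 := hN m hm n hn
    rw [dist_eq_norm, lt_div_iff₀ (by positivity)] at h2
    rw [dist_eq_norm]
    have h3 := hdiff m n
    nlinarith [norm_nonneg (f' m - f' n)]
  obtain ⟨g, hg⟩ := cauchySeq_tendsto_of_complete hcauchy
  refine ⟨g, (isTrace_iff hΩ).2 ⟨F, hF, ?_, hg⟩⟩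
  simpa only [← hrep] using hlim

theorem isTrace_tr (hΩ : IsBoundedLipschitzDomain Ω) (f : H1 Ω) : IsTrace f (tr f) := by
  have h := exists_isTrace hΩ f
  rw [tr, dif_pos h]
  exact h.choose_spec

theorem exists_norm_tr_le (hΩ : IsBoundedLipschitzDomain Ω) :
    ∃ C : ℝ, ∀ f : H1 Ω, ‖tr f‖ ≤ C * ‖f‖ := by
  obtain ⟨C, -, hC⟩ := exists_norm_isTrace_le hΩ
  exact ⟨C, fun f => hC f _ (isTrace_tr hΩ f)⟩

/-- The trace as a bounded operator from `H¹(Ω)` to `L²(∂Ω)`. -/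
def trL (hΩ : IsBoundedLipschitzDomain Ω) : H1 Ω →L[ℝ] Lp ℝ 2 (surf Ω) :=
  LinearMap.mkContinuousOfExistsBound
    { toFun := tr
      map_add' := fun f g => (isTrace_tr hΩ (f + g)).unique hΩ
        ((isTrace_tr hΩ f).add hΩ (isTrace_tr hΩ g))
      map_smul' := fun c f => (isTrace_tr hΩ (c • f)).unique hΩ ((isTrace_tr hΩ f).smul hΩ c) }
    (exists_norm_tr_le hΩ)

/-- A smooth cutoff function vanishing exactly on `[-C, C]`. -/
theorem exists_smooth_vanishing_exactly {C : ℝ} (hC : 0 ≤ C) :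
    ∃ (χ : ℝ → ℝ) (L : ℝ≥0), ContDiff ℝ (⊤ : ℕ∞) χ ∧ LipschitzWith L χ ∧
      ∀ s, χ s = 0 ↔ |s| ≤ C := by
  set χ : ℝ → ℝ := fun s => Real.smoothTransition (s ^ 2 - C ^ 2)
  have hχ : ContDiff ℝ (⊤ : ℕ∞) χ :=
    Real.smoothTransition.contDiff.comp ((contDiff_id.pow 2).sub contDiff_const)
  have hs : HasCompactSupport fun s => 1 - χ s := by
    refine HasCompactSupport.of_support_subset_isCompact
      (isCompact_Icc (a := -(C + 1)) (b := C + 1)) fun s hs => ?_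
    rw [mem_Icc, ← abs_le]
    by_contra! h
    refine hs ?_
    have h1 : 1 ≤ s ^ 2 - C ^ 2 := by
      rw [← sq_abs s]; nlinarith
    change 1 - Real.smoothTransition (s ^ 2 - C ^ 2) = 0
    rw [Real.smoothTransition.one_of_one_le h1, sub_self]
  have hd : ContDiff ℝ (⊤ : ℕ∞) fun s => 1 - χ s := contDiff_const.sub hχ
  obtain ⟨L, hL⟩ := (hs.deriv).exists_bound_of_continuous (hd.continuous_deriv (by simp))
  refine ⟨χ, L.toNNReal, hχ, ?_, fun s => ?_⟩
  · refine lipschitzWith_of_nnnorm_deriv_le (hχ.differentiable (by simp)) fun s => ?_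
    have h1 : deriv (fun s => 1 - χ s) s = - deriv χ s := by
      rw [deriv_const_sub]
    have h2 := hL s
    rw [h1, norm_neg] at h2
    rw [← NNReal.coe_le_coe, coe_nnnorm]
    exact h2.trans (Real.le_coe_toNNReal L)
  · constructor
    · intro h
      by_contra! hs
      have : 0 < s ^ 2 - C ^ 2 := by rw [← sq_abs s]; nlinarith
      exact absurd h (Real.smoothTransition.pos_of_pos this).ne'
    · intro h
      refine Real.smoothTransition.zero_of_nonpos ?_
      have := abs_nonneg s
      rw [← sq_abs s]; nlinarith

theorem eLpNorm_comp_sub_comp_le {α : Type*} [MeasurableSpace α] {ν : Measure α} {χ : ℝ → ℝ}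
    {L : ℝ≥0} (hL : LipschitzWith L χ) (f g : α → ℝ) (p : ℝ≥0∞) :
    eLpNorm (fun x => χ (f x) - χ (g x)) p ν ≤ L * eLpNorm (fun x => f x - g x) p ν := by
  refine eLpNorm_le_nnreal_smul_eLpNorm_of_ae_le_mul (Eventually.of_forall fun x => ?_) p
  rw [← NNReal.coe_le_coe]
  simpa [dist_eq_norm] using hL.dist_le_mul (f x) (g x)

/-- The trace of a function bounded by `C` is bounded by `C`: if `χ` vanishes exactly on `[-C, C]`
and `F_k` are smooth approximations, the multiplicative trace inequality shows that
`χ ∘ F_k` tends to zero on the boundary. -/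
theorem abs_tr_le (hΩ : IsBoundedLipschitzDomain Ω) {f : H1 Ω} {C : ℝ} (hC : 0 ≤ C)
    (hf : ∀ᵐ x ∂(vol Ω), |fn f x| ≤ C) : ∀ᵐ x ∂(surf Ω), |tr f x| ≤ C := by
  obtain ⟨χ, L, hχ, hL, hχ0⟩ := exists_smooth_vanishing_exactly hC
  obtain ⟨K, hK⟩ := exists_trace_inequality_L2 hΩ
  obtain ⟨F, hF, h1, h2, h3⟩ := isTrace_tr hΩ f
  have hχF : ∀ k, ContDiff ℝ (⊤ : ℕ∞) fun x => χ (F k x) := fun k => hχ.comp (hF k)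
  -- the `L²(Ω)` norms of `χ ∘ F_k` tend to zero, since `χ ∘ f = 0`
  have hA : Tendsto (fun k => eLpNorm (fun x => χ (F k x)) 2 (vol Ω)) atTop (𝓝 0) := by
    refine tendsto_of_tendsto_of_tendsto_of_le_of_le tendsto_const_nhds
      (b := atTop) (h := fun k => L * eLpNorm (fun x => F k x - fn f x) 2 (vol Ω)) ?_
      (fun _ => zero_le) fun k => ?_
    · simpa using ENNReal.Tendsto.const_mul h1 (Or.inr ENNReal.coe_ne_top)
    · refine le_trans (le_of_eq (eLpNorm_congr_ae ?_)) (eLpNorm_comp_sub_comp_le hL (F k) (fn f) 2)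
      filter_upwards [hf] with x hx
      rw [(hχ0 _).2 hx, sub_zero]
  have hB : ∀ k, eLpNorm (gradient fun x => χ (F k x)) 2 (vol Ω) ≤
      L * (eLpNorm (fun x => gradient (F k) x - grad f x) 2 (vol Ω)
        + eLpNorm (grad f) 2 (vol Ω)) := by
    intro k
    calc eLpNorm (gradient fun x => χ (F k x)) 2 (vol Ω)
        ≤ L * eLpNorm (gradient (F k)) 2 (vol Ω) := by
          refine eLpNorm_le_nnreal_smul_eLpNorm_of_ae_le_mul (Eventually.of_forall fun x => ?_) 2
          rw [← NNReal.coe_le_coe]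
          push_cast
          rw [norm_gradient, norm_gradient]
          have hdd : fderiv ℝ (fun x => χ (F k x)) x = deriv χ (F k x) • fderiv ℝ (F k) x :=
            ((hχ.differentiable (by simp) _).hasDerivAt.comp_hasFDerivAt x
              ((hF k).differentiable (by simp) x).hasFDerivAt).fderiv
          rw [hdd, norm_smul]
          gcongr
          exact norm_deriv_le_of_lipschitz hL
      _ ≤ _ := by
          gcongr
          have e : gradient (F k) = (fun x => gradient (F k) x - grad f x) + grad f := by
            funext x; simp
          conv_lhs => rw [e]
          exact eLpNorm_add_le ((continuous_gradient (hF k)).aestronglyMeasurable.sub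
            (memLp_grad f).1) (memLp_grad f).1 (by norm_num)
  have hBlim : Tendsto (fun k => L * (eLpNorm (fun x => gradient (F k) x - grad f x) 2 (vol Ω)
      + eLpNorm (grad f) 2 (vol Ω))) atTop (𝓝 (L * (0 + eLpNorm (grad f) 2 (vol Ω)))) :=
    ENNReal.Tendsto.const_mul (h2.add tendsto_const_nhds) (Or.inr ENNReal.coe_ne_top)
  have hS : Tendsto (fun k => eLpNorm (fun x => χ (F k x)) 2 (surf Ω)) atTop (𝓝 0) := by
    have hS2 : Tendsto (fun k => eLpNorm (fun x => χ (F k x)) 2 (surf Ω) ^ 2) atTop (𝓝 0) := by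
      refine tendsto_of_tendsto_of_tendsto_of_le_of_le tendsto_const_nhds
        (b := atTop) (h := fun k => K * (eLpNorm (fun x => χ (F k x)) 2 (vol Ω) *
          (eLpNorm (fun x => χ (F k x)) 2 (vol Ω) + 2 * (L *
            (eLpNorm (fun x => gradient (F k) x - grad f x) 2 (vol Ω)
              + eLpNorm (grad f) 2 (vol Ω)))))) ?_
        (fun _ => zero_le) fun k => ?_
      · have hfin : eLpNorm (grad f) 2 (vol Ω) ≠ ∞ := (memLp_grad f).2.ne
        have hX := hA.add (ENNReal.Tendsto.const_mul (a := 2) hBlim (Or.inr (by simp)))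
        have hY := ENNReal.Tendsto.mul hA (Or.inr (by finiteness)) hX (Or.inr (by simp))
        have hZ := ENNReal.Tendsto.const_mul (a := (K : ℝ≥0∞)) hY (Or.inr ENNReal.coe_ne_top)
        simpa using hZ
      · refine (hK _ (hχF k)).trans ?_
        refine mul_le_mul_right (mul_le_mul_right (add_le_add_right ?_ _) _) _
        exact mul_le_mul_right (hB k) _
    have := hS2.ennrpow_const (1 / 2)
    rw [ENNReal.zero_rpow_of_pos (by norm_num)] at this
    refine this.congr fun k => ?_
    rw [← ENNReal.rpow_natCast, ← ENNReal.rpow_mul]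
    norm_num
  have hS' : Tendsto (fun k => eLpNorm (fun x => χ (F k x) - χ (tr f x)) 2 (surf Ω)) atTop
      (𝓝 0) := by
    refine tendsto_of_tendsto_of_tendsto_of_le_of_le tendsto_const_nhds
      (b := atTop) (h := fun k => L * eLpNorm (fun x => F k x - tr f x) 2 (surf Ω)) ?_
      (fun _ => zero_le) fun k => eLpNorm_comp_sub_comp_le hL (F k) (tr f) 2
    simpa using ENNReal.Tendsto.const_mul h3 (Or.inr ENNReal.coe_ne_top)
  have hm : AEStronglyMeasurable (fun x => χ (tr f x)) (surf Ω) :=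
    hχ.continuous.comp_aestronglyMeasurable (Lp.aestronglyMeasurable (tr f))
  have hzero : eLpNorm (fun x => χ (tr f x)) 2 (surf Ω) = 0 := by
    refine le_antisymm (ge_of_tendsto' (by simpa using hS.add hS') fun k => ?_) zero_le
    have e : (fun x => χ (tr f x)) =
        (fun x => χ (F k x)) - fun x => χ (F k x) - χ (tr f x) := by
      funext x; simp
    conv_lhs => rw [e]
    exact eLpNorm_sub_le (hχF k).continuous.aestronglyMeasurable
      ((hχF k).continuous.aestronglyMeasurable.sub hm) (by norm_num)
  rw [eLpNorm_eq_zero_iff hm (by norm_num)] at hzero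
  filter_upwards [hzero] with x hx using (hχ0 _).1 hx

end TraceOperator

/-! ### The Sobolev embedding of `H¹₀(Ω)` -/

theorem exists_eLpNorm_six_le : ∃ C : ℝ≥0, ∀ {Ω : Set Space}, IsOpen Ω → ∀ f ∈ H10 Ω,
    eLpNorm (fn f) 6 (vol Ω) ≤ C * ‖f‖ₑ := by
  set C : ℝ≥0 := SNormLESNormFDerivOfEqConst ℝ (volume : Measure Space) (2 : ℝ≥0)
  refine ⟨C, fun {Ω} hΩ f hf => ?_⟩
  have htest : ∀ f ∈ Submodule.span ℝ {f : H1 Ω | ∃ ψ, IsTestFun Ω ψ ∧ fn f =ᵐ[vol Ω] ψ},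
      ∃ ψ, IsTestFun Ω ψ ∧ fn f =ᵐ[vol Ω] ψ := by
    intro f hf
    induction hf using Submodule.span_induction with
    | mem f h => exact h
    | zero =>
      refine ⟨fun _ => 0, ⟨contDiff_const, HasCompactSupport.zero, ?_⟩, fn_zero⟩
      have : tsupport (fun _ : Space => (0 : ℝ)) = ∅ := tsupport_eq_empty_iff.2 rfl
      rw [this]; exact empty_subset _
    | add f g _ _ hf hg =>
      obtain ⟨ψ, hψ, h1⟩ := hf
      obtain ⟨ξ, hξ, h2⟩ := hg
      refine ⟨fun x => ψ x + ξ x, ⟨hψ.1.add hξ.1, hψ.2.1.add hξ.2.1,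
        (tsupport_add ψ ξ).trans (union_subset hψ.2.2 hξ.2.2)⟩, ?_⟩
      exact (fn_add f g).trans (h1.add h2)
    | smul c f _ hf =>
      obtain ⟨ψ, hψ, h1⟩ := hf
      exact ⟨fun x => c * ψ x, hψ.mul_left contDiff_const, (fn_smul c f).trans (h1.const_smul c)⟩
  have hsupp : ∀ ψ, IsTestFun Ω ψ → Function.support (gradient ψ) ⊆ Ω := by
    intro ψ hψ x hx
    refine hψ.2.2 (tsupport_fderiv_subset ℝ (subset_tsupport _ fun h => hx ?_))
    rw [← norm_eq_zero, norm_gradient, h, norm_zero]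
  have hspan : ∀ f ∈ Submodule.span ℝ {f : H1 Ω | ∃ ψ, IsTestFun Ω ψ ∧ fn f =ᵐ[vol Ω] ψ},
      eLpNorm (fn f) 6 (vol Ω) ≤ C * ‖f‖ₑ := by
    intro f hf
    obtain ⟨ψ, hψ, h1⟩ := htest f hf
    have hgns := eLpNorm_le_eLpNorm_fderiv_of_eq (F := ℝ) (volume : Measure Space) (u := ψ)
      (hψ.1.of_le (by exact_mod_cast le_top)) hψ.2.1 (p := 2) (p' := 6) (by norm_num)
      (by simp) (by simp; norm_num)
    have hgrad : grad f =ᵐ[vol Ω] gradient ψ := by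
      refine (hasWeakGradient_fn f).ae_unique (p := 2) hΩ
        ((hasWeakGradient_of_contDiff hψ.1).congr h1.symm EventuallyEq.rfl) (memLp_grad f) ?_
      exact (continuous_gradient hψ.1).memLp_of_hasCompactSupport
        ((hψ.2.1.fderiv (𝕜 := ℝ)).comp_left (map_zero _))
    calc eLpNorm (fn f) 6 (vol Ω) = eLpNorm ψ 6 (vol Ω) := eLpNorm_congr_ae h1
      _ ≤ eLpNorm ψ 6 volume := eLpNorm_restrict_le _ _ _ _
      _ ≤ C * eLpNorm (fderiv ℝ ψ) 2 volume := by exact_mod_cast hgns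
      _ = C * eLpNorm (gradient ψ) 2 volume := by
        congr 1
        exact eLpNorm_congr_norm_ae (Eventually.of_forall fun x => (norm_gradient ψ x).symm)
      _ = C * eLpNorm (gradient ψ) 2 (vol Ω) := by
        rw [eLpNorm_restrict_eq_of_support_subset (hsupp ψ hψ)]
      _ = C * eLpNorm (grad f) 2 (vol Ω) := by
        rw [eLpNorm_congr_ae hgrad]
      _ ≤ C * ‖f‖ₑ := by
        gcongr
        have h2 : ‖gradL 2 Ω f‖ₑ ≤ ‖f‖ₑ := enorm_le_iff_norm_le.2 (norm_gradL_le f)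
        rwa [Lp.enorm_def] at h2
  obtain ⟨f', hf', hlim⟩ := mem_closure_iff_seq_limit.1 hf
  obtain ⟨ns, hns, hae⟩ := (tendstoInMeasure_of_tendsto_Lp
    (((fnL 2 Ω).continuous.tendsto f).comp hlim)).exists_seq_tendsto_ae
  refine (Lp.eLpNorm_lim_le_liminf_eLpNorm (f := fun k => fn (f' (ns k)))
    (fun k => (memLp_fn (f' (ns k))).1) (fn f) hae).trans ?_
  have h1 : Tendsto (fun k => C * ‖f' (ns k)‖ₑ) atTop (𝓝 (C * ‖f‖ₑ)) :=
    ENNReal.Tendsto.const_mul ((continuous_enorm.tendsto f).comp (hlim.comp hns.tendsto_atTop))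
      (Or.inr ENNReal.coe_ne_top)
  rw [← h1.liminf_eq]
  exact liminf_le_liminf (Eventually.of_forall fun k => hspan _ (hf' (ns k)))

/-! ### Operators between Lebesgue spaces -/

instance factOneLeSix : Fact ((1 : ℝ≥0∞) ≤ 6) := ⟨by norm_num⟩

instance holderTripleSixSixThree : ENNReal.HolderTriple 6 6 3 where
  inv_add_inv_eq_inv := by
    rw [← ENNReal.toReal_eq_toReal_iff' (by simp) (by simp), ENNReal.toReal_add (by simp) (by simp)]
    simp; norm_num

instance holderTripleSixThreeTwo : ENNReal.HolderTriple 6 3 2 where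
  inv_add_inv_eq_inv := by
    rw [← ENNReal.toReal_eq_toReal_iff' (by simp) (by simp), ENNReal.toReal_add (by simp) (by simp)]
    simp; norm_num

theorem coeFn_sum {α : Type*} [MeasurableSpace α] {ν : Measure α} {E : Type*}
    [NormedAddCommGroup E] {p : ℝ≥0∞} {ι : Type*} (s : Finset ι) (f : ι → Lp E p ν) :
    ((∑ i ∈ s, f i : Lp E p ν) : α → E) =ᵐ[ν] fun x => ∑ i ∈ s, f i x := by
  classical
  induction s using Finset.induction_on with
  | empty =>
    rw [Finset.sum_empty]
    exact (Lp.coeFn_zero E p ν).trans (Eventually.of_forall fun x => by simp)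
  | insert i s hi ih =>
    rw [Finset.sum_insert hi]
    filter_upwards [Lp.coeFn_add (f i) (∑ j ∈ s, f j), ih] with x h1 h2
    rw [h1, Pi.add_apply, h2, Finset.sum_insert hi]

section Lp

variable {α : Type*} [MeasurableSpace α] {ν : Measure α} {E F H : Type*} [NormedAddCommGroup E]
  [NormedSpace ℝ E] [NormedAddCommGroup F] [NormedSpace ℝ F] [NormedAddCommGroup H]
  [InnerProductSpace ℝ H]

variable (ν E) in
/-- Multiplication of `L^s` and `L^p` functions, with values in `L^q`. -/
def smulL (s p q : ℝ≥0∞) [ENNReal.HolderTriple s p q] [Fact (1 ≤ s)] [Fact (1 ≤ p)]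
    [Fact (1 ≤ q)] : Lp ℝ s ν →L[ℝ] Lp E p ν →L[ℝ] Lp E q ν :=
  (ContinuousLinearMap.lsmul ℝ ℝ).holderL ν s p q

section

variable {s p q : ℝ≥0∞} [ENNReal.HolderTriple s p q] [Fact (1 ≤ s)] [Fact (1 ≤ p)] [Fact (1 ≤ q)]

theorem smulL_ae {a : Lp ℝ s ν} {f : Lp E p ν} {a' : α → ℝ} {f' : α → E}
    (ha : a =ᵐ[ν] a') (hf : f =ᵐ[ν] f') :
    (smulL ν E s p q a f : α → E) =ᵐ[ν] fun x => a' x • f' x := by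
  filter_upwards [ContinuousLinearMap.coeFn_holder (r := q) (ContinuousLinearMap.lsmul ℝ ℝ) a f,
    ha, hf] with x h1 h2 h3
  refine h1.trans ?_
  rw [h2, h3]
  rfl

variable (ν E s p q) in
/-- The inclusion of `L^p` into `L^q` for a finite measure, as multiplication with the constant
function `1` in `L^s`. -/
def inclL [IsFiniteMeasure ν] : Lp E p ν →L[ℝ] Lp E q ν :=
  smulL ν E s p q ((memLp_const 1).toLp fun _ => 1)

theorem inclL_ae [IsFiniteMeasure ν] {f : Lp E p ν} {f' : α → E} (hf : f =ᵐ[ν] f') :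
    (inclL ν E s p q f : α → E) =ᵐ[ν] f' := by
  filter_upwards [smulL_ae (q := q) (memLp_const (p := s) (μ := ν) (1 : ℝ)).coeFn_toLp hf]
    with x hx
  exact hx.trans (one_smul _ _)

end

variable {p : ℝ≥0∞} [Fact (1 ≤ p)]

/-- The operator combining several `L^p` valued operators pointwise by linear maps. -/
def combineL {ι X : Type*} [Fintype ι] [NormedAddCommGroup X] [NormedSpace ℝ X]
    (A : ι → X →L[ℝ] Lp E p ν) (T : ι → E →L[ℝ] F) : X →L[ℝ] Lp F p ν :=
  ∑ i, ((T i).compLpL p ν).comp (A i)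

theorem combineL_ae {ι X : Type*} [Fintype ι] [NormedAddCommGroup X] [NormedSpace ℝ X]
    (A : ι → X →L[ℝ] Lp E p ν) (T : ι → E →L[ℝ] F) (x : X) :
    (combineL A T x : α → F) =ᵐ[ν] fun ω => ∑ i, T i (A i x ω) := by
  have h1 : combineL A T x = ∑ i, (T i).compLpL p ν (A i x) := by
    simp [combineL]
  rw [h1]
  filter_upwards [coeFn_sum Finset.univ fun i => (T i).compLpL p ν (A i x),
    ae_all_iff.2 fun i => (T i).coeFn_compLpL (A i x)] with ω h2 h3
  rw [h2]
  exact Finset.sum_congr rfl fun i _ => h3 i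

variable (H) in
/-- The inner product of a real inner product space as a bounded bilinear map. -/
def innerL : H →L[ℝ] H →L[ℝ] ℝ :=
  (innerₗ H).mkContinuous₂ 1 fun x y => by simpa using norm_inner_le_norm (𝕜 := ℝ) x y

/-- The functional `z ↦ (f, T z)`, depending linearly on `f`. -/
def dualPair {X : Type*} [NormedAddCommGroup X] [NormedSpace ℝ X] (T : X →L[ℝ] H) :
    H →L[ℝ] StrongDual ℝ X :=
  ((ContinuousLinearMap.compL ℝ X H ℝ).flip T).comp (innerL H)

end Lp

theorem pair_eq_inner {H : Type*} [NormedAddCommGroup H] [InnerProductSpace ℝ H]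
    {ν : Measure Space} {f h : Space → H} {f' h' : Lp H 2 ν} (hf : f' =ᵐ[ν] f) (hh : h' =ᵐ[ν] h) :
    inner ℝ f' h' = pair ν f h := by
  rw [L2.inner_def, pair]
  refine integral_congr_ae ?_
  filter_upwards [hf, hh] with x h1 h2
  rw [h1, h2]

/-! ### Vector fields as elements of Lebesgue spaces -/

section VectorFields

variable {Ω : Set Space}

variable (Ω) in
/-- The components of a velocity field as operators into `H¹(Ω)`. -/
def compL (i : Fin 3) : Hsig Ω →L[ℝ] H1 Ω :=
  (PiLp.proj (𝕜 := ℝ) 2 (fun _ : Fin 3 => H1 Ω) i).comp (Hsig Ω).subtypeL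

theorem norm_compL_le (i : Fin 3) (v : Hsig Ω) : ‖compL Ω i v‖ ≤ ‖v‖ := PiLp.norm_apply_le v.1 i

variable (Ω) in
/-- The velocity field in `L²`. -/
def vec2L : Hsig Ω →L[ℝ] Lp Space 2 (vol Ω) :=
  combineL (fun i => (fnL 2 Ω).comp (compL Ω i))
    fun i => ContinuousLinearMap.toSpanSingleton ℝ (EuclideanSpace.single i 1)

theorem sum_smul_single (x : Space) :
    ∑ i, x i • (EuclideanSpace.single i 1 : Space) = x := by
  ext j
  simp [Finset.sum_apply, Pi.single_apply]

theorem vec2L_ae (v : Hsig Ω) : (vec2L Ω v : Space → Space) =ᵐ[vol Ω] vec v.1 := by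
  filter_upwards [combineL_ae (fun i => (fnL 2 Ω).comp (compL Ω i))
    (fun i => ContinuousLinearMap.toSpanSingleton ℝ (EuclideanSpace.single i 1 : Space)) v] with x hx
  exact hx.trans (sum_smul_single (vec v.1 x))

/-- The linear map which assigns to the gradient of the `i`-th component of a field its
contribution to the symmetric gradient. -/
def symPart (i : Fin 3) : Space →L[ℝ] EuclideanSpace ℝ (Fin 3 × Fin 3) :=
  LinearMap.toContinuousLinearMap
    { toFun := fun x => WithLp.toLp 2 fun ij =>
        ((if ij.1 = i then x ij.2 else 0) + (if ij.2 = i then x ij.1 else 0)) / 2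
      map_add' := by
        intro x y; ext ij; simp only [PiLp.add_apply]; split_ifs <;> ring
      map_smul' := by
        intro c x; ext ij; simp only [PiLp.smul_apply, smul_eq_mul, RingHom.id_apply]
        split_ifs <;> ring }

theorem symPart_apply (i : Fin 3) (x : Space) (ij : Fin 3 × Fin 3) : symPart i x ij =
    ((if ij.1 = i then x ij.2 else 0) + (if ij.2 = i then x ij.1 else 0)) / 2 := rfl

variable (Ω) in
/-- The symmetric gradient of a velocity field in `L²`. -/
def symGradL : Hsig Ω →L[ℝ] Lp (EuclideanSpace ℝ (Fin 3 × Fin 3)) 2 (vol Ω) :=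
  combineL (fun i => (gradL 2 Ω).comp (compL Ω i)) symPart

theorem sum_symPart_apply (x : Fin 3 → Space) (ij : Fin 3 × Fin 3) :
    (∑ i, symPart i (x i)) ij = (x ij.1 ij.2 + x ij.2 ij.1) / 2 := by
  rw [WithLp.ofLp_sum, Finset.sum_apply]
  simp only [symPart_apply]
  rw [← Finset.sum_div, Finset.sum_add_distrib, Finset.sum_ite_eq, Finset.sum_ite_eq]
  simp only [Finset.mem_univ, if_true]

theorem symGradL_ae (v : Hsig Ω) :
    (symGradL Ω v : Space → EuclideanSpace ℝ (Fin 3 × Fin 3)) =ᵐ[vol Ω] symGrad v.1 := by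
  filter_upwards [combineL_ae (fun i => (gradL 2 Ω).comp (compL Ω i)) symPart v] with x hx
  refine hx.trans ?_
  ext ij
  exact sum_symPart_apply (fun i => grad (v.1 i) x) ij

theorem memLp_six (hΩ : IsOpen Ω) (i : Fin 3) (v : Hsig Ω) : MemLp (fn (v.1 i)) 6 (vol Ω) := by
  obtain ⟨C, hC⟩ := exists_eLpNorm_six_le
  exact ⟨(memLp_fn (v.1 i)).1, (hC hΩ _ (v.2.1 i)).trans_lt (by finiteness)⟩

/-- The components of a velocity field in `L⁶`, without the bound. -/
def comp6 (hΩ : IsOpen Ω) (i : Fin 3) : Hsig Ω →ₗ[ℝ] Lp ℝ 6 (vol Ω) where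
  toFun v := (memLp_six hΩ i v).toLp (fn (v.1 i))
  map_add' v w := by
    refine Eq.trans ?_ (MemLp.toLp_add (memLp_six hΩ i v) (memLp_six hΩ i w))
    exact MemLp.toLp_congr _ _ (fn_add (v.1 i) (w.1 i))
  map_smul' c v := by
    refine Eq.trans ?_ (MemLp.toLp_const_smul c (memLp_six hΩ i v))
    exact MemLp.toLp_congr _ _ (fn_smul c (v.1 i))

theorem exists_norm_comp6_le (hΩ : IsOpen Ω) (i : Fin 3) :
    ∃ C : ℝ, ∀ v, ‖comp6 hΩ i v‖ ≤ C * ‖v‖ := by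
  obtain ⟨C, hC⟩ := exists_eLpNorm_six_le
  refine ⟨C, fun v => ?_⟩
  have h1 : ‖comp6 hΩ i v‖ₑ ≤ C * ‖v.1 i‖ₑ :=
    (Lp.enorm_toLp (memLp_six hΩ i v)).trans_le (hC hΩ _ (v.2.1 i))
  have h2 : ‖comp6 hΩ i v‖ ≤ C * ‖v.1 i‖ := by
    simp only [enorm_eq_nnnorm] at h1
    exact_mod_cast h1
  exact h2.trans (mul_le_mul_of_nonneg_left (norm_compL_le i v) C.2)

/-- The components of a velocity field in `L⁶`. -/
def comp6L (hΩ : IsOpen Ω) (i : Fin 3) : Hsig Ω →L[ℝ] Lp ℝ 6 (vol Ω) :=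
  (comp6 hΩ i).mkContinuousOfExistsBound (exists_norm_comp6_le hΩ i)

theorem comp6L_ae (hΩ : IsOpen Ω) (i : Fin 3) (v : Hsig Ω) :
    (comp6L hΩ i v : Space → ℝ) =ᵐ[vol Ω] fn (v.1 i) := (memLp_six hΩ i v).coeFn_toLp

/-- The velocity field in `L³`. -/
def vec3L (hΩ : IsOpen Ω) [IsFiniteMeasure (vol Ω)] : Hsig Ω →L[ℝ] Lp Space 3 (vol Ω) :=
  combineL (p := 3) (fun i => (inclL (vol Ω) ℝ 6 6 3).comp (comp6L hΩ i))
    fun i => ContinuousLinearMap.toSpanSingleton ℝ (EuclideanSpace.single i 1 : Space)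

theorem vec3L_ae (hΩ : IsOpen Ω) [IsFiniteMeasure (vol Ω)] (v : Hsig Ω) :
    (vec3L hΩ v : Space → Space) =ᵐ[vol Ω] vec v.1 := by
  filter_upwards [combineL_ae (p := 3) (fun i => (inclL (vol Ω) ℝ 6 6 3).comp (comp6L hΩ i))
    (fun i => ContinuousLinearMap.toSpanSingleton ℝ (EuclideanSpace.single i 1 : Space)) v,
    ae_all_iff.2 fun i => inclL_ae (s := 6) (p := 6) (q := 3) (comp6L_ae hΩ i v)] with x hx hx2
  refine hx.trans ((Finset.sum_congr rfl fun i _ => ?_).trans (sum_smul_single (vec v.1 x)))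
  exact congrArg (fun t : ℝ => t • (EuclideanSpace.single i 1 : Space)) (hx2 i)

end VectorFields

/-! ### Superposition operators on `L^∞` -/

section Nemytskii

variable {α : Type*} [MeasurableSpace α] {ν : Measure α}

theorem ae_norm_le_norm_top (a : Lp ℝ ⊤ ν) : ∀ᵐ x ∂ν, |a x| ≤ ‖a‖ := by
  filter_upwards [ae_le_eLpNormEssSup (f := a) (μ := ν)] with x hx
  rw [← eLpNorm_exponent_top, ← Lp.enorm_def] at hx
  exact enorm_le_iff_norm_le.1 hx

theorem norm_top_le_of_ae_bound {a : Lp ℝ ⊤ ν} {C : ℝ} (hC : 0 ≤ C) (h : ∀ᵐ x ∂ν, |a x| ≤ C) :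
    ‖a‖ ≤ C := by
  rw [Lp.norm_def, eLpNorm_exponent_top]
  exact ENNReal.toReal_le_of_le_ofReal hC (eLpNormEssSup_le_of_ae_bound h)

theorem memLp_comp_top {f : ℝ → ℝ} (hf : Continuous f) (a : Lp ℝ ⊤ ν) :
    MemLp (fun x => f (a x)) ⊤ ν := by
  obtain ⟨C, hC⟩ := (isCompact_Icc (a := -‖a‖) (b := ‖a‖)).exists_bound_of_continuousOn
    hf.continuousOn
  refine memLp_top_of_bound (hf.comp_aestronglyMeasurable (Lp.aestronglyMeasurable a)) C ?_
  filter_upwards [ae_norm_le_norm_top a] with x hx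
  exact hC _ (abs_le.1 hx)

/-- The superposition operator `a ↦ f ∘ a` on `L^∞`. -/
def nem {f : ℝ → ℝ} (hf : Continuous f) (a : Lp ℝ ⊤ ν) : Lp ℝ ⊤ ν :=
  (memLp_comp_top hf a).toLp _

theorem nem_ae {f : ℝ → ℝ} (hf : Continuous f) {a : Lp ℝ ⊤ ν} {a' : α → ℝ} (ha : a =ᵐ[ν] a') :
    (nem hf a : α → ℝ) =ᵐ[ν] fun x => f (a' x) := by
  filter_upwards [(memLp_comp_top hf a).coeFn_toLp, ha] with x h1 h2
  exact h1.trans (by rw [h2])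

theorem hasFDerivAt_nem {f : ℝ → ℝ} (hf : Continuous f) (hd : Differentiable ℝ f)
    (hf' : Continuous (deriv f)) (a : Lp ℝ ⊤ ν) :
    HasFDerivAt (nem hf) (smulL ν ℝ ⊤ ⊤ ⊤ (nem hf' a)) a := by
  rw [hasFDerivAt_iff_isLittleO_nhds_zero, Asymptotics.isLittleO_iff]
  intro ε hε
  have hu := (isCompact_Icc (a := -(‖a‖ + 1)) (b := ‖a‖ + 1)).uniformContinuousOn_of_continuous
    hf'.continuousOn
  obtain ⟨δ, hδ, hu⟩ := Metric.uniformContinuousOn_iff.1 hu ε hε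
  filter_upwards [Metric.ball_mem_nhds (0 : Lp ℝ ⊤ ν) (lt_min hδ one_pos)] with d hd'
  rw [mem_ball_zero_iff, lt_min_iff] at hd'
  refine norm_top_le_of_ae_bound (by positivity) ?_
  filter_upwards [ae_norm_le_norm_top a, ae_norm_le_norm_top d, nem_ae hf (Lp.coeFn_add a d),
    nem_ae hf (ae_eq_refl a), smulL_ae (E := ℝ) (q := ⊤) (nem_ae hf' (ae_eq_refl a)) (ae_eq_refl d),
    Lp.coeFn_sub (nem hf (a + d) - nem hf a) (smulL ν ℝ ⊤ ⊤ ⊤ (nem hf' a) d),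
    Lp.coeFn_sub (nem hf (a + d)) (nem hf a)] with x h1 h2 h3 h4 h5 h6 h7
  rw [h6, Pi.sub_apply, h7, Pi.sub_apply, h3, h4, h5, Pi.add_apply, smul_eq_mul]
  -- the mean value inequality for `t ↦ f t - f' (a x) t` on the segment from `a x` to `a x + d x`
  have hmem : ∀ t ∈ uIcc (a x) (a x + d x),
      t ∈ Icc (-(‖a‖ + 1)) (‖a‖ + 1) ∧ |t - a x| ≤ |d x| := by
    intro t ht
    have h8 := abs_sub_left_of_mem_uIcc ht
    rw [add_sub_cancel_left] at h8
    refine ⟨?_, h8⟩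
    rw [abs_le] at h1
    rw [abs_le] at h8
    constructor <;> linarith
  have hmv := (convex_uIcc (a x) (a x + d x)).norm_image_sub_le_of_norm_hasDerivWithin_le
    (f := fun t => f t - deriv f (a x) * t) (f' := fun t => deriv f t - deriv f (a x)) (C := ε)
    (fun t _ => ((hd t).hasDerivAt.sub (by
      simpa using (hasDerivAt_id t).const_mul (deriv f (a x)))).hasDerivWithinAt)
    (fun t ht => by
      have h8 := hmem t ht
      have h9 := hmem (a x) left_mem_uIcc
      exact (hu t h8.1 (a x) h9.1 (by
        rw [Real.dist_eq]; linarith [h8.2])).le) left_mem_uIcc right_mem_uIcc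
  rw [add_sub_cancel_left] at hmv
  calc |f (a x + d x) - f (a x) - deriv f (a x) * d x|
      = ‖f (a x + d x) - deriv f (a x) * (a x + d x) - (f (a x) - deriv f (a x) * a x)‖ := by
        rw [Real.norm_eq_abs]; ring_nf
    _ ≤ ε * ‖d x‖ := hmv
    _ ≤ ε * ‖d‖ := by
        rw [Real.norm_eq_abs]
        exact mul_le_mul_of_nonneg_left h2 hε.le

end Nemytskii

/-! ### Differentiability with explicit directional derivatives -/

/-- `f` is Fréchet differentiable everywhere, and its derivative at `y` in the direction `d` is
`f' y d`. -/
def HasDirDeriv {A G : Type*} [NormedAddCommGroup A] [NormedSpace ℝ A] [NormedAddCommGroup G]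
    [NormedSpace ℝ G] (f : A → G) (f' : A → A → G) : Prop :=
  ∀ y, ∃ L : A →L[ℝ] G, HasFDerivAt f L y ∧ ∀ d, L d = f' y d

namespace HasDirDeriv

variable {A G G₁ G₂ : Type*} [NormedAddCommGroup A] [NormedSpace ℝ A] [NormedAddCommGroup G]
  [NormedSpace ℝ G] [NormedAddCommGroup G₁] [NormedSpace ℝ G₁] [NormedAddCommGroup G₂]
  [NormedSpace ℝ G₂]

theorem const (c : G) : HasDirDeriv (fun _ : A => c) fun _ _ => 0 := fun y =>
  ⟨0, hasFDerivAt_const c y, fun _ => rfl⟩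

theorem of_clm (T : A →L[ℝ] G) : HasDirDeriv (fun y => T y) fun _ d => T d := fun _ =>
  ⟨T, T.hasFDerivAt, fun _ => rfl⟩

variable {f g : A → G} {f' g' : A → A → G}

theorem add (hf : HasDirDeriv f f') (hg : HasDirDeriv g g') :
    HasDirDeriv (fun y => f y + g y) fun y d => f' y d + g' y d := fun y => by
  obtain ⟨L, h1, h2⟩ := hf y
  obtain ⟨L', h3, h4⟩ := hg y
  exact ⟨L + L', h1.add h3, fun d => by rw [add_apply, h2, h4]⟩

theorem sub (hf : HasDirDeriv f f') (hg : HasDirDeriv g g') :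
    HasDirDeriv (fun y => f y - g y) fun y d => f' y d - g' y d := fun y => by
  obtain ⟨L, h1, h2⟩ := hf y
  obtain ⟨L', h3, h4⟩ := hg y
  exact ⟨L - L', h1.sub h3, fun d => by rw [sub_apply, h2, h4]⟩

theorem const_smul (hf : HasDirDeriv f f') (c : ℝ) :
    HasDirDeriv (fun y => c • f y) fun y d => c • f' y d := fun y => by
  obtain ⟨L, h1, h2⟩ := hf y
  exact ⟨c • L, h1.const_smul c, fun d => by rw [smul_apply, h2]⟩

theorem clm (T : G →L[ℝ] G₁) (hf : HasDirDeriv f f') :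
    HasDirDeriv (fun y => T (f y)) fun y d => T (f' y d) := fun y => by
  obtain ⟨L, h1, h2⟩ := hf y
  exact ⟨T.comp L, T.hasFDerivAt.comp y h1, fun d => by rw [ContinuousLinearMap.comp_apply, h2]⟩

theorem bilin (T : G →L[ℝ] G₁ →L[ℝ] G₂) {k : A → G₁} {k' : A → A → G₁} (hf : HasDirDeriv f f')
    (hk : HasDirDeriv k k') :
    HasDirDeriv (fun y => T (f y) (k y)) fun y d => T (f y) (k' y d) + T (f' y d) (k y) :=
  fun y => by
  obtain ⟨L, h1, h2⟩ := hf y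
  obtain ⟨L', h3, h4⟩ := hk y
  exact ⟨_, T.hasFDerivAt_of_bilinear h1 h3, fun d => by
    change T (f y) (L' d) + T (L d) (k y) = _
    rw [h2, h4]⟩

theorem nem {α : Type*} [MeasurableSpace α] {ν : Measure α} {f : ℝ → ℝ} (hf : ContDiff ℝ 1 f)
    {a : A → Lp ℝ ⊤ ν} {a' : A → A → Lp ℝ ⊤ ν} (ha : HasDirDeriv a a') :
    HasDirDeriv (fun y => CHNS.nem hf.continuous (a y)) fun y d =>
      smulL ν ℝ ⊤ ⊤ ⊤ (CHNS.nem hf.continuous_deriv_one (a y)) (a' y d) := fun y => by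
  obtain ⟨L, h1, h2⟩ := ha y
  refine ⟨_, (hasFDerivAt_nem hf.continuous (hf.differentiable one_ne_zero)
    hf.continuous_deriv_one (a y)).comp y h1, fun d => ?_⟩
  rw [ContinuousLinearMap.comp_apply, h2]

end HasDirDeriv

/-! ### Fields depending on two consecutive states -/

/-- The family `h s s'` of functions, depending on a current state `s` and a previous state `s'`,
represents a Fréchet differentiable map into `L^p`, whose partial derivatives in the directions
`d` are represented by `hc s s' d` (current state) and `hp s s' d` (previous state). -/
def IsStepField {S E : Type*} [NormedAddCommGroup S] [NormedSpace ℝ S] [NormedAddCommGroup E]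
    [NormedSpace ℝ E] (p : ℝ≥0∞) [Fact (1 ≤ p)] (ν : Measure Space) (h : S → S → Space → E)
    (hc hp : S → S → S → Space → E) : Prop :=
  ∃ (f : S × S → Lp E p ν) (f' : S × S → S × S → Lp E p ν), HasDirDeriv f f' ∧
    (∀ s s', f (s, s') =ᵐ[ν] h s s') ∧ (∀ s s' d, f' (s, s') (d, 0) =ᵐ[ν] hc s s' d) ∧
    ∀ s s' d, f' (s, s') (0, d) =ᵐ[ν] hp s s' d

namespace IsStepField

variable {S E : Type*} [NormedAddCommGroup S] [NormedSpace ℝ S] [NormedAddCommGroup E]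
    [NormedSpace ℝ E] {p q : ℝ≥0∞} [Fact (1 ≤ p)] [Fact (1 ≤ q)] {ν : Measure Space}
    {h k : S → S → Space → E} {hc hp kc kp : S → S → S → Space → E}

theorem congr (H : IsStepField p ν h hc hp) (h1 : ∀ s s' x, h s s' x = k s s' x)
    (h2 : ∀ s s' d x, hc s s' d x = kc s s' d x) (h3 : ∀ s s' d x, hp s s' d x = kp s s' d x) :
    IsStepField p ν k kc kp := by
  obtain rfl : h = k := by funext s s' x; exact h1 s s' x
  obtain rfl : hc = kc := by funext s s' d x; exact h2 s s' d x
  obtain rfl : hp = kp := by funext s s' d x; exact h3 s s' d x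
  exact H

theorem current (T : S →L[ℝ] Lp E p ν) {t : S → Space → E} (ht : ∀ s, T s =ᵐ[ν] t s) :
    IsStepField p ν (fun s _ => t s) (fun _ _ d => t d) fun _ _ _ _ => 0 :=
  ⟨_, _, HasDirDeriv.of_clm (T.comp (ContinuousLinearMap.fst ℝ S S)), fun s _ => ht s,
    fun _ _ d => ht d, fun _ _ d => by
      change (T 0 : Space → E) =ᵐ[ν] _
      rw [map_zero]
      exact Lp.coeFn_zero E p ν⟩

theorem previous (T : S →L[ℝ] Lp E p ν) {t : S → Space → E} (ht : ∀ s, T s =ᵐ[ν] t s) :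
    IsStepField p ν (fun _ s => t s) (fun _ _ _ _ => 0) fun _ _ d => t d :=
  ⟨_, _, HasDirDeriv.of_clm (T.comp (ContinuousLinearMap.snd ℝ S S)), fun _ s => ht s,
    fun _ _ d => by
      change (T 0 : Space → E) =ᵐ[ν] _
      rw [map_zero]
      exact Lp.coeFn_zero E p ν, fun _ _ d => ht d⟩

theorem const {c : Space → E} (hc : MemLp c p ν) :
    IsStepField (S := S) p ν (fun _ _ => c) (fun _ _ _ _ => 0) fun _ _ _ _ => 0 :=
  ⟨_, _, HasDirDeriv.const (hc.toLp c), fun _ _ => hc.coeFn_toLp,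
    fun _ _ _ => Lp.coeFn_zero E p ν, fun _ _ _ => Lp.coeFn_zero E p ν⟩

theorem add (H : IsStepField p ν h hc hp) (K : IsStepField p ν k kc kp) :
    IsStepField p ν (fun s s' x => h s s' x + k s s' x) (fun s s' d x => hc s s' d x + kc s s' d x)
      fun s s' d x => hp s s' d x + kp s s' d x := by
  obtain ⟨f, f', h0, h1, h2, h3⟩ := H
  obtain ⟨g, g', k0, k1, k2, k3⟩ := K
  exact ⟨_, _, h0.add k0, fun s s' => (Lp.coeFn_add _ _).trans ((h1 s s').add (k1 s s')),
    fun s s' d => (Lp.coeFn_add _ _).trans ((h2 s s' d).add (k2 s s' d)),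
    fun s s' d => (Lp.coeFn_add _ _).trans ((h3 s s' d).add (k3 s s' d))⟩

theorem sub (H : IsStepField p ν h hc hp) (K : IsStepField p ν k kc kp) :
    IsStepField p ν (fun s s' x => h s s' x - k s s' x) (fun s s' d x => hc s s' d x - kc s s' d x)
      fun s s' d x => hp s s' d x - kp s s' d x := by
  obtain ⟨f, f', h0, h1, h2, h3⟩ := H
  obtain ⟨g, g', k0, k1, k2, k3⟩ := K
  exact ⟨_, _, h0.sub k0, fun s s' => (Lp.coeFn_sub _ _).trans ((h1 s s').sub (k1 s s')),
    fun s s' d => (Lp.coeFn_sub _ _).trans ((h2 s s' d).sub (k2 s s' d)),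
    fun s s' d => (Lp.coeFn_sub _ _).trans ((h3 s s' d).sub (k3 s s' d))⟩

theorem const_smul (H : IsStepField p ν h hc hp) (c : ℝ) :
    IsStepField p ν (fun s s' x => c • h s s' x) (fun s s' d x => c • hc s s' d x)
      fun s s' d x => c • hp s s' d x := by
  obtain ⟨f, f', h0, h1, h2, h3⟩ := H
  exact ⟨_, _, h0.const_smul c, fun s s' => (Lp.coeFn_smul _ _).trans ((h1 s s').const_smul c),
    fun s s' d => (Lp.coeFn_smul _ _).trans ((h2 s s' d).const_smul c),
    fun s s' d => (Lp.coeFn_smul _ _).trans ((h3 s s' d).const_smul c)⟩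

/-- Products of `L^s` and `L^p` fields. The exponents are related by Hölder's inequality. -/
theorem smul {r : ℝ≥0∞} [Fact (1 ≤ r)] [ENNReal.HolderTriple r p q] {a : S → S → Space → ℝ}
    {ac ap : S → S → S → Space → ℝ} (A : IsStepField r ν a ac ap) (H : IsStepField p ν h hc hp) :
    IsStepField q ν (fun s s' x => a s s' x • h s s' x)
      (fun s s' d x => a s s' x • hc s s' d x + ac s s' d x • h s s' x)
      fun s s' d x => a s s' x • hp s s' d x + ap s s' d x • h s s' x := by
  obtain ⟨f, f', h0, h1, h2, h3⟩ := H
  obtain ⟨g, g', k0, k1, k2, k3⟩ := A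
  exact ⟨_, _, k0.bilin (smulL ν E r p q) h0, fun s s' => smulL_ae (k1 s s') (h1 s s'),
    fun s s' d => (Lp.coeFn_add _ _).trans
      ((smulL_ae (k1 s s') (h2 s s' d)).add (smulL_ae (k2 s s' d) (h1 s s'))),
    fun s s' d => (Lp.coeFn_add _ _).trans
      ((smulL_ae (k1 s s') (h3 s s' d)).add (smulL_ae (k3 s s' d) (h1 s s')))⟩

theorem incl (r : ℝ≥0∞) [Fact (1 ≤ r)] [ENNReal.HolderTriple r p q] [IsFiniteMeasure ν]
    (H : IsStepField p ν h hc hp) : IsStepField q ν h hc hp := by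
  obtain ⟨f, f', h0, h1, h2, h3⟩ := H
  exact ⟨_, _, h0.clm (inclL ν E r p q), fun s s' => inclL_ae (h1 s s'),
    fun s s' d => inclL_ae (h2 s s' d), fun s s' d => inclL_ae (h3 s s' d)⟩

/-- The chain rule for `C¹` functions of a bounded field. -/
theorem comp {f : ℝ → ℝ} (hf : ContDiff ℝ 1 f) {a : S → S → Space → ℝ}
    {ac ap : S → S → S → Space → ℝ} (A : IsStepField ⊤ ν a ac ap) :
    IsStepField ⊤ ν (fun s s' x => f (a s s' x)) (fun s s' d x => deriv f (a s s' x) * ac s s' d x)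
      fun s s' d x => deriv f (a s s' x) * ap s s' d x := by
  obtain ⟨g, g', h0, h1, h2, h3⟩ := A
  exact ⟨_, _, HasDirDeriv.nem hf h0, fun s s' => nem_ae _ (h1 s s'),
    fun s s' d => smulL_ae (nem_ae _ (h1 s s')) (h2 s s' d),
    fun s s' d => smulL_ae (nem_ae _ (h1 s s')) (h3 s s' d)⟩

end IsStepField

/-! ### Functionals depending on two consecutive states -/

/-- The values `F s s' z`, depending on a current state `s`, a previous state `s'` and a test
element `z`, are those of a Fréchet differentiable map into the dual of the test space, whose
partial derivatives in the directions `d` have the values `Fc s s' d z` (current state) and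
`Fp s s' d z` (previous state). -/
def IsStepForm {S X : Type*} [NormedAddCommGroup S] [NormedSpace ℝ S] [NormedAddCommGroup X]
    [NormedSpace ℝ X] (F : S → S → X → ℝ) (Fc Fp : S → S → S → X → ℝ) : Prop :=
  ∃ (f : S × S → StrongDual ℝ X) (f' : S × S → S × S → StrongDual ℝ X), HasDirDeriv f f' ∧
    (∀ s s' z, f (s, s') z = F s s' z) ∧ (∀ s s' d z, f' (s, s') (d, 0) z = Fc s s' d z) ∧
    ∀ s s' d z, f' (s, s') (0, d) z = Fp s s' d z

namespace IsStepForm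

variable {S X : Type*} [NormedAddCommGroup S] [NormedSpace ℝ S] [NormedAddCommGroup X]
  [NormedSpace ℝ X] {F G : S → S → X → ℝ} {Fc Fp Gc Gp : S → S → S → X → ℝ}

theorem congr (H : IsStepForm F Fc Fp) (h1 : ∀ s s' z, F s s' z = G s s' z)
    (h2 : ∀ s s' d z, Fc s s' d z = Gc s s' d z) (h3 : ∀ s s' d z, Fp s s' d z = Gp s s' d z) :
    IsStepForm G Gc Gp := by
  obtain rfl : F = G := by funext s s' x; exact h1 s s' x
  obtain rfl : Fc = Gc := by funext s s' d x; exact h2 s s' d x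
  obtain rfl : Fp = Gp := by funext s s' d x; exact h3 s s' d x
  exact H

theorem add (H : IsStepForm F Fc Fp) (K : IsStepForm G Gc Gp) :
    IsStepForm (fun s s' z => F s s' z + G s s' z) (fun s s' d z => Fc s s' d z + Gc s s' d z)
      fun s s' d z => Fp s s' d z + Gp s s' d z := by
  obtain ⟨f, f', h0, h1, h2, h3⟩ := H
  obtain ⟨g, g', k0, k1, k2, k3⟩ := K
  exact ⟨_, _, h0.add k0, fun s s' z => by rw [add_apply, h1, k1],
    fun s s' d z => by rw [add_apply, h2, k2],
    fun s s' d z => by rw [add_apply, h3, k3]⟩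

theorem sub (H : IsStepForm F Fc Fp) (K : IsStepForm G Gc Gp) :
    IsStepForm (fun s s' z => F s s' z - G s s' z) (fun s s' d z => Fc s s' d z - Gc s s' d z)
      fun s s' d z => Fp s s' d z - Gp s s' d z := by
  obtain ⟨f, f', h0, h1, h2, h3⟩ := H
  obtain ⟨g, g', k0, k1, k2, k3⟩ := K
  exact ⟨_, _, h0.sub k0, fun s s' z => by rw [sub_apply, h1, k1],
    fun s s' d z => by rw [sub_apply, h2, k2],
    fun s s' d z => by rw [sub_apply, h3, k3]⟩

theorem const_mul (H : IsStepForm F Fc Fp) (c : ℝ) :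
    IsStepForm (fun s s' z => c * F s s' z) (fun s s' d z => c * Fc s s' d z)
      fun s s' d z => c * Fp s s' d z := by
  obtain ⟨f, f', h0, h1, h2, h3⟩ := H
  exact ⟨_, _, h0.const_smul c, fun s s' z => by rw [smul_apply, smul_eq_mul, h1],
    fun s s' d z => by rw [smul_apply, smul_eq_mul, h2],
    fun s s' d z => by rw [smul_apply, smul_eq_mul, h3]⟩

/-- Pairing a field with a function depending linearly and continuously on the test element. -/
theorem pair {H : Type*} [NormedAddCommGroup H] [InnerProductSpace ℝ H] {ν : Measure Space}
    (T : X →L[ℝ] Lp H 2 ν) {t : X → Space → H} (ht : ∀ z, T z =ᵐ[ν] t z) {h : S → S → Space → H}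
    {hc hp : S → S → S → Space → H} (K : IsStepField 2 ν h hc hp) :
    IsStepForm (fun s s' z => pair ν (h s s') (t z)) (fun s s' d z => CHNS.pair ν (hc s s' d) (t z))
      fun s s' d z => CHNS.pair ν (hp s s' d) (t z) := by
  obtain ⟨g, g', h0, h1, h2, h3⟩ := K
  exact ⟨_, _, h0.clm (dualPair T), fun s s' z => pair_eq_inner (h1 s s') (ht z),
    fun s s' d z => pair_eq_inner (h2 s s' d) (ht z),
    fun s s' d z => pair_eq_inner (h3 s s' d) (ht z)⟩

end IsStepForm

/-! ### The trilinear form -/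

section Trilinear

variable {Ω : Set Space}

section Abstract

variable {ι V N₆ N₃ H X S : Type*} [Fintype ι] [NormedAddCommGroup V] [NormedSpace ℝ V]
  [NormedAddCommGroup N₆] [NormedSpace ℝ N₆] [NormedAddCommGroup N₃] [NormedSpace ℝ N₃]
  [NormedAddCommGroup H] [InnerProductSpace ℝ H] [NormedAddCommGroup X] [NormedSpace ℝ X]
  [NormedAddCommGroup S] [NormedSpace ℝ S]

/-- The trilinear map `(u, v, w) ↦ (G v, C w ⬝ u)`, where `⬝` is a bounded bilinear product. -/
def leftForm (m : N₆ →L[ℝ] N₃ →L[ℝ] H) (C : V →L[ℝ] N₆) (G : V →L[ℝ] H) :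
    N₃ →L[ℝ] V →L[ℝ] StrongDual ℝ V :=
  ((ContinuousLinearMap.compL ℝ V H ℝ).flip).bilinearComp
    (((ContinuousLinearMap.compL ℝ V N₆ H).flip C).comp m.flip) ((innerL H).comp G)

theorem leftForm_apply (m : N₆ →L[ℝ] N₃ →L[ℝ] H) (C : V →L[ℝ] N₆) (G : V →L[ℝ] H) (u : N₃)
    (v w : V) : leftForm m C G u v w = inner ℝ (G v) (m (C w) u) := rfl

/-- The trilinear map `(u, v, w) ↦ (C v ⬝ u, G w)`, where `⬝` is a bounded bilinear product. -/
def rightForm (m : N₆ →L[ℝ] N₃ →L[ℝ] H) (C : V →L[ℝ] N₆) (G : V →L[ℝ] H) :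
    N₃ →L[ℝ] V →L[ℝ] StrongDual ℝ V :=
  (ContinuousLinearMap.compL ℝ V H (StrongDual ℝ V) (dualPair G)).comp
    (m.flip.bilinearComp (ContinuousLinearMap.id ℝ N₃) C)

theorem rightForm_apply (m : N₆ →L[ℝ] N₃ →L[ℝ] H) (C : V →L[ℝ] N₆) (G : V →L[ℝ] H) (u : N₃)
    (v w : V) : rightForm m C G u v w = inner ℝ (m (C v) u) (G w) := rfl

/-- Half the difference of the sums of two families of bounded bilinear maps. -/
def halfSubSum {G : Type*} [NormedAddCommGroup G] [NormedSpace ℝ G]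
    (A B : ι → N₃ →L[ℝ] V →L[ℝ] G) : N₃ →L[ℝ] V →L[ℝ] G :=
  (1 / 2 : ℝ) • ∑ i, A i - (1 / 2 : ℝ) • ∑ i, B i

theorem halfSubSum_apply {G : Type*} [NormedAddCommGroup G] [NormedSpace ℝ G]
    (A B : ι → N₃ →L[ℝ] V →L[ℝ] G) (u : N₃) (v : V) : halfSubSum A B u v =
      (1 / 2 : ℝ) • ∑ i, A i u v - (1 / 2 : ℝ) • ∑ i, B i u v := by
  simp only [halfSubSum, sub_apply, smul_apply, sum_apply]

/-- The skew-symmetric trilinear form built from a product of `L⁶` and `L³`, the components `C i`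
and the gradients `G i` of vector fields. -/
def skewForm (m : N₆ →L[ℝ] N₃ →L[ℝ] H) (C : ι → V →L[ℝ] N₆) (G : ι → V →L[ℝ] H) :
    N₃ →L[ℝ] V →L[ℝ] StrongDual ℝ V :=
  halfSubSum (fun i => leftForm m (C i) (G i)) fun i => rightForm m (C i) (G i)

theorem skewForm_apply (m : N₆ →L[ℝ] N₃ →L[ℝ] H) (C : ι → V →L[ℝ] N₆) (G : ι → V →L[ℝ] H)
    (u : N₃) (v w : V) : skewForm m C G u v w =
      1 / 2 * ∑ i, inner ℝ (G i v) (m (C i w) u) - 1 / 2 * ∑ i, inner ℝ (G i w) (m (C i v) u) := by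
  rw [skewForm, halfSubSum_apply]
  simp only [sub_apply, smul_apply, sum_apply, leftForm_apply, rightForm_apply, smul_eq_mul]
  congr 2
  exact Finset.sum_congr rfl fun i _ => real_inner_comm _ _

/-- Composing a bounded trilinear form with a field, the velocity of the current state and the
velocity of the test element. -/
theorem IsStepForm.trilinear {E : Type*} [NormedAddCommGroup E] [NormedSpace ℝ E] {p : ℝ≥0∞}
    [Fact (1 ≤ p)] {ν : Measure Space} (T : Lp E p ν →L[ℝ] V →L[ℝ] StrongDual ℝ V)
    {t : (Space → E) → V → V → ℝ}
    (hT : ∀ (u : Lp E p ν) (u' : Space → E), u =ᵐ[ν] u' → ∀ v w, T u v w = t u' v w)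
    (vel : S →L[ℝ] V) (W : X →L[ℝ] V) {u : S → S → Space → E} {uc up : S → S → S → Space → E}
    (K : IsStepField p ν u uc up) :
    IsStepForm (fun s s' z => t (u s s') (vel s) (W z))
      (fun s s' d z => t (u s s') (vel d) (W z) + t (uc s s' d) (vel s) (W z))
      fun s s' d z => t (up s s' d) (vel s) (W z) := by
  obtain ⟨f, f', h0, h1, h2, h3⟩ := K
  refine ⟨_, _, (h0.bilin T (HasDirDeriv.of_clm
    (vel.comp (ContinuousLinearMap.fst ℝ S S)))).clm ((ContinuousLinearMap.compL ℝ X V ℝ).flip W),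
    fun s s' z => hT _ _ (h1 s s') _ _, fun s s' d z => ?_, fun s s' d z => ?_⟩
  · change T (f (s, s')) (vel d) (W z) + T (f' (s, s') (d, 0)) (vel s) (W z) = _
    rw [hT _ _ (h1 s s'), hT _ _ (h2 s s' d)]
  · change T (f (s, s')) (vel 0) (W z) + T (f' (s, s') (0, d)) (vel s) (W z) = _
    rw [hT _ _ (h3 s s' d), map_zero, map_zero, zero_apply, zero_add]

/-- A continuous linear map into `L²` whose values are bounded by the norm takes values in
`L^∞`. -/
def liftTop {α : Type*} [MeasurableSpace α] {ν : Measure α} (T : V →L[ℝ] Lp ℝ 2 ν)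
    (h : ∀ f, ∀ᵐ x ∂ν, |T f x| ≤ ‖f‖) : V →L[ℝ] Lp ℝ ⊤ ν :=
  have hm : ∀ f, MemLp (T f) ⊤ ν := fun f =>
    memLp_top_of_bound (Lp.aestronglyMeasurable _) ‖f‖ (h f)
  LinearMap.mkContinuous
    { toFun := fun f => (hm f).toLp _
      map_add' := fun f g => by
        refine Eq.trans ?_ (MemLp.toLp_add (hm f) (hm g))
        refine MemLp.toLp_congr _ _ ?_
        rw [map_add]
        exact Lp.coeFn_add _ _
      map_smul' := fun c f => by
        refine Eq.trans ?_ (MemLp.toLp_const_smul c (hm f))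
        refine MemLp.toLp_congr _ _ ?_
        rw [map_smul]
        exact Lp.coeFn_smul _ _ } 1 fun f => by
    rw [one_mul]
    refine norm_top_le_of_ae_bound (norm_nonneg f) ?_
    filter_upwards [h f, (hm f).coeFn_toLp] with x h1 h2
    exact (congrArg abs h2).trans_le h1

theorem liftTop_ae {α : Type*} [MeasurableSpace α] {ν : Measure α} (T : V →L[ℝ] Lp ℝ 2 ν)
    (h : ∀ f, ∀ᵐ x ∂ν, |T f x| ≤ ‖f‖) (f : V) : liftTop T h f =ᵐ[ν] T f :=
  MemLp.coeFn_toLp (memLp_top_of_bound (Lp.aestronglyMeasurable _) ‖f‖ (h f))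

end Abstract

variable (Ω) in
/-- The gradient of the `i`-th component of a velocity field. -/
def gradCompL (i : Fin 3) : Hsig Ω →L[ℝ] Lp Space 2 (vol Ω) := (gradL 2 Ω).comp (compL Ω i)

theorem gradCompL_ae (i : Fin 3) (v : Hsig Ω) :
    (gradCompL Ω i v : Space → Space) =ᵐ[vol Ω] grad (v.1 i) := ae_eq_refl _

theorem sum_inner_smulL_eq_pair {ν : Measure Space} {u : Lp Space 3 ν} {u' : Space → Space}
    (hu : u =ᵐ[ν] u') {G : Fin 3 → Lp Space 2 ν} {g : Fin 3 → Space → Space}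
    (hG : ∀ i, G i =ᵐ[ν] g i) {C : Fin 3 → Lp ℝ 6 ν} {c : Fin 3 → Space → ℝ}
    (hC : ∀ i, C i =ᵐ[ν] c i) :
    ∑ i, inner ℝ (G i) (smulL ν Space 6 3 2 (C i) u) =
      pair ν (fun x => (WithLp.toLp 2 fun i => inner ℝ (u' x) (g i x) : Space))
        (fun x => WithLp.toLp 2 fun i => c i x) := by
  simp only [L2.inner_def]
  rw [← integral_finsetSum _ fun i _ => L2.integrable_inner _ _, pair]
  refine integral_congr_ae ?_
  filter_upwards [ae_all_iff.2 hG, ae_all_iff.2 fun i => smulL_ae (q := 2) (hC i) hu] with x h1 h2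
  rw [PiLp.inner_apply]
  refine Finset.sum_congr rfl fun i _ => ?_
  rw [h1 i, h2 i, real_inner_smul_right, real_inner_comm]
  rfl

theorem sum_inner_eq_pair_conv (hΩ : IsOpen Ω) {u : Lp Space 3 (vol Ω)} {u' : Space → Space}
    (hu : u =ᵐ[vol Ω] u') (v w : Hsig Ω) :
    ∑ i, inner ℝ (gradCompL Ω i v) (smulL (vol Ω) Space 6 3 2 (comp6L hΩ i w) u) =
      pair (vol Ω) (conv u' v.1) (vec w.1) :=
  sum_inner_smulL_eq_pair hu (fun i => gradCompL_ae i v) fun i => comp6L_ae hΩ i w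

/-- The trilinear form, with `L³` fields as first argument. It is bounded because the components
of the other two arguments are in `L⁶`. -/
def triL (hΩ : IsOpen Ω) : Lp Space 3 (vol Ω) →L[ℝ] Hsig Ω →L[ℝ] StrongDual ℝ (Hsig Ω) :=
  skewForm (smulL (vol Ω) Space 6 3 2) (comp6L hΩ) (gradCompL Ω)

theorem triL_apply (hΩ : IsOpen Ω) (u : Lp Space 3 (vol Ω)) (u' : Space → Space)
    (hu : u =ᵐ[vol Ω] u') (v w : Hsig Ω) : triL hΩ u v w = tri u' v.1 w.1 := by
  exact (skewForm_apply (smulL (vol Ω) Space 6 3 2) (comp6L hΩ) (gradCompL Ω) u v w).trans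
    (congrArg₂ (fun a b : ℝ => 1 / 2 * a - 1 / 2 * b) (sum_inner_eq_pair_conv hΩ hu v w)
      (sum_inner_eq_pair_conv hΩ hu w v))

end Trilinear

/-! ### States and their traces -/

section States

variable {Ω : Set Space}

variable (Ω) in
/-- Bounded phase fields: pairs of a function in `H¹(Ω)` and the same function in `L^∞(Ω)`. -/
def BddPhase : Submodule ℝ (H1 Ω × Lp ℝ ⊤ (vol Ω)) where
  carrier := {f | fn f.1 =ᵐ[vol Ω] f.2}
  zero_mem' := fn_zero.trans (Lp.coeFn_zero ℝ ⊤ (vol Ω)).symm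
  add_mem' {f g} hf hg := by
    refine (fn_add f.1 g.1).trans (EventuallyEq.trans ?_ (Lp.coeFn_add f.2 g.2).symm)
    exact EventuallyEq.add hf hg
  smul_mem' c f hf := by
    refine (fn_smul c f.1).trans (EventuallyEq.trans ?_ (Lp.coeFn_smul c f.2).symm)
    have h : fn f.1 =ᵐ[vol Ω] f.2 := hf
    exact h.const_smul c

theorem BddPhase.ae_eq (f : BddPhase Ω) : fn f.1.1 =ᵐ[vol Ω] f.1.2 := f.2

instance BddPhase.normedAddCommGroup : NormedAddCommGroup (BddPhase Ω) :=
  Submodule.normedAddCommGroup _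

instance BddPhase.normedSpace : NormedSpace ℝ (BddPhase Ω) := Submodule.normedSpace _

variable (Ω) in
/-- The states `(v, φ, μ)` of one time step. -/
def StepState : Type := Hsig Ω × BddPhase Ω × W1 3 Ω

instance StepState.normedAddCommGroup : NormedAddCommGroup (StepState Ω) :=
  Prod.normedAddCommGroup (E := Hsig Ω) (F := BddPhase Ω × W1 3 Ω)

instance StepState.normedSpace : NormedSpace ℝ (StepState Ω) :=
  Prod.normedSpace (𝕜 := ℝ) (E := Hsig Ω) (F := BddPhase Ω × W1 3 Ω)

/-- The phase field of a state, as an element of `H¹(Ω)`. -/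
def phase (s : StepState Ω) : H1 Ω := s.2.1.1.1

variable (Ω) in
/-- The velocity of a state. -/
def velL : StepState Ω →L[ℝ] Hsig Ω := ContinuousLinearMap.fst ℝ (Hsig Ω) (BddPhase Ω × W1 3 Ω)

variable (Ω) in
/-- The phase field of a state, with both its regularities. -/
def bddPhaseL : StepState Ω →L[ℝ] BddPhase Ω :=
  (ContinuousLinearMap.fst ℝ (BddPhase Ω) (W1 3 Ω)).comp
    (ContinuousLinearMap.snd ℝ (Hsig Ω) (BddPhase Ω × W1 3 Ω))

variable (Ω) in
/-- The phase field of a state in `H¹(Ω)`. -/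
def phaseL : StepState Ω →L[ℝ] H1 Ω :=
  (ContinuousLinearMap.fst ℝ (H1 Ω) (Lp ℝ ⊤ (vol Ω))).comp ((BddPhase Ω).subtypeL.comp (bddPhaseL Ω))

variable (Ω) in
/-- The phase field of a state in `L^∞(Ω)`. -/
def phaseTopL : StepState Ω →L[ℝ] Lp ℝ ⊤ (vol Ω) :=
  (ContinuousLinearMap.snd ℝ (H1 Ω) (Lp ℝ ⊤ (vol Ω))).comp ((BddPhase Ω).subtypeL.comp (bddPhaseL Ω))

variable (Ω) in
/-- The chemical potential of a state. -/
def potL : StepState Ω →L[ℝ] W1 3 Ω :=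
  (ContinuousLinearMap.snd ℝ (BddPhase Ω) (W1 3 Ω)).comp
    (ContinuousLinearMap.snd ℝ (Hsig Ω) (BddPhase Ω × W1 3 Ω))

theorem phaseTopL_ae (s : StepState Ω) : phaseTopL Ω s =ᵐ[vol Ω] fn (phase s) :=
  (BddPhase.ae_eq s.2.1).symm

/-- The trace of bounded phase fields with values in `L²(∂Ω)`. -/
def trBddL (hΩ : IsBoundedLipschitzDomain Ω) : BddPhase Ω →L[ℝ] Lp ℝ 2 (surf Ω) :=
  (trL hΩ).comp ((ContinuousLinearMap.fst ℝ _ _).comp (BddPhase Ω).subtypeL)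

theorem abs_tr_phase_le (hΩ : IsBoundedLipschitzDomain Ω) (f : BddPhase Ω) :
    ∀ᵐ x ∂surf Ω, |trBddL hΩ f x| ≤ ‖f‖ := by
  refine abs_tr_le hΩ (norm_nonneg f) ?_
  filter_upwards [BddPhase.ae_eq f, ae_norm_le_norm_top f.1.2] with x h1 h2
  exact (congrArg abs h1).trans_le (h2.trans (norm_snd_le f.1))

/-- The trace of bounded phase fields with values in `L^∞(∂Ω)`. -/
def trTopL (hΩ : IsBoundedLipschitzDomain Ω) : BddPhase Ω →L[ℝ] Lp ℝ ⊤ (surf Ω) :=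
  liftTop (trBddL hΩ) (abs_tr_phase_le hΩ)

theorem trTopL_ae (hΩ : IsBoundedLipschitzDomain Ω) (f : BddPhase Ω) :
    (trTopL hΩ f : Space → ℝ) =ᵐ[surf Ω] tr f.1.1 :=
  liftTop_ae (V := BddPhase Ω) (trBddL hΩ) (abs_tr_phase_le hΩ) f

end States

/-! ### Calculus of pairings -/

section Pairings

variable {H : Type*} [NormedAddCommGroup H] [InnerProductSpace ℝ H] {ν : Measure Space}

theorem pair_congr {f f' h h' : Space → H} (hf : ∀ x, f x = f' x) (hh : ∀ x, h x = h' x) :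
    pair ν f h = pair ν f' h' := by rw [funext hf, funext hh]

theorem pair_zero_left (h : Space → H) : pair ν (fun _ => 0) h = 0 := by simp [pair]

theorem pair_neg_left (f h : Space → H) : pair ν (fun x => -f x) h = -pair ν f h := by
  simp only [pair, inner_neg_left, integral_neg]

theorem pair_smul_left (c : ℝ) (f h : Space → H) :
    pair ν (fun x => c • f x) h = c * pair ν f h := by
  simp only [pair, real_inner_smul_left, integral_const_mul]

theorem pair_smul_eq_pair_inner (a : Space → ℝ) (f h : Space → H) :
    pair ν (fun x => a x • f x) h = pair ν a fun x => inner ℝ (f x) (h x) := by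
  simp only [pair, real_inner_smul_left]
  refine integral_congr_ae (Eventually.of_forall fun x => ?_)
  exact mul_comm _ _

theorem integrable_inner_of_memLp {f h : Space → H} (hf : MemLp f 2 ν) (hh : MemLp h 2 ν) :
    Integrable (fun x => (inner ℝ (f x) (h x) : ℝ)) ν := by
  refine (L2.integrable_inner (𝕜 := ℝ) (hf.toLp f) (hh.toLp h)).congr ?_
  filter_upwards [hf.coeFn_toLp, hh.coeFn_toLp] with x h1 h2
  rw [h1, h2]

theorem pair_add_left {f g h : Space → H} (hf : MemLp f 2 ν) (hg : MemLp g 2 ν)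
    (hh : MemLp h 2 ν) : pair ν (fun x => f x + g x) h = pair ν f h + pair ν g h := by
  simp only [pair, inner_add_left]
  exact integral_add (integrable_inner_of_memLp hf hh) (integrable_inner_of_memLp hg hh)

theorem pair_sub_left {f g h : Space → H} (hf : MemLp f 2 ν) (hg : MemLp g 2 ν)
    (hh : MemLp h 2 ν) : pair ν (fun x => f x - g x) h = pair ν f h - pair ν g h := by
  simp only [pair, inner_sub_left]
  exact integral_sub (integrable_inner_of_memLp hf hh) (integrable_inner_of_memLp hg hh)

theorem pair_sub_right {f g h : Space → H} (hf : MemLp f 2 ν) (hg : MemLp g 2 ν)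
    (hh : MemLp h 2 ν) : pair ν f (fun x => g x - h x) = pair ν f g - pair ν f h := by
  simp only [pair, inner_sub_right]
  exact integral_sub (integrable_inner_of_memLp hf hg) (integrable_inner_of_memLp hf hh)

end Pairings

namespace IsStepField

variable {S E : Type*} [NormedAddCommGroup S] [NormedSpace ℝ S] [NormedAddCommGroup E]
    [NormedSpace ℝ E] {p : ℝ≥0∞} [Fact (1 ≤ p)] {ν : Measure Space}
    {h : S → S → Space → E} {hc hp : S → S → S → Space → E}

theorem memLp (H : IsStepField p ν h hc hp) (s s' : S) : MemLp (h s s') p ν := by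
  obtain ⟨f, f', h0, h1, h2, h3⟩ := H
  exact (memLp_congr_ae (h1 s s')).1 (Lp.memLp _)

theorem memLp_current (H : IsStepField p ν h hc hp) (s s' d : S) : MemLp (hc s s' d) p ν := by
  obtain ⟨f, f', h0, h1, h2, h3⟩ := H
  exact (memLp_congr_ae (h2 s s' d)).1 (Lp.memLp _)

theorem memLp_previous (H : IsStepField p ν h hc hp) (s s' d : S) : MemLp (hp s s' d) p ν := by
  obtain ⟨f, f', h0, h1, h2, h3⟩ := H
  exact (memLp_congr_ae (h3 s s' d)).1 (Lp.memLp _)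

end IsStepField

namespace IsStepForm

variable {S X H : Type*} [NormedAddCommGroup S] [NormedSpace ℝ S] [NormedAddCommGroup X]
  [NormedSpace ℝ X] [NormedAddCommGroup H] [InnerProductSpace ℝ H] {ν : Measure Space}

theorem memLp_of_ae (T : X →L[ℝ] Lp H 2 ν) {t : X → Space → H} (ht : ∀ z, T z =ᵐ[ν] t z) (z : X) :
    MemLp (t z) 2 ν := (memLp_congr_ae (ht z)).1 (Lp.memLp _)

theorem pair_add (T : X →L[ℝ] Lp H 2 ν) {t : X → Space → H} (ht : ∀ z, T z =ᵐ[ν] t z)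
    {h k : S → S → Space → H} {hc hp kc kp : S → S → S → Space → H}
    (K : IsStepField 2 ν h hc hp) (L : IsStepField 2 ν k kc kp) :
    IsStepForm (fun s s' z => CHNS.pair ν (fun x => h s s' x + k s s' x) (t z))
      (fun s s' d z => CHNS.pair ν (hc s s' d) (t z) + CHNS.pair ν (kc s s' d) (t z))
      fun s s' d z => CHNS.pair ν (hp s s' d) (t z) + CHNS.pair ν (kp s s' d) (t z) :=
  ((IsStepForm.pair T ht K).add (IsStepForm.pair T ht L)).congr
    (fun s s' z => (pair_add_left (K.memLp s s') (L.memLp s s') (memLp_of_ae T ht z)).symm)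
    (fun _ _ _ _ => rfl) fun _ _ _ _ => rfl

theorem pair_sub (T : X →L[ℝ] Lp H 2 ν) {t : X → Space → H} (ht : ∀ z, T z =ᵐ[ν] t z)
    {h k : S → S → Space → H} {hc hp kc kp : S → S → S → Space → H}
    (K : IsStepField 2 ν h hc hp) (L : IsStepField 2 ν k kc kp) :
    IsStepForm (fun s s' z => CHNS.pair ν (fun x => h s s' x - k s s' x) (t z))
      (fun s s' d z => CHNS.pair ν (hc s s' d) (t z) - CHNS.pair ν (kc s s' d) (t z))
      fun s s' d z => CHNS.pair ν (hp s s' d) (t z) - CHNS.pair ν (kp s s' d) (t z) := by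
  refine (pair_add T ht K (L.const_smul (-1))).congr (fun s s' z => ?_) (fun s s' d z => ?_)
    fun s s' d z => ?_
  · exact pair_congr (fun x => by rw [neg_one_smul, sub_eq_add_neg]) fun _ => rfl
  · rw [pair_smul_left]; ring
  · rw [pair_smul_left]; ring

/-- The product rule, with the two parts of the derivative paired separately. -/
theorem pair_smul (T : X →L[ℝ] Lp H 2 ν) {t : X → Space → H} (ht : ∀ z, T z =ᵐ[ν] t z)
    {a : S → S → Space → ℝ} {ac ap : S → S → S → Space → ℝ} {h : S → S → Space → H}
    {hc hp : S → S → S → Space → H} (A : IsStepField ⊤ ν a ac ap) (K : IsStepField 2 ν h hc hp) :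
    IsStepForm (fun s s' z => CHNS.pair ν (fun x => a s s' x • h s s' x) (t z))
      (fun s s' d z => CHNS.pair ν (fun x => a s s' x • hc s s' d x) (t z) +
        CHNS.pair ν (fun x => ac s s' d x • h s s' x) (t z))
      fun s s' d z => CHNS.pair ν (fun x => a s s' x • hp s s' d x) (t z) +
        CHNS.pair ν (fun x => ap s s' d x • h s s' x) (t z) :=
  (IsStepForm.pair T ht (A.smul (q := 2) K)).congr (fun _ _ _ => rfl)
    (fun s s' d z => pair_add_left ((K.memLp_current s s' d).smul (A.memLp s s'))
      ((K.memLp s s').smul (A.memLp_current s s' d)) (memLp_of_ae T ht z))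
    fun s s' d z => pair_add_left ((K.memLp_previous s s' d).smul (A.memLp s s'))
      ((K.memLp s s').smul (A.memLp_previous s s' d)) (memLp_of_ae T ht z)

end IsStepForm

/-! ### The fields of one time step -/

section Fields

variable {Ω : Set Space}

theorem contDiff_one_deriv {f : ℝ → ℝ} (hf : ContDiff ℝ 2 f) : ContDiff ℝ 1 (deriv f) :=
  (contDiff_succ_iff_deriv.1 (hf : ContDiff ℝ (1 + 1) f)).2.2

theorem phase_current (Ω : Set Space) : IsStepField (S := StepState Ω) ⊤ (vol Ω) (fun s _ => fn (phase s))
    (fun _ _ d => fn (phase d)) fun _ _ _ _ => 0 :=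
  IsStepField.current (phaseTopL Ω) phaseTopL_ae

theorem phase_previous (Ω : Set Space) : IsStepField (S := StepState Ω) ⊤ (vol Ω) (fun _ s => fn (phase s))
    (fun _ _ _ _ => 0) fun _ _ d => fn (phase d) :=
  IsStepField.previous (phaseTopL Ω) phaseTopL_ae

theorem comp_phase_current (Ω : Set Space) {f : ℝ → ℝ} (hf : ContDiff ℝ 1 f) :
    IsStepField (S := StepState Ω) ⊤ (vol Ω) (fun s _ x => f (fn (phase s) x))
      (fun s _ d x => deriv f (fn (phase s) x) * fn (phase d) x) fun _ _ _ _ => 0 :=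
  ((phase_current Ω).comp hf).congr (fun _ _ _ => rfl) (fun _ _ _ _ => rfl) fun _ _ _ _ => mul_zero _

theorem comp_phase_previous (Ω : Set Space) {f : ℝ → ℝ} (hf : ContDiff ℝ 1 f) :
    IsStepField (S := StepState Ω) ⊤ (vol Ω) (fun _ s x => f (fn (phase s) x))
      (fun _ _ _ _ => 0) fun _ s d x => deriv f (fn (phase s) x) * fn (phase d) x :=
  ((phase_previous Ω).comp hf).congr (fun _ _ _ => rfl) (fun _ _ _ _ => mul_zero _) fun _ _ _ _ => rfl

theorem vel_current (Ω : Set Space) : IsStepField (S := StepState Ω) 2 (vol Ω) (fun s _ => vec s.1.1)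
    (fun _ _ d => vec d.1.1) fun _ _ _ _ => 0 :=
  IsStepField.current ((vec2L Ω).comp (velL Ω)) fun s => vec2L_ae s.1

theorem vel_previous (Ω : Set Space) : IsStepField (S := StepState Ω) 2 (vol Ω) (fun _ s => vec s.1.1)
    (fun _ _ _ _ => 0) fun _ _ d => vec d.1.1 :=
  IsStepField.previous ((vec2L Ω).comp (velL Ω)) fun s => vec2L_ae s.1

theorem vel_previous_three (hΩ : IsOpen Ω) [IsFiniteMeasure (vol Ω)] :
    IsStepField (S := StepState Ω) 3 (vol Ω) (fun _ s => vec s.1.1)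
      (fun _ _ _ _ => 0) fun _ _ d => vec d.1.1 :=
  IsStepField.previous ((vec3L hΩ).comp (velL Ω)) fun s => vec3L_ae hΩ s.1

theorem symGrad_current (Ω : Set Space) : IsStepField (S := StepState Ω) 2 (vol Ω) (fun s _ => symGrad s.1.1)
    (fun _ _ d => symGrad d.1.1) fun _ _ _ _ => 0 :=
  IsStepField.current ((symGradL Ω).comp (velL Ω)) fun s => symGradL_ae s.1

theorem phase_two_current (Ω : Set Space) : IsStepField (S := StepState Ω) 2 (vol Ω) (fun s _ => fn (phase s))
    (fun _ _ d => fn (phase d)) fun _ _ _ _ => 0 :=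
  IsStepField.current ((fnL 2 Ω).comp (phaseL Ω)) fun _ => ae_eq_refl _

theorem phase_two_previous (Ω : Set Space) : IsStepField (S := StepState Ω) 2 (vol Ω) (fun _ s => fn (phase s))
    (fun _ _ _ _ => 0) fun _ _ d => fn (phase d) :=
  IsStepField.previous ((fnL 2 Ω).comp (phaseL Ω)) fun _ => ae_eq_refl _

theorem gradPhase_current (Ω : Set Space) : IsStepField (S := StepState Ω) 2 (vol Ω) (fun s _ => grad (phase s))
    (fun _ _ d => grad (phase d)) fun _ _ _ _ => 0 :=
  IsStepField.current ((gradL 2 Ω).comp (phaseL Ω)) fun _ => ae_eq_refl _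

theorem gradPot_current_three (Ω : Set Space) : IsStepField (S := StepState Ω) 3 (vol Ω) (fun s _ => grad s.2.2)
    (fun _ _ d => grad d.2.2) fun _ _ _ _ => 0 :=
  IsStepField.current ((gradL 3 Ω).comp (potL Ω)) fun _ => ae_eq_refl _

theorem gradPot_current (Ω : Set Space) [IsFiniteMeasure (vol Ω)] :
    IsStepField (S := StepState Ω) 2 (vol Ω) (fun s _ => grad s.2.2)
      (fun _ _ d => grad d.2.2) fun _ _ _ _ => 0 :=
  (gradPot_current_three Ω).incl 6

theorem pot_current (Ω : Set Space) [IsFiniteMeasure (vol Ω)] :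
    IsStepField (S := StepState Ω) 2 (vol Ω) (fun s _ => fn s.2.2)
      (fun _ _ d => fn d.2.2) fun _ _ _ _ => 0 :=
  (IsStepField.current ((fnL 3 Ω).comp (potL Ω)) fun _ => ae_eq_refl _).incl 6

theorem tr_current (hΩ : IsBoundedLipschitzDomain Ω) :
    IsStepField (S := StepState Ω) 2 (surf Ω) (fun s _ => tr (phase s))
      (fun _ _ d => tr (phase d)) fun _ _ _ _ => 0 :=
  IsStepField.current ((trL hΩ).comp (phaseL Ω)) fun _ => ae_eq_refl _

theorem tr_previous (hΩ : IsBoundedLipschitzDomain Ω) :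
    IsStepField (S := StepState Ω) 2 (surf Ω) (fun _ s => tr (phase s))
      (fun _ _ _ _ => 0) fun _ _ d => tr (phase d) :=
  IsStepField.previous ((trL hΩ).comp (phaseL Ω)) fun _ => ae_eq_refl _

theorem comp_tr_previous (hΩ : IsBoundedLipschitzDomain Ω) {f : ℝ → ℝ} (hf : ContDiff ℝ 1 f) :
    IsStepField (S := StepState Ω) ⊤ (surf Ω) (fun _ s x => f (tr (phase s) x))
      (fun _ _ _ _ => 0) fun _ s d x => deriv f (tr (phase s) x) * tr (phase d) x :=
  ((IsStepField.previous (t := fun s => tr (phase s)) ((trTopL hΩ).comp (bddPhaseL Ω))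
    fun s => trTopL_ae hΩ s.2.1).comp hf).congr (fun _ _ _ => rfl) (fun _ _ _ _ => mul_zero _)
      fun _ _ _ _ => rfl

end Fields

/-! ### The test functions -/

section Tests

variable {Ω : Set Space}

variable (Ω) in
/-- The velocity of a test triple. -/
def testVelL : TestSpace Ω →L[ℝ] Hsig Ω := ContinuousLinearMap.fst ℝ _ _

variable (Ω) in
/-- The second component of a test triple. -/
def testPhaseL : TestSpace Ω →L[ℝ] H1 Ω :=
  (ContinuousLinearMap.fst ℝ _ _).comp (ContinuousLinearMap.snd ℝ _ _)

variable (Ω) in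
/-- The third component of a test triple. -/
def testPotL : TestSpace Ω →L[ℝ] H1 Ω :=
  (ContinuousLinearMap.snd ℝ _ _).comp (ContinuousLinearMap.snd ℝ _ _)

theorem test_vec_ae (z : TestSpace Ω) :
    ((vec2L Ω).comp (testVelL Ω) z : Space → Space) =ᵐ[vol Ω] vec z.1.1 := vec2L_ae z.1

theorem test_symGrad_ae (z : TestSpace Ω) :
    ((symGradL Ω).comp (testVelL Ω) z : Space → EuclideanSpace ℝ (Fin 3 × Fin 3)) =ᵐ[vol Ω]
      symGrad z.1.1 := symGradL_ae z.1

theorem test_phase_ae (z : TestSpace Ω) :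
    ((fnL 2 Ω).comp (testPhaseL Ω) z : Space → ℝ) =ᵐ[vol Ω] fn z.2.1 := ae_eq_refl _

theorem test_gradPhase_ae (z : TestSpace Ω) :
    ((gradL 2 Ω).comp (testPhaseL Ω) z : Space → Space) =ᵐ[vol Ω] grad z.2.1 := ae_eq_refl _

theorem test_pot_ae (z : TestSpace Ω) :
    ((fnL 2 Ω).comp (testPotL Ω) z : Space → ℝ) =ᵐ[vol Ω] fn z.2.2 := ae_eq_refl _

theorem test_gradPot_ae (z : TestSpace Ω) :
    ((gradL 2 Ω).comp (testPotL Ω) z : Space → Space) =ᵐ[vol Ω] grad z.2.2 := ae_eq_refl _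

theorem test_tr_ae (hΩ : IsBoundedLipschitzDomain Ω) (z : TestSpace Ω) :
    ((trL hΩ).comp (testPotL Ω) z : Space → ℝ) =ᵐ[surf Ω] tr z.2.2 := ae_eq_refl _

end Tests

/-! ### The momentum balance of one time step -/

section StepTerms

variable {Ω : Set Space} (P : ModelData)

theorem ModelData.ρ_contDiff_one : ContDiff ℝ 1 P.ρ := P.ρ_contDiff.of_le (by norm_num)

/-- The momentum `ρ(φ) v` of the previous state. -/
theorem momentum_previous (Ω : Set Space) {p : ℝ≥0∞} [Fact (1 ≤ p)]
    (V : IsStepField (S := StepState Ω) p (vol Ω) (fun _ s => vec s.1.1)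
      (fun _ _ _ _ => 0) fun _ _ d => vec d.1.1) :
    IsStepField (S := StepState Ω) p (vol Ω)
      (fun _ s x => P.ρ (fn (phase s) x) • vec s.1.1 x) (fun _ _ _ _ => 0)
      fun _ s d x => (deriv P.ρ (fn (phase s) x) * fn (phase d) x) • vec s.1.1 x
        + P.ρ (fn (phase s) x) • vec d.1.1 x := by
  refine ((comp_phase_previous Ω P.ρ_contDiff_one).smul (q := p) V).congr (fun _ _ _ => rfl)
    (fun _ s d x => ?_) fun _ s d x => add_comm _ _
  simp only [smul_zero, zero_smul, add_zero]

theorem isStepForm_inertia (Ω : Set Space) :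
    IsStepForm (S := StepState Ω) (X := TestSpace Ω)
      (fun s s' z => pair (vol Ω) (fun x =>
        ((P.ρ (fn (phase s) x) + P.ρ (fn (phase s') x)) / 2) • vec s.1.1 x
          - P.ρ (fn (phase s') x) • vec s'.1.1 x) (vec z.1.1))
      (fun s s' d z => 1 / 2 * pair (vol Ω)
            (fun x => (P.ρ (fn (phase s) x) + P.ρ (fn (phase s') x)) • vec d.1.1 x) (vec z.1.1)
        + 1 / 2 * pair (vol Ω) (fun x => deriv P.ρ (fn (phase s) x) * fn (phase d) x)
            (fun x => inner ℝ (vec s.1.1 x) (vec z.1.1 x)))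
      fun s s' d z => 1 / 2 * pair (vol Ω)
            (fun x => deriv P.ρ (fn (phase s') x) * fn (phase d) x)
            (fun x => inner ℝ (vec s.1.1 x) (vec z.1.1 x))
        - pair (vol Ω) (fun x => (deriv P.ρ (fn (phase s') x) * fn (phase d) x) • vec s'.1.1 x
            + P.ρ (fn (phase s') x) • vec d.1.1 x) (vec z.1.1) := by
  have A := (comp_phase_current Ω P.ρ_contDiff_one).add (comp_phase_previous Ω P.ρ_contDiff_one)
  have K := momentum_previous P Ω (vel_previous Ω)
  have T := test_vec_ae (Ω := Ω)
  refine (((IsStepForm.pair_smul _ T A (vel_current Ω)).const_mul (1 / 2)).sub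
    (IsStepForm.pair _ T K)).congr (fun s s' z => ?_) (fun s s' d z => ?_) fun s s' d z => ?_
  · have h := pair_sub_left ((((vel_current Ω).memLp s s').smul (A.memLp s s')).const_smul
      (1 / 2 : ℝ)) (K.memLp s s') (IsStepForm.memLp_of_ae _ T z)
    have h1 := pair_smul_left (ν := vol Ω) (1 / 2 : ℝ)
      (fun x => (P.ρ (fn (phase s) x) + P.ρ (fn (phase s') x)) • vec s.1.1 x) (vec z.1.1)
    refine Eq.trans (congrArg₂ (· - ·) h1.symm rfl)
      (h.symm.trans (pair_congr (fun x => ?_) fun _ => rfl))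
    simp only [Pi.smul_apply, Pi.smul_apply']
    module
  · simp only [add_zero, pair_zero_left, pair_smul_eq_pair_inner]
    ring
  · simp only [smul_zero, zero_add, pair_zero_left, pair_smul_eq_pair_inner]

/-- The transport term. Its first argument is in `L³`, since velocities are in `L⁶` and gradients
of chemical potentials in `L³`. -/
theorem isStepForm_transport (hΩ : IsOpen Ω) [IsFiniteMeasure (vol Ω)] :
    IsStepForm (S := StepState Ω) (X := TestSpace Ω)
      (fun s s' z => tri (fun x => P.ρ (fn (phase s') x) • vec s'.1.1 x
        + flux P (phase s) s.2.2 x) s.1.1 z.1.1)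
      (fun s s' d z => tri (fun x => P.ρ (fn (phase s') x) • vec s'.1.1 x
          + flux P (phase s) s.2.2 x) d.1.1 z.1.1
        + tri (fun x => (-P.b * deriv (deriv P.ρ) (fn (phase s) x) * fn (phase d) x) • grad s.2.2 x
            + (-P.b * deriv P.ρ (fn (phase s) x)) • grad d.2.2 x) s.1.1 z.1.1)
      fun s s' d z => tri (fun x =>
        (deriv P.ρ (fn (phase s') x) * fn (phase d) x) • vec s'.1.1 x
          + P.ρ (fn (phase s') x) • vec d.1.1 x) s.1.1 z.1.1 := by
  have J : IsStepField (S := StepState Ω) 3 (vol Ω) (fun s _ => flux P (phase s) s.2.2)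
      (fun s _ d x => (-P.b * deriv (deriv P.ρ) (fn (phase s) x) * fn (phase d) x) • grad s.2.2 x
            + (-P.b * deriv P.ρ (fn (phase s) x)) • grad d.2.2 x) fun _ _ _ _ => 0 := by
    refine (((comp_phase_current Ω (contDiff_one_deriv P.ρ_contDiff)).const_smul (-P.b)).smul
      (q := 3) (gradPot_current_three Ω)).congr (fun _ _ _ => rfl) (fun s s' d x => ?_)
        fun s s' d x => ?_
    · simp only [smul_eq_mul]
      rw [add_comm, mul_assoc]
    · simp only [smul_zero, zero_smul, add_zero]
  refine (IsStepForm.trilinear (V := Hsig Ω) (S := StepState Ω) (X := TestSpace Ω)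
    (t := fun (u : Space → Space) (v w : Hsig Ω) => tri u v.1 w.1) (triL hΩ) (triL_apply hΩ)
    (velL Ω) (testVelL Ω) ((momentum_previous P Ω (vel_previous_three hΩ)).add J)).congr (fun s s' z => rfl)
      (fun s s' d z => ?_) fun s s' d z => ?_
  · simp only [zero_add]
    rfl
  · simp only [add_zero]
    rfl

theorem isStepForm_viscosity (Ω : Set Space) :
    IsStepForm (S := StepState Ω) (X := TestSpace Ω)
      (fun s _ z => pair (vol Ω) (fun x => (2 * P.η (fn (phase s) x)) • symGrad s.1.1 x)
        (symGrad z.1.1))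
      (fun s _ d z => pair (vol Ω)
          (fun x => (2 * deriv P.η (fn (phase s) x) * fn (phase d) x) • symGrad s.1.1 x)
          (symGrad z.1.1)
        + pair (vol Ω) (fun x => (2 * P.η (fn (phase s) x)) • symGrad d.1.1 x) (symGrad z.1.1))
      fun _ _ _ _ => 0 := by
  refine (IsStepForm.pair_smul _ (test_symGrad_ae (Ω := Ω))
    ((comp_phase_current Ω P.η_contDiff).const_smul 2) (symGrad_current Ω)).congr
      (fun _ _ _ => rfl) (fun s s' d z => ?_) fun s s' d z => ?_
  · simp only [smul_eq_mul, mul_assoc]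
    exact add_comm _ _
  · simp only [smul_zero, zero_smul, pair_zero_left, add_zero]

theorem isStepForm_capillary (Ω : Set Space) [IsFiniteMeasure (vol Ω)] :
    IsStepForm (S := StepState Ω) (X := TestSpace Ω)
      (fun s s' z => pair (vol Ω) (fun x => fn (phase s') x • grad s.2.2 x) (vec z.1.1))
      (fun _ s' d z => pair (vol Ω) (fun x => fn (phase s') x • grad d.2.2 x) (vec z.1.1))
      fun s _ d z => pair (vol Ω) (fun x => fn (phase d) x • grad s.2.2 x) (vec z.1.1) := by
  refine (IsStepForm.pair _ (test_vec_ae (Ω := Ω))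
    ((phase_previous Ω).smul (q := 2) (gradPot_current Ω))).congr
      (fun _ _ _ => rfl) (fun s s' d z => ?_) fun s s' d z => ?_
  · simp only [zero_smul, add_zero]
  · simp only [smul_zero, zero_add]

theorem isStepForm_gravity (Ω : Set Space) [IsFiniteMeasure (vol Ω)] :
    IsStepForm (S := StepState Ω) (X := TestSpace Ω)
      (fun s _ z => pair (vol Ω) (fun x => P.ρ (fn (phase s) x) • P.g) (vec z.1.1))
      (fun s _ d z => pair (vol Ω)
        (fun x => (deriv P.ρ (fn (phase s) x) * fn (phase d) x) • P.g) (vec z.1.1))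
      fun _ _ _ _ => 0 := by
  refine (IsStepForm.pair _ (test_vec_ae (Ω := Ω)) ((comp_phase_current Ω P.ρ_contDiff_one).smul
    (q := 2) (IsStepField.const (p := 2) (memLp_const P.g)))).congr
      (fun _ _ _ => rfl) (fun s s' d z => ?_) fun s s' d z => ?_
  · simp only [smul_zero, zero_add]
  · simp only [smul_zero, zero_smul, add_zero, pair_zero_left]

/-! ### The mass balance of one time step -/

theorem isStepForm_phaseIncrement (Ω : Set Space) :
    IsStepForm (S := StepState Ω) (X := TestSpace Ω)
      (fun s s' z => pair (vol Ω) (fun x => fn (phase s) x - fn (phase s') x) (fn z.2.1))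
      (fun _ _ d z => pair (vol Ω) (fn (phase d)) (fn z.2.1))
      fun _ _ d z => -pair (vol Ω) (fn (phase d)) (fn z.2.1) := by
  refine (IsStepForm.pair_sub _ (test_phase_ae (Ω := Ω)) (phase_two_current Ω)
    (phase_two_previous Ω)).congr (fun _ _ _ => rfl) (fun s s' d z => ?_) fun s s' d z => ?_
  · simp only [pair_zero_left, sub_zero]
  · simp only [pair_zero_left, zero_sub]

theorem isStepForm_advection (Ω : Set Space) :
    IsStepForm (S := StepState Ω) (X := TestSpace Ω)
      (fun _ s' z => pair (vol Ω) (fun x => fn (phase s') x • vec s'.1.1 x) (grad z.2.1))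
      (fun _ _ _ _ => 0)
      fun _ s' d z => pair (vol Ω) (fun x => fn (phase d) x • vec s'.1.1 x
        + fn (phase s') x • vec d.1.1 x) (grad z.2.1) := by
  refine (IsStepForm.pair _ (test_gradPhase_ae (Ω := Ω))
    ((phase_previous Ω).smul (q := 2) (vel_previous Ω))).congr
      (fun _ _ _ => rfl) (fun s s' d z => ?_) fun s s' d z => ?_
  · simp only [smul_zero, zero_smul, add_zero, pair_zero_left]
  · exact pair_congr (fun _ => add_comm _ _) fun _ => rfl

theorem sq_phase_previous (Ω : Set Space) : IsStepField (S := StepState Ω) ⊤ (vol Ω)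
    (fun _ s x => |fn (phase s) x| ^ 2) (fun _ _ _ _ => 0)
    fun _ s d x => 2 * fn (phase s) x * fn (phase d) x := by
  refine ((phase_previous Ω).smul (r := ⊤) (p := ⊤) (q := ⊤) (phase_previous Ω)).congr
    (fun _ s x => ?_) (fun _ s d x => ?_) fun _ s d x => ?_
  · rw [sq_abs, sq, smul_eq_mul]
  · rw [smul_zero, zero_smul, add_zero]
  · rw [smul_eq_mul, smul_eq_mul]
    ring

theorem isStepForm_stabilization (Ω : Set Space) [IsFiniteMeasure (vol Ω)] :
    IsStepForm (S := StepState Ω) (X := TestSpace Ω)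
      (fun s s' z => pair (vol Ω) (fun x => (|fn (phase s') x| ^ 2) • grad s.2.2 x) (grad z.2.1))
      (fun _ s' d z => pair (vol Ω) (fun x => (|fn (phase s') x| ^ 2) • grad d.2.2 x)
        (grad z.2.1))
      fun s s' d z => pair (vol Ω)
        (fun x => (2 * fn (phase s') x * fn (phase d) x) • grad s.2.2 x) (grad z.2.1) := by
  refine (IsStepForm.pair _ (test_gradPhase_ae (Ω := Ω))
    ((sq_phase_previous Ω).smul (q := 2) (gradPot_current Ω))).congr
      (fun _ _ _ => rfl) (fun s s' d z => ?_) fun s s' d z => ?_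
  · simp only [zero_smul, add_zero]
  · simp only [smul_zero, zero_add]

theorem isStepForm_diffusion (Ω : Set Space) [IsFiniteMeasure (vol Ω)] :
    IsStepForm (S := StepState Ω) (X := TestSpace Ω)
      (fun s _ z => pair (vol Ω) (grad s.2.2) (grad z.2.1))
      (fun _ _ d z => pair (vol Ω) (grad d.2.2) (grad z.2.1)) fun _ _ _ _ => 0 :=
  (IsStepForm.pair _ (test_gradPhase_ae (Ω := Ω)) (gradPot_current Ω)).congr
    (fun _ _ _ => rfl) (fun _ _ _ _ => rfl) fun _ _ _ _ => pair_zero_left _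

/-! ### The equation for the chemical potential in one time step -/

theorem isStepForm_interface (Ω : Set Space) :
    IsStepForm (S := StepState Ω) (X := TestSpace Ω)
      (fun s _ z => pair (vol Ω) (grad (phase s)) (grad z.2.2))
      (fun _ _ d z => pair (vol Ω) (grad (phase d)) (grad z.2.2)) fun _ _ _ _ => 0 :=
  (IsStepForm.pair _ (test_gradPot_ae (Ω := Ω)) (gradPhase_current Ω)).congr
    (fun _ _ _ => rfl) (fun _ _ _ _ => rfl) fun _ _ _ _ => pair_zero_left _

theorem isStepForm_potential (Ω : Set Space) [IsFiniteMeasure (vol Ω)] :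
    IsStepForm (S := StepState Ω) (X := TestSpace Ω)
      (fun s s' z => pair (vol Ω)
        (fun x => deriv P.Wp (fn (phase s) x) + deriv P.Wm (fn (phase s') x)) (fn z.2.2))
      (fun s _ d z => pair (vol Ω)
        (fun x => deriv (deriv P.Wp) (fn (phase s) x) * fn (phase d) x) (fn z.2.2))
      fun _ s' d z => pair (vol Ω)
        (fun x => deriv (deriv P.Wm) (fn (phase s') x) * fn (phase d) x) (fn z.2.2) := by
  refine (IsStepForm.pair _ (test_pot_ae (Ω := Ω))
    (((comp_phase_current Ω (contDiff_one_deriv P.Wp_contDiff)).add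
      (comp_phase_previous Ω (contDiff_one_deriv P.Wm_contDiff))).incl (q := 2) 2)).congr
      (fun _ _ _ => rfl) (fun s s' d z => ?_) fun s s' d z => ?_
  · simp only [add_zero]
  · simp only [zero_add]

theorem isStepForm_chemical (Ω : Set Space) [IsFiniteMeasure (vol Ω)] :
    IsStepForm (S := StepState Ω) (X := TestSpace Ω)
      (fun s _ z => pair (vol Ω) (fn s.2.2) (fn z.2.2))
      (fun _ _ d z => pair (vol Ω) (fn d.2.2) (fn z.2.2)) fun _ _ _ _ => 0 :=
  (IsStepForm.pair _ (test_pot_ae (Ω := Ω)) (pot_current Ω)).congr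
    (fun _ _ _ => rfl) (fun _ _ _ _ => rfl) fun _ _ _ _ => pair_zero_left _

theorem isStepForm_traceIncrement (hΩ : IsBoundedLipschitzDomain Ω) :
    IsStepForm (S := StepState Ω) (X := TestSpace Ω)
      (fun s s' z => pair (surf Ω) (fun x => tr (phase s) x - tr (phase s') x) (tr z.2.2))
      (fun _ _ d z => pair (surf Ω) (tr (phase d)) (tr z.2.2))
      fun _ _ d z => -pair (surf Ω) (tr (phase d)) (tr z.2.2) := by
  refine (IsStepForm.pair_sub _ (test_tr_ae hΩ) (tr_current hΩ)
    (tr_previous hΩ)).congr (fun _ _ _ => rfl) (fun s s' d z => ?_) fun s s' d z => ?_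
  · simp only [pair_zero_left, sub_zero]
  · simp only [pair_zero_left, zero_sub]

/-- The contact line term. The control enters through an `L²(∂Ω)` factor; it is multiplied by
functions of the trace of the phase field, which are in `L^∞(∂Ω)`. -/
theorem isStepForm_contactLine (hΩ : IsBoundedLipschitzDomain Ω) [IsFiniteMeasure (surf Ω)]
    (β : Lp ℝ 2 (surf Ω)) :
    IsStepForm (S := StepState Ω) (X := TestSpace Ω)
      (fun s s' z => pair (surf Ω) (fun x => P.Sγ / 2 * (tr (phase s) x - tr (phase s') x)
        + dγ P β (phase s') x) (tr z.2.2))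
      (fun _ _ d z => P.Sγ / 2 * pair (surf Ω) (tr (phase d)) (tr z.2.2))
      fun _ s' d z => -(P.Sγ / 2 * pair (surf Ω) (tr (phase d)) (tr z.2.2))
        + pair (surf Ω) (fun x => ddγ P β (phase s') x * tr (phase d) x) (tr z.2.2) := by
  have hβ : MemLp (fun x => P.σlg * (Real.cos P.θeq + β x)) 2 (surf Ω) :=
    ((memLp_const (Real.cos P.θeq)).add (Lp.memLp β)).const_mul P.σlg
  have K : IsStepField (S := StepState Ω) 2 (surf Ω) (fun _ s => dγ P β (phase s))
      (fun _ _ _ _ => 0) fun _ s d x => ddγ P β (phase s) x * tr (phase d) x := by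
    refine ((comp_tr_previous hΩ (contDiff_one_deriv P.θ_contDiff)).smul (q := 2)
      (IsStepField.const hβ)).congr (fun _ s x => ?_) (fun _ s d x => ?_) fun _ s d x => ?_
    · exact mul_comm _ _
    · simp
    · simp only [ddγ, smul_eq_mul, mul_zero, zero_add]
      ring
  refine (IsStepForm.pair_add _ (test_tr_ae hΩ)
    (((tr_current hΩ).sub (tr_previous hΩ)).const_smul (P.Sγ / 2)) K).congr
      (fun _ _ _ => rfl) (fun s s' d z => ?_) fun s s' d z => ?_
  · rw [pair_zero_left, pair_smul_left]
    simp only [sub_zero, add_zero]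
  · rw [pair_smul_left]
    simp only [zero_sub, pair_neg_left, mul_neg]

end StepTerms

/-! ### One time step -/

section Step

variable {Ω : Set Space} (P : ModelData)

/-- The contribution of one time step to `⟨z, e(y,u)⟩`, for the current state `s`, the previous
state `s'`, the test triple `z` and the mean control action `β`. -/
def stepPairing (β : Lp ℝ 2 (surf Ω)) (s s' : StepState Ω) (z : TestSpace Ω) : ℝ :=
  (pair (vol Ω) (fun x => ((P.ρ (fn (phase s) x) + P.ρ (fn (phase s') x)) / 2) • vec s.1.1 x
          - P.ρ (fn (phase s') x) • vec s'.1.1 x) (vec z.1.1)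
      + P.τ * tri (fun x => P.ρ (fn (phase s') x) • vec s'.1.1 x + flux P (phase s) s.2.2 x)
          s.1.1 z.1.1
      + P.τ * pair (vol Ω) (fun x => (2 * P.η (fn (phase s) x)) • symGrad s.1.1 x)
          (symGrad z.1.1)
      + P.τ * pair (vol Ω) (fun x => fn (phase s') x • grad s.2.2 x) (vec z.1.1)
      - P.τ * pair (vol Ω) (fun x => P.ρ (fn (phase s) x) • P.g) (vec z.1.1))
    + (pair (vol Ω) (fun x => fn (phase s) x - fn (phase s') x) (fn z.2.1)
      - P.τ * pair (vol Ω) (fun x => fn (phase s') x • vec s'.1.1 x) (grad z.2.1)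
      + P.τ ^ 2 / P.ρmin *
          pair (vol Ω) (fun x => (|fn (phase s') x| ^ 2) • grad s.2.2 x) (grad z.2.1)
      + P.τ * P.b * pair (vol Ω) (grad s.2.2) (grad z.2.1))
    + (P.τ * P.σ * P.ε * pair (vol Ω) (grad (phase s)) (grad z.2.2)
      + P.τ * (P.σ / P.ε) * pair (vol Ω)
          (fun x => deriv P.Wp (fn (phase s) x) + deriv P.Wm (fn (phase s') x)) (fn z.2.2)
      - P.τ * pair (vol Ω) (fn s.2.2) (fn z.2.2)
      + P.r * pair (surf Ω) (fun x => tr (phase s) x - tr (phase s') x) (tr z.2.2)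
      + P.τ * pair (surf Ω) (fun x => P.Sγ / 2 * (tr (phase s) x - tr (phase s') x)
          + dγ P β (phase s') x) (tr z.2.2))

/-- The derivative of `stepPairing` with respect to the current state in the direction `d`. -/
def stepCurrent (s s' d : StepState Ω) (z : TestSpace Ω) : ℝ :=
  (1 / 2 * pair (vol Ω) (fun x => deriv P.ρ (fn (phase s) x) * fn (phase d) x)
          (fun x => inner ℝ (vec s.1.1 x) (vec z.1.1 x))
      + 1 / 2 * pair (vol Ω)
          (fun x => (P.ρ (fn (phase s) x) + P.ρ (fn (phase s') x)) • vec d.1.1 x) (vec z.1.1)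
      + P.τ * tri (fun x =>
          (-P.b * deriv (deriv P.ρ) (fn (phase s) x) * fn (phase d) x) • grad s.2.2 x
            + (-P.b * deriv P.ρ (fn (phase s) x)) • grad d.2.2 x) s.1.1 z.1.1
      + P.τ * tri (fun x => P.ρ (fn (phase s') x) • vec s'.1.1 x + flux P (phase s) s.2.2 x)
          d.1.1 z.1.1
      + P.τ * pair (vol Ω)
          (fun x => (2 * deriv P.η (fn (phase s) x) * fn (phase d) x) • symGrad s.1.1 x)
          (symGrad z.1.1)
      + P.τ * pair (vol Ω) (fun x => (2 * P.η (fn (phase s) x)) • symGrad d.1.1 x)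
          (symGrad z.1.1)
      + P.τ * pair (vol Ω) (fun x => fn (phase s') x • grad d.2.2 x) (vec z.1.1)
      - P.τ * pair (vol Ω) (fun x => (deriv P.ρ (fn (phase s) x) * fn (phase d) x) • P.g)
          (vec z.1.1))
    + (pair (vol Ω) (fn (phase d)) (fn z.2.1)
      + P.τ ^ 2 / P.ρmin *
          pair (vol Ω) (fun x => (|fn (phase s') x| ^ 2) • grad d.2.2 x) (grad z.2.1)
      + P.τ * P.b * pair (vol Ω) (grad d.2.2) (grad z.2.1))
    + (P.τ * P.σ * P.ε * pair (vol Ω) (grad (phase d)) (grad z.2.2)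
      + P.τ * P.σ / P.ε * pair (vol Ω)
          (fun x => deriv (deriv P.Wp) (fn (phase s) x) * fn (phase d) x) (fn z.2.2)
      - P.τ * pair (vol Ω) (fn d.2.2) (fn z.2.2)
      + P.r * pair (surf Ω) (tr (phase d)) (tr z.2.2)
      + P.τ * (P.Sγ / 2 * pair (surf Ω) (tr (phase d)) (tr z.2.2)))

/-- The derivative of `stepPairing` with respect to the previous state in the direction `d`. -/
def stepPrevious (β : Lp ℝ 2 (surf Ω)) (s s' d : StepState Ω) (z : TestSpace Ω) : ℝ :=
  (1 / 2 * pair (vol Ω) (fun x => deriv P.ρ (fn (phase s') x) * fn (phase d) x)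
          (fun x => inner ℝ (vec s.1.1 x) (vec z.1.1 x))
      - pair (vol Ω) (fun x => (deriv P.ρ (fn (phase s') x) * fn (phase d) x) • vec s'.1.1 x
          + P.ρ (fn (phase s') x) • vec d.1.1 x) (vec z.1.1)
      + P.τ * tri (fun x => (deriv P.ρ (fn (phase s') x) * fn (phase d) x) • vec s'.1.1 x
          + P.ρ (fn (phase s') x) • vec d.1.1 x) s.1.1 z.1.1
      + P.τ * pair (vol Ω) (fun x => fn (phase d) x • grad s.2.2 x) (vec z.1.1))
    + (-pair (vol Ω) (fn (phase d)) (fn z.2.1)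
      - P.τ * pair (vol Ω) (fun x => fn (phase d) x • vec s'.1.1 x
          + fn (phase s') x • vec d.1.1 x) (grad z.2.1)
      + P.τ ^ 2 / P.ρmin * pair (vol Ω)
          (fun x => (2 * fn (phase s') x * fn (phase d) x) • grad s.2.2 x) (grad z.2.1))
    + (P.τ * P.σ / P.ε * pair (vol Ω)
          (fun x => deriv (deriv P.Wm) (fn (phase s') x) * fn (phase d) x) (fn z.2.2)
      - P.r * pair (surf Ω) (tr (phase d)) (tr z.2.2)
      + P.τ * (-(P.Sγ / 2 * pair (surf Ω) (tr (phase d)) (tr z.2.2))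
        + pair (surf Ω) (fun x => ddγ P β (phase s') x * tr (phase d) x) (tr z.2.2)))

theorem isStepForm_step (hΩ : IsBoundedLipschitzDomain Ω) (β : Lp ℝ 2 (surf Ω)) :
    IsStepForm (stepPairing P β) (stepCurrent P) (stepPrevious P β) := by
  have := isFiniteMeasure_vol hΩ.isBounded
  have := isFiniteMeasure_surf hΩ
  refine ((((((isStepForm_inertia P Ω).add
    ((isStepForm_transport P hΩ.isOpen).const_mul P.τ)).add
    ((isStepForm_viscosity P Ω).const_mul P.τ)).add
    ((isStepForm_capillary Ω).const_mul P.τ)).sub ((isStepForm_gravity P Ω).const_mul P.τ)).add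
    ((((isStepForm_phaseIncrement Ω).sub ((isStepForm_advection Ω).const_mul P.τ)).add
    ((isStepForm_stabilization Ω).const_mul (P.τ ^ 2 / P.ρmin))).add
    ((isStepForm_diffusion Ω).const_mul (P.τ * P.b)))).add
    (((((isStepForm_interface Ω).const_mul (P.τ * P.σ * P.ε)).add
    ((isStepForm_potential P Ω).const_mul (P.τ * (P.σ / P.ε)))).sub
    ((isStepForm_chemical Ω).const_mul P.τ)).add
    ((isStepForm_traceIncrement hΩ).const_mul P.r) |>.add
    ((isStepForm_contactLine P hΩ β).const_mul P.τ)) |>.congr (fun s s' z => rfl)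
      (fun s s' d z => ?_) fun s s' d z => ?_
  · simp only [stepCurrent]
    ring
  · simp only [stepPrevious]
    ring

end Step

/-! ### Time stepping -/

theorem map_timeSeq {X X' : Type*} [Zero X] [Zero X'] (f : X → X') (hf : f 0 = 0) {M : ℕ} (a₀ : X)
    (a : Fin M → X) (k : ℕ) : f (timeSeq a₀ a k) = timeSeq (f a₀) (fun m => f (a m)) k := by
  cases k with
  | zero => rfl
  | succ k =>
    simp only [timeSeq]
    split_ifs with h
    · rfl
    · exact hf

theorem timeSeq_succ {X : Type*} [Zero X] {M : ℕ} (a₀ : X) (a : Fin M → X) (m : Fin M) :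
    timeSeq a₀ a (m + 1) = a m := by
  simp [timeSeq]

theorem timeSeq_last {X : Type*} [Zero X] {M : ℕ} (a₀ : X) (a : Fin M → X) :
    timeSeq a₀ a (M + 1) = 0 := by
  simp [timeSeq]

theorem timeSeq_zero_of_forall {X : Type*} [Zero X] {M : ℕ} {a : Fin M → X} {k : ℕ}
    (h : ∀ m : Fin M, (m : ℕ) + 1 = k → a m = 0) : timeSeq 0 a k = 0 := by
  cases k with
  | zero => rfl
  | succ k =>
    simp only [timeSeq]
    split_ifs with hk
    · exact h ⟨k, hk⟩ rfl
    · rfl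

theorem sum_fin_succ_eq_sum_Icc (M : ℕ) (G : ℕ → ℝ) :
    ∑ m : Fin M, G (m + 1) = ∑ k ∈ Finset.Icc 1 M, G k := by
  rw [Fin.sum_univ_eq_sum_range fun k => G (k + 1)]
  induction M with
  | zero => simp
  | succ M ih => rw [Finset.sum_range_succ, ih, Finset.sum_Icc_succ_top (by omega)]

theorem sum_Icc_succ_eq (M : ℕ) (G : ℕ → ℝ) (h1 : G 1 = 0) (hM : G (M + 1) = 0) :
    ∑ k ∈ Finset.Icc 1 M, G (k + 1) = ∑ k ∈ Finset.Icc 1 M, G k := by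
  have h := Finset.sum_range_succ' (fun k => G (k + 1)) M
  rw [Finset.sum_range_succ, h1, hM, add_zero, add_zero] at h
  rw [← sum_fin_succ_eq_sum_Icc M fun k => G (k + 1), ← sum_fin_succ_eq_sum_Icc M G,
    Fin.sum_univ_eq_sum_range fun k => G (k + 1 + 1), Fin.sum_univ_eq_sum_range fun k => G (k + 1),
    h]

theorem IsStepForm.zero_dir {S X : Type*} [NormedAddCommGroup S] [NormedSpace ℝ S]
    [NormedAddCommGroup X] [NormedSpace ℝ X] {F : S → S → X → ℝ} {Fc Fp : S → S → S → X → ℝ}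
    (H : IsStepForm F Fc Fp) (s s' : S) (z : X) : Fc s s' 0 z = 0 ∧ Fp s s' 0 z = 0 := by
  obtain ⟨f, f', h0, h1, h2, h3⟩ := H
  obtain ⟨L, -, hL⟩ := h0 (s, s')
  rw [← h2, ← h3, ← hL, Prod.mk_zero_zero, map_zero]
  exact ⟨rfl, rfl⟩

theorem IsStepForm.zero_test {S X : Type*} [NormedAddCommGroup S] [NormedSpace ℝ S]
    [NormedAddCommGroup X] [NormedSpace ℝ X] {F : S → S → X → ℝ} {Fc Fp : S → S → S → X → ℝ}
    (H : IsStepForm F Fc Fp) (s s' d : S) : Fp s s' d 0 = 0 := by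
  obtain ⟨f, f', h0, h1, h2, h3⟩ := H
  rw [← h3, map_zero]

/-- The operator which collects the residuals of all time steps is Fréchet differentiable: the
state at each time index is an affine function of the unknowns, since the initial state is
fixed. -/
theorem exists_timeStepping {A S X : Type*} [NormedAddCommGroup A] [NormedSpace ℝ A]
    [NormedAddCommGroup S] [NormedSpace ℝ S] [NormedAddCommGroup X] [NormedSpace ℝ X] {M : ℕ}
    (D : Fin M → A →L[ℝ] S) (s₀ : S) {F : ℕ → S → S → X → ℝ} {Fc Fp : ℕ → S → S → S → X → ℝ}
    (H : ∀ k, IsStepForm (F k) (Fc k) (Fp k)) :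
    ∃ (e : A → Fin M → StrongDual ℝ X) (e' : A → A →L[ℝ] Fin M → StrongDual ℝ X),
      (∀ y m z, e y m z = F (m + 1) (timeSeq s₀ (fun k => D k y) (m + 1))
        (timeSeq s₀ (fun k => D k y) m) z) ∧
      (∀ y, HasFDerivAt e (e' y) y) ∧
      ∀ y d m z, e' y d m z =
        Fc (m + 1) (timeSeq s₀ (fun k => D k y) (m + 1)) (timeSeq s₀ (fun k => D k y) m)
          (timeSeq 0 (fun k => D k d) (m + 1)) z +
        Fp (m + 1) (timeSeq s₀ (fun k => D k y) (m + 1)) (timeSeq s₀ (fun k => D k y) m)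
          (timeSeq 0 (fun k => D k d) m) z := by
  choose f f' h0 h1 h2 h3 using H
  have hst : ∀ k y, HasFDerivAt (fun y => timeSeq s₀ (fun m => D m y) k) (timeSeq 0 D k) y := by
    intro k y
    cases k with
    | zero => exact hasFDerivAt_const s₀ y
    | succ k =>
      by_cases hk : k < M
      · have h : (fun y => timeSeq s₀ (fun m => D m y) (k + 1)) = fun y => D ⟨k, hk⟩ y := by
          funext y; simp [timeSeq, hk]
        rw [h]
        simp only [timeSeq, hk, dif_pos]
        exact (D ⟨k, hk⟩).hasFDerivAt
      · have h : (fun y => timeSeq s₀ (fun m => D m y) (k + 1)) = fun _ => 0 := by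
          funext y; simp [timeSeq, hk]
        rw [h]
        simp only [timeSeq, hk, dif_neg, not_false_eq_true]
        exact hasFDerivAt_const 0 y
  have hdir : ∀ k d, timeSeq 0 D k d = timeSeq 0 (fun m => D m d) k := fun k d =>
    map_timeSeq (fun L : A →L[ℝ] S => L d) rfl 0 D k
  choose L hL hL' using fun k y => h0 k y
  refine ⟨fun y m => f (m + 1) (timeSeq s₀ (fun k => D k y) (m + 1),
      timeSeq s₀ (fun k => D k y) m),
    fun y => ContinuousLinearMap.pi fun m : Fin M =>
      (L (m + 1) (timeSeq s₀ (fun k => D k y) (m + 1), timeSeq s₀ (fun k => D k y) m)).comp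
        ((timeSeq 0 D (m + 1)).prod (timeSeq 0 D m)), fun y m z => h1 _ _ _ z, fun y => ?_,
    fun y d m z => ?_⟩
  · refine hasFDerivAt_pi.2 fun m => ?_
    exact (hL (m + 1) _).comp y ((hst (m + 1) y).prodMk (hst m y))
  · rw [← h2, ← h3, ← hL', ← hL', ← add_apply, ← map_add, Prod.mk_add_mk, add_zero, zero_add,
      ← hdir, ← hdir]
    rfl

/-! ### The components of the unknown -/

section Components

variable {Ω : Set Space} {M : ℕ}

/-- The state at one time index, as a linear function of the unknown. -/
def stateLin (m : Fin M) : Y Ω M →ₗ[ℝ] StepState Ω where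
  toFun y := (Y.v y m, ⟨(Y.φ y m, y.1.snd.snd.fst m), y.2 m⟩, Y.μ y m)
  map_add' _ _ := rfl
  map_smul' _ _ := rfl

theorem norm_stateLin_le (m : Fin M) (y : Y Ω M) : ‖stateLin m y‖ ≤ 1 * ‖y‖ := by
  rw [one_mul]
  have h0 : ‖y.1.snd‖ ≤ ‖y‖ := WithLp.norm_snd_le (p := 1) _ y.1
  have h1 : ‖y.1.snd.snd‖ ≤ ‖y‖ := (WithLp.norm_snd_le (p := 1) _ y.1.snd).trans h0
  refine max_le ?_ (max_le (max_le ?_ ?_) ?_)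
  · exact (norm_le_pi_norm y.1.fst m).trans (WithLp.norm_fst_le (p := 1) _ y.1)
  · exact (norm_le_pi_norm y.1.snd.fst m).trans ((WithLp.norm_fst_le (p := 1) _ y.1.snd).trans h0)
  · exact (norm_le_pi_norm y.1.snd.snd.fst m).trans
      ((WithLp.norm_fst_le (p := 1) _ y.1.snd.snd).trans h1)
  · exact (norm_le_pi_norm y.1.snd.snd.snd m).trans
      ((WithLp.norm_snd_le (p := 1) _ y.1.snd.snd).trans h1)

/-- The state at one time index, as a continuous linear function of the unknown. -/
def stateL (m : Fin M) : Y Ω M →L[ℝ] StepState Ω :=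
  (stateLin m).mkContinuous 1 (norm_stateLin_le m)

theorem BddPhase.eq_zero {f : BddPhase Ω} (hf : f.1.1 = 0) : f = 0 := by
  have h : f.1.2 = 0 := by
    refine Lp.ext ?_
    refine (BddPhase.ae_eq f).symm.trans (EventuallyEq.trans ?_ (Lp.coeFn_zero ℝ ⊤ (vol Ω)).symm)
    rw [hf]
    exact fn_zero
  exact Subtype.ext (Prod.ext hf h)

theorem stateL_eq_zero {m : Fin M} {y : Y Ω M} (hv : Y.v y m = 0) (hφ : Y.φ y m = 0)
    (hμ : Y.μ y m = 0) : stateL m y = 0 :=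
  Prod.ext hv (Prod.ext (BddPhase.eq_zero hφ) hμ)

end Components

/-! ### The derivative as a sum over time steps -/

section Derivative

variable {Ω : Set Space} (P : ModelData)

theorem memLp_vec (v : Hsig Ω) : MemLp (vec v.1) 2 (vol Ω) :=
  (memLp_congr_ae (vec2L_ae v)).1 (Lp.memLp _)

theorem pair_densityVariation (s s' d : StepState Ω) (z z' : TestSpace Ω) :
    pair (vol Ω) (fun x => deriv P.ρ (fn (phase s) x) * fn (phase d) x)
        (fun x => inner ℝ (vec s.1.1 x) (vec z.1.1 x) + inner ℝ (vec s'.1.1 x) (vec z'.1.1 x)) =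
      pair (vol Ω) (fun x => deriv P.ρ (fn (phase s) x) * fn (phase d) x)
        (fun x => inner ℝ (vec s.1.1 x) (vec z.1.1 x)) +
      pair (vol Ω) (fun x => deriv P.ρ (fn (phase s) x) * fn (phase d) x)
        (fun x => inner ℝ (vec s'.1.1 x) (vec z'.1.1 x)) := by
  have ha := (comp_phase_current Ω P.ρ_contDiff_one).memLp_current s s' d
  have hint : ∀ (t : StepState Ω) (z : TestSpace Ω), Integrable (fun x => (inner ℝ
      (deriv P.ρ (fn (phase s) x) * fn (phase d) x)
      (inner ℝ (vec t.1.1 x) (vec z.1.1 x) : ℝ) : ℝ)) (vol Ω) := by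
    intro t z
    refine (integrable_inner_of_memLp ((memLp_vec t.1).smul ha) (memLp_vec z.1)).congr (Eventually.of_forall fun x => ?_)
    simp only [Pi.smul_apply', real_inner_smul_left]
    exact mul_comm _ _
  simp only [pair, inner_add_right]
  exact integral_add (hint s z) (hint s' z')

/-- The variation of the state at one time index enters the residuals of two consecutive time
steps: as the current state of its own step and as the previous state of the next one. -/
theorem stepCurrent_add_stepPrevious (β : Lp ℝ 2 (surf Ω)) (s' s t d : StepState Ω)
    (z z' : TestSpace Ω) :
    ((1 / 2 * pair (vol Ω) (fun x => deriv P.ρ (fn (phase s) x) * fn (phase d) x)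
            (fun x => inner ℝ (vec s.1.1 x) (vec z.1.1 x)
              + inner ℝ (vec t.1.1 x) (vec z'.1.1 x))
        + 1 / 2 * pair (vol Ω)
            (fun x => (P.ρ (fn (phase s) x) + P.ρ (fn (phase s') x)) • vec d.1.1 x) (vec z.1.1)
        - pair (vol Ω) (fun x => (deriv P.ρ (fn (phase s) x) * fn (phase d) x) • vec s.1.1 x
            + P.ρ (fn (phase s) x) • vec d.1.1 x) (vec z'.1.1)
        + P.τ * tri (fun x => (deriv P.ρ (fn (phase s) x) * fn (phase d) x) • vec s.1.1 x
            + P.ρ (fn (phase s) x) • vec d.1.1 x) t.1.1 z'.1.1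
        + P.τ * tri (fun x =>
            (-P.b * deriv (deriv P.ρ) (fn (phase s) x) * fn (phase d) x) • grad s.2.2 x
            + (-P.b * deriv P.ρ (fn (phase s) x)) • grad d.2.2 x) s.1.1 z.1.1
        + P.τ * tri (fun x => P.ρ (fn (phase s') x) • vec s'.1.1 x
            + flux P (phase s) s.2.2 x) d.1.1 z.1.1
        + P.τ * pair (vol Ω)
            (fun x => (2 * deriv P.η (fn (phase s) x) * fn (phase d) x) • symGrad s.1.1 x)
            (symGrad z.1.1)
        + P.τ * pair (vol Ω) (fun x => (2 * P.η (fn (phase s) x)) • symGrad d.1.1 x)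
            (symGrad z.1.1)
        + P.τ * pair (vol Ω) (fun x => fn (phase d) x • grad t.2.2 x) (vec z'.1.1)
        + P.τ * pair (vol Ω) (fun x => fn (phase s') x • grad d.2.2 x) (vec z.1.1)
        - P.τ * pair (vol Ω) (fun x => (deriv P.ρ (fn (phase s) x) * fn (phase d) x) • P.g)
            (vec z.1.1))
      + (pair (vol Ω) (fn (phase d)) (fun x => fn z.2.1 x - fn z'.2.1 x)
        - P.τ * pair (vol Ω) (fun x => fn (phase d) x • vec s.1.1 x
            + fn (phase s) x • vec d.1.1 x) (grad z'.2.1)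
        + P.τ ^ 2 / P.ρmin * pair (vol Ω)
            (fun x => (2 * fn (phase s) x * fn (phase d) x) • grad t.2.2 x) (grad z'.2.1)
        + P.τ ^ 2 / P.ρmin *
            pair (vol Ω) (fun x => (|fn (phase s') x| ^ 2) • grad d.2.2 x) (grad z.2.1)
        + P.τ * P.b * pair (vol Ω) (grad d.2.2) (grad z.2.1))
      + (P.τ * P.σ * P.ε * pair (vol Ω) (grad (phase d)) (grad z.2.2)
        + P.τ * P.σ / P.ε * pair (vol Ω)
            (fun x => deriv (deriv P.Wp) (fn (phase s) x) * fn (phase d) x) (fn z.2.2)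
        + P.τ * P.σ / P.ε * pair (vol Ω)
            (fun x => deriv (deriv P.Wm) (fn (phase s) x) * fn (phase d) x) (fn z'.2.2)
        - P.τ * pair (vol Ω) (fn d.2.2) (fn z.2.2)
        + P.r * pair (surf Ω) (tr (phase d)) (fun x => tr z.2.2 x - tr z'.2.2 x)
        + P.τ * (P.Sγ / 2 * pair (surf Ω) (tr (phase d)) (fun x => tr z.2.2 x - tr z'.2.2 x)
          + pair (surf Ω) (fun x => ddγ P β (phase s) x * tr (phase d) x) (tr z'.2.2)))) =
    stepCurrent P s s' d z + stepPrevious P β t s d z' := by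
  have h1 := pair_densityVariation P s t d z z'
  have h2 := pair_sub_right (memLp_fn (phase d)) (memLp_fn z.2.1) (memLp_fn z'.2.1)
  have h3 := pair_sub_right (Lp.memLp (tr (phase d))) (Lp.memLp (tr z.2.2)) (Lp.memLp (tr z'.2.2))
  simp only [stepCurrent, stepPrevious]
  linear_combination 1 / 2 * h1 + h2 + (P.r + P.τ * (P.Sγ / 2)) * h3

section Zero

variable {ν : Measure Space} {H : Type*} [NormedAddCommGroup H] [InnerProductSpace ℝ H]

theorem pair_eq_zero_of_left {f : Space → H} (hf : f =ᵐ[ν] fun _ => 0) (h : Space → H) :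
    pair ν f h = 0 := by
  refine integral_eq_zero_of_ae ?_
  filter_upwards [hf] with x hx
  rw [hx, inner_zero_left, Pi.zero_apply]

theorem pair_eq_zero_of_right {h : Space → H} (hh : h =ᵐ[ν] fun _ => 0) (f : Space → H) :
    pair ν f h = 0 := by
  refine integral_eq_zero_of_ae ?_
  filter_upwards [hh] with x hx
  rw [hx, inner_zero_right, Pi.zero_apply]

theorem vec_zero : vec (0 : VH1 Ω) =ᵐ[vol Ω] fun _ => 0 := by
  filter_upwards [fn_zero (p := 2) (Ω := Ω)] with x hx
  ext i
  exact hx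

theorem symGrad_zero : symGrad (0 : VH1 Ω) =ᵐ[vol Ω] fun _ => 0 := by
  filter_upwards [grad_zero (p := 2) (Ω := Ω)] with x hx
  ext ij
  change (grad (0 : H1 Ω) x ij.2 + grad (0 : H1 Ω) x ij.1) / 2 = 0
  rw [hx]
  simp

theorem tri_zero_right (u : Space → Space) (v : VH1 Ω) : tri u v 0 = 0 := by
  have h : conv u (0 : VH1 Ω) =ᵐ[vol Ω] fun _ => 0 := by
    filter_upwards [grad_zero (p := 2) (Ω := Ω)] with x hx
    ext i
    change inner ℝ (u x) (grad (0 : H1 Ω) x) = 0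
    rw [hx]
    exact inner_zero_right _
  rw [tri, pair_eq_zero_of_right vec_zero, pair_eq_zero_of_left h, mul_zero, sub_zero]

theorem fn_ae_zero {p : ℝ≥0∞} [Fact (1 ≤ p)] {f : W1 p Ω} (hf : f = 0) :
    fn f =ᵐ[vol Ω] fun _ => 0 := by
  subst hf
  exact fn_zero

theorem grad_ae_zero {p : ℝ≥0∞} [Fact (1 ≤ p)] {f : W1 p Ω} (hf : f = 0) :
    grad f =ᵐ[vol Ω] fun _ => 0 := by
  subst hf
  exact grad_zero

theorem tr_ae_zero (hΩ : IsBoundedLipschitzDomain Ω) {f : H1 Ω} (hf : f = 0) :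
    (tr f : Space → ℝ) =ᵐ[surf Ω] fun _ => 0 := by
  have h : tr f = 0 := by
    subst hf
    exact map_zero (trL hΩ)
  rw [h]
  exact Lp.coeFn_zero ℝ 2 (surf Ω)

theorem mul_fn_ae_zero {p : ℝ≥0∞} [Fact (1 ≤ p)] {f : W1 p Ω} (hf : f = 0) (a : Space → ℝ) :
    (fun x => a x * fn f x) =ᵐ[vol Ω] fun _ => 0 := by
  filter_upwards [fn_ae_zero hf] with x hx
  rw [hx, mul_zero]

theorem smul_grad_ae_zero {p : ℝ≥0∞} [Fact (1 ≤ p)] {f : W1 p Ω} (hf : f = 0) (a : Space → ℝ) :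
    (fun x => a x • grad f x) =ᵐ[vol Ω] fun _ => 0 := by
  filter_upwards [grad_ae_zero hf] with x hx
  rw [hx, smul_zero]

end Zero

/-- The equations for the phase field and the chemical potential of one time step do not contain
the velocity of the current state. -/
theorem stepCurrent_eq_zero (hΩ : IsBoundedLipschitzDomain Ω) (s s' : StepState Ω)
    {d : StepState Ω} (hφ : phase d = 0) (hμ : d.2.2 = 0) (Ψ Φ : H1 Ω) :
    stepCurrent P s s' d (0, Ψ, Φ) = 0 := by
  have hvec : vec (0 : Hsig Ω).1 =ᵐ[vol Ω] fun _ => 0 := vec_zero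
  have hsym : symGrad (0 : Hsig Ω).1 =ᵐ[vol Ω] fun _ => 0 := symGrad_zero
  have hadd : ∀ {a b : ℝ}, a = 0 → b = 0 → a + b = 0 := fun ha hb => by rw [ha, hb, add_zero]
  have hsub : ∀ {a b : ℝ}, a = 0 → b = 0 → a - b = 0 := fun ha hb => by rw [ha, hb, sub_zero]
  have hmul : ∀ {a b : ℝ}, b = 0 → a * b = 0 := fun hb => by rw [hb, mul_zero]
  rw [stepCurrent]
  refine hadd (hadd (hsub (hadd (hadd (hadd (hadd (hadd (hadd (hmul ?_) (hmul ?_)) (hmul ?_))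
    (hmul ?_)) (hmul ?_)) (hmul ?_)) (hmul ?_)) (hmul ?_))
    (hadd (hadd ?_ (hmul ?_)) (hmul ?_)))
    (hadd (hadd (hsub (hadd (hmul ?_) (hmul ?_)) (hmul ?_)) (hmul ?_)) (hmul (hmul ?_)))
  · exact pair_eq_zero_of_left (mul_fn_ae_zero hφ _) _
  · exact pair_eq_zero_of_right hvec _
  · exact tri_zero_right _ _
  · exact tri_zero_right _ _
  · exact pair_eq_zero_of_right hsym _
  · exact pair_eq_zero_of_right hsym _
  · exact pair_eq_zero_of_right hvec _
  · exact pair_eq_zero_of_right hvec _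
  · exact pair_eq_zero_of_left (fn_ae_zero hφ) _
  · exact pair_eq_zero_of_left (smul_grad_ae_zero hμ _) _
  · exact pair_eq_zero_of_left (grad_ae_zero hμ) _
  · exact pair_eq_zero_of_left (grad_ae_zero hφ) _
  · exact pair_eq_zero_of_left (mul_fn_ae_zero hφ _) _
  · exact pair_eq_zero_of_left (fn_ae_zero hμ) _
  · exact pair_eq_zero_of_left (tr_ae_zero hΩ hφ) _
  · exact pair_eq_zero_of_left (tr_ae_zero hΩ hφ) _

end Derivative

/-! ### Matching the two pairings -/

section Matching

variable {Ω : Set Space} (P : ModelData) {M : ℕ}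

/-- The state at time index `k`, for the initial state `s₀`. -/
def stateSeq (s₀ : StepState Ω) (y : Y Ω M) (k : ℕ) : StepState Ω :=
  timeSeq s₀ (fun m => stateL m y) k

theorem vel_stateSeq (s₀ : StepState Ω) (y : Y Ω M) (k : ℕ) :
    timeSeq s₀.1 (Y.v y) k = (stateSeq s₀ y k).1 :=
  (map_timeSeq (fun s : StepState Ω => s.1) rfl s₀ (fun m => stateL m y) k).symm

theorem phase_stateSeq (s₀ : StepState Ω) (y : Y Ω M) (k : ℕ) :
    timeSeq (phase s₀) (Y.φ y) k = phase (stateSeq s₀ y k) :=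
  (map_timeSeq (phase (Ω := Ω)) rfl s₀ (fun m => stateL m y) k).symm

theorem pot_stateSeq (s₀ : StepState Ω) (y : Y Ω M) (k : ℕ) :
    timeSeq s₀.2.2 (Y.μ y) k = (stateSeq s₀ y k).2.2 :=
  (map_timeSeq (fun s : StepState Ω => s.2.2) rfl s₀ (fun m => stateL m y) k).symm

theorem vel_testSeq (z : Fin M → TestSpace Ω) (k : ℕ) :
    timeSeq 0 (fun m => (z m).1) k = (timeSeq 0 z k).1 :=
  (map_timeSeq (fun z : TestSpace Ω => z.1) rfl 0 z k).symm

theorem phase_testSeq (z : Fin M → TestSpace Ω) (k : ℕ) :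
    timeSeq 0 (fun m => (z m).2.1) k = (timeSeq 0 z k).2.1 :=
  (map_timeSeq (fun z : TestSpace Ω => z.2.1) rfl 0 z k).symm

theorem pot_testSeq (z : Fin M → TestSpace Ω) (k : ℕ) :
    timeSeq 0 (fun m => (z m).2.2) k = (timeSeq 0 z k).2.2 :=
  (map_timeSeq (fun z : TestSpace Ω => z.2.2) rfl 0 z k).symm

theorem schemePairing_eq (β : BdryL2 Ω (M * P.τ)) (s₀ : StepState Ω) (hs₀ : s₀.2.2 = 0)
    (y : Y Ω M) (z : Fin M → TestSpace Ω) :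
    schemePairing P β s₀.1 (phase s₀) y z = ∑ k ∈ Finset.Icc 1 M,
      stepPairing P (meanControl P β k) (stateSeq s₀ y k) (stateSeq s₀ y (k - 1))
        (timeSeq 0 z k) := by
  have hμ := pot_stateSeq s₀ y
  rw [hs₀] at hμ
  simp only [schemePairing, vel_stateSeq, phase_stateSeq, hμ, vel_testSeq, phase_testSeq,
    pot_testSeq]
  rfl

theorem derivPairing_eq (β : BdryL2 Ω (M * P.τ)) (s₀ : StepState Ω) (hs₀ : s₀.2.2 = 0)
    (y d : Y Ω M) (z : Fin M → TestSpace Ω) :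
    derivPairing P β s₀.1 (phase s₀) y d z = ∑ k ∈ Finset.Icc 1 M,
      (stepCurrent P (stateSeq s₀ y k) (stateSeq s₀ y (k - 1)) (stateSeq 0 d k) (timeSeq 0 z k) +
        stepPrevious P (meanControl P β (k + 1)) (stateSeq s₀ y (k + 1)) (stateSeq s₀ y k)
          (stateSeq 0 d k) (timeSeq 0 z (k + 1))) := by
  have hμ := pot_stateSeq s₀ y
  rw [hs₀] at hμ
  have h1 : ∀ k, timeSeq 0 (Y.v d) k = (stateSeq 0 d k).1 := vel_stateSeq 0 d
  have h2 : ∀ k, timeSeq 0 (Y.φ d) k = phase (stateSeq 0 d k) := phase_stateSeq 0 d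
  have h3 : ∀ k, timeSeq 0 (Y.μ d) k = (stateSeq 0 d k).2.2 := pot_stateSeq 0 d
  simp only [derivPairing, vel_stateSeq, phase_stateSeq, hμ, vel_testSeq, phase_testSeq,
    pot_testSeq, h1, h2, h3]
  exact Finset.sum_congr rfl fun k _ => stepCurrent_add_stepPrevious P _ _ _ _ _ _ _

end Matching

/-! ### The operator and its derivative -/

section Operator

variable {Ω : Set Space} (P : ModelData) {M : ℕ}

/-- The operator and its derivative, with the values of their components as contributions of
single time steps. -/
theorem exists_residual (hΩ : IsBoundedLipschitzDomain Ω) (β : BdryL2 Ω (M * P.τ))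
    (s₀ : StepState Ω) : ∃ (e : Y Ω M → Z Ω M) (e' : Y Ω M → Y Ω M →L[ℝ] Z Ω M),
      (∀ y (m : Fin M) z, e y m z = stepPairing P (meanControl P β (m + 1 : ℕ))
        (stateSeq s₀ y (m + 1)) (stateSeq s₀ y m) z) ∧
      (∀ y, HasFDerivAt e (e' y) y) ∧
      ∀ y d (m : Fin M) z, e' y d m z =
        stepCurrent P (stateSeq s₀ y (m + 1)) (stateSeq s₀ y m) (stateSeq 0 d (m + 1)) z +
        stepPrevious P (meanControl P β (m + 1 : ℕ)) (stateSeq s₀ y (m + 1)) (stateSeq s₀ y m)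
          (stateSeq 0 d m) z :=
  exists_timeStepping (A := Y Ω M) (S := StepState Ω) (X := TestSpace Ω) stateL s₀
    (F := fun k => stepPairing P (meanControl P β k)) (Fc := fun _ => stepCurrent P)
    (Fp := fun k => stepPrevious P (meanControl P β k))
    fun k => isStepForm_step P hΩ (meanControl P β k)

theorem sum_residual_eq (β : BdryL2 Ω (M * P.τ)) (s₀ : StepState Ω) (hs₀ : s₀.2.2 = 0)
    (y : Y Ω M) (z : Fin M → TestSpace Ω) :
    ∑ m : Fin M, stepPairing P (meanControl P β (m + 1 : ℕ)) (stateSeq s₀ y (m + 1))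
      (stateSeq s₀ y m) (z m) = schemePairing P β s₀.1 (phase s₀) y z := by
  rw [schemePairing_eq P β s₀ hs₀, ← sum_fin_succ_eq_sum_Icc]
  exact Finset.sum_congr rfl fun m _ => congrArg (stepPairing P _ _ _) (timeSeq_succ 0 z m).symm

theorem sum_residualDeriv_eq (hΩ : IsBoundedLipschitzDomain Ω) (β : BdryL2 Ω (M * P.τ))
    (s₀ : StepState Ω) (hs₀ : s₀.2.2 = 0) (y d : Y Ω M) (z : Fin M → TestSpace Ω) :
    ∑ m : Fin M, (stepCurrent P (stateSeq s₀ y (m + 1)) (stateSeq s₀ y m)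
        (stateSeq 0 d (m + 1)) (z m) +
      stepPrevious P (meanControl P β (m + 1 : ℕ)) (stateSeq s₀ y (m + 1)) (stateSeq s₀ y m)
        (stateSeq 0 d m) (z m)) = derivPairing P β s₀.1 (phase s₀) y d z := by
  rw [derivPairing_eq P β s₀ hs₀]
  -- the index shift loses no terms: directions vanish at time index `0`, tests at `M + 1`
  have hshift := sum_Icc_succ_eq M (fun k => stepPrevious P (meanControl P β k)
    (stateSeq s₀ y k) (stateSeq s₀ y (k - 1)) (stateSeq 0 d (k - 1)) (timeSeq 0 z k))
    ((isStepForm_step P hΩ _).zero_dir _ _ _).2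
    ((congrArg (stepPrevious P _ _ _ _) (timeSeq_last 0 z)).trans
      ((isStepForm_step P hΩ _).zero_test _ _ _))
  refine Eq.trans ?_ ((congrArg₂ (· + ·) (sum_fin_succ_eq_sum_Icc M fun k => stepCurrent P
    (stateSeq s₀ y k) (stateSeq s₀ y (k - 1)) (stateSeq 0 d k) (timeSeq 0 z k))
    ((sum_fin_succ_eq_sum_Icc M _).trans hshift.symm)).trans Finset.sum_add_distrib.symm)
  rw [← Finset.sum_add_distrib]
  refine Finset.sum_congr rfl fun m _ => ?_
  rw [timeSeq_succ 0 z]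
  rfl

theorem stateSeq_succ_eq_zero {d : Y Ω M} {m : Fin M} (hv : Y.v d m = 0) (hφ : Y.φ d m = 0)
    (hμ : Y.μ d m = 0) : stateSeq 0 d (m + 1) = 0 :=
  (timeSeq_succ 0 _ m).trans (stateL_eq_zero hv hφ hμ)

theorem stateSeq_eq_zero {d : Y Ω M} {m : Fin M}
    (h : ∀ k : Fin M, (k : ℕ) + 1 = m → Y.v d k = 0 ∧ Y.φ d k = 0 ∧ Y.μ d k = 0) :
    stateSeq 0 d m = 0 :=
  timeSeq_zero_of_forall fun k hk => stateL_eq_zero (h k hk).1 (h k hk).2.1 (h k hk).2.2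

theorem phase_stateSeq_succ_eq_zero {d : Y Ω M} {m : Fin M} (hφ : Y.φ d m = 0) :
    phase (stateSeq 0 d (m + 1)) = 0 :=
  (phase_stateSeq 0 d (m + 1)).symm.trans ((timeSeq_succ 0 (Y.φ d) m).trans hφ)

theorem pot_stateSeq_succ_eq_zero {d : Y Ω M} {m : Fin M} (hμ : Y.μ d m = 0) :
    (stateSeq 0 d (m + 1)).2.2 = 0 :=
  (pot_stateSeq 0 d (m + 1)).symm.trans ((timeSeq_succ 0 (Y.μ d) m).trans hμ)

theorem stepDeriv_eq_zero (hΩ : IsBoundedLipschitzDomain Ω) (β : Lp ℝ 2 (surf Ω))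
    (s s' : StepState Ω) {d d' : StepState Ω} (hd : d = 0) (hd' : d' = 0) (z : TestSpace Ω) :
    stepCurrent P s s' d z + stepPrevious P β s s' d' z = 0 := by
  subst hd hd'
  have h := (isStepForm_step P hΩ β).zero_dir s s' z
  rw [h.1, h.2, add_zero]

theorem stepDeriv_eq_zero_of_vel_test_eq_zero (hΩ : IsBoundedLipschitzDomain Ω)
    (β : Lp ℝ 2 (surf Ω)) (s s' : StepState Ω) {d d' : StepState Ω} (hφ : phase d = 0)
    (hμ : d.2.2 = 0) (hd' : d' = 0) (Ψ Φ : H1 Ω) :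
    stepCurrent P s s' d (0, Ψ, Φ) + stepPrevious P β s s' d' (0, Ψ, Φ) = 0 := by
  subst hd'
  rw [stepCurrent_eq_zero P hΩ s s' hφ hμ, ((isStepForm_step P hΩ β).zero_dir s s' _).2, add_zero]

variable (Ω) in
/-- The initial state. There is no initial chemical potential; its value is irrelevant. -/
def initState (v₀ : Hsig Ω) (φ₀ : H1 Ω) (hφ₀ : MemLp (fn φ₀) ⊤ (vol Ω)) : StepState Ω :=
  (v₀, ⟨(φ₀, hφ₀.toLp _), hφ₀.coeFn_toLp.symm⟩, 0)

/-- Testing with families concentrated at one index shows that a family of functionals is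
determined by its sums. -/
theorem eq_of_sum_apply_eq {X : Type*} [NormedAddCommGroup X] [NormedSpace ℝ X]
    {f g : Fin M → StrongDual ℝ X} (h : ∀ z : Fin M → X, ∑ m, f m (z m) = ∑ m, g m (z m)) :
    f = g := by
  have h1 : ∀ (f : Fin M → StrongDual ℝ X) m z, ∑ k, f k (Pi.single m z k) = f m z :=
    fun f m z => by
      rw [Finset.sum_eq_single m, Pi.single_eq_same]
      · intro k _ hk
        rw [Pi.single_eq_of_ne hk, map_zero]
      · exact fun hm => absurd (Finset.mem_univ m) hm
  funext m
  ext z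
  rw [← h1 f, ← h1 g, h]

theorem exists_unique_operator (hΩ : IsBoundedLipschitzDomain Ω) (β : BdryL2 Ω (M * P.τ))
    (v₀ : Hsig Ω) (φ₀ : H1 Ω) (hφ₀ : MemLp (fn φ₀) ⊤ (vol Ω)) :
    ∃! e : Y Ω M → Z Ω M,
      (∀ y (z : Fin M → TestSpace Ω),
        ∑ m, e y m (z m) = schemePairing P β v₀ φ₀ y z) ∧
      ∃ e' : Y Ω M → Y Ω M →L[ℝ] Z Ω M,
        (∀ y, HasFDerivAt e (e' y) y) ∧
        (∀ y d (z : Fin M → TestSpace Ω),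
          ∑ m, e' y d m (z m) = derivPairing P β v₀ φ₀ y d z) ∧
        (∀ y d (m : Fin M),
          (∀ k : Fin M, (k = m ∨ (k : ℕ) + 1 = m) →
            Y.v d k = 0 ∧ Y.φ d k = 0 ∧ Y.μ d k = 0) →
          e' y d m = 0) ∧
        (∀ y d (m : Fin M),
          (∀ k : Fin M, (k : ℕ) + 1 = m → Y.v d k = 0) →
          (∀ k : Fin M, (k = m ∨ (k : ℕ) + 1 = m) →
            Y.φ d k = 0 ∧ Y.μ d k = 0) →
          ∀ Ψ Φ : H1 Ω, e' y d m (0, Ψ, Φ) = 0) := by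
  refine (exists_residual (M := M) P hΩ β (initState Ω v₀ φ₀ hφ₀)).elim fun e h => h.elim
    fun e' h => ?_
  have he := h.1
  have hde := h.2.1
  have he' := h.2.2
  have hsum : ∀ y (z : Fin M → TestSpace Ω),
      ∑ m, e y m (z m) = schemePairing P β v₀ φ₀ y z := fun y z =>
    (Finset.sum_congr rfl fun m _ => he y m (z m)).trans
      (sum_residual_eq (M := M) P β (initState Ω v₀ φ₀ hφ₀) rfl y z)
  refine ⟨e, ⟨hsum, e', hde, fun y d z => ?_, fun y d m h => ?_, fun y d m h h' Ψ Φ => ?_⟩,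
    fun g hg => funext fun y => eq_of_sum_apply_eq fun z => (hg.1 y z).trans (hsum y z).symm⟩
  · exact (Finset.sum_congr rfl fun m _ => he' y d m (z m)).trans
      (sum_residualDeriv_eq (M := M) P hΩ β (initState Ω v₀ φ₀ hφ₀) rfl y d z)
  · have hm := h m (Or.inl rfl)
    exact ContinuousLinearMap.ext fun z => (he' y d m z).trans
      (stepDeriv_eq_zero P hΩ _ _ _ (stateSeq_succ_eq_zero hm.1 hm.2.1 hm.2.2)
        (stateSeq_eq_zero fun k hk => h k (Or.inr hk)) z)
  · have hm := h' m (Or.inl rfl)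
    exact (he' y d m (0, Ψ, Φ)).trans
      (stepDeriv_eq_zero_of_vel_test_eq_zero P hΩ _ _ _
        (phase_stateSeq_succ_eq_zero hm.1) (pot_stateSeq_succ_eq_zero hm.2)
        (stateSeq_eq_zero fun k hk => ⟨h k hk, h' k (Or.inr hk)⟩) Ψ Φ)

end Operator

end CHNS

end


theorem mainTheorem7 (P : CHNS.ModelData) (Ω : Set CHNS.Space)
    (hΩ : CHNS.IsBoundedLipschitzDomain Ω) (M : ℕ)
    {U : Type*} [NormedAddCommGroup U] [NormedSpace ℝ U]
    (B : U →L[ℝ] CHNS.BdryL2 Ω (M * P.τ))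
    (v₀ : CHNS.Hsig Ω) (φ₀ : CHNS.H1 Ω) (hφ₀ : MemLp (CHNS.fn φ₀) ⊤ (CHNS.vol Ω))
    (u : U) (hu : u ∈ CHNS.Uad P B) :
    ∃! e : CHNS.Y Ω M → CHNS.Z Ω M,
      (∀ y (z : Fin M → CHNS.TestSpace Ω),
        ∑ m, e y m (z m) = CHNS.schemePairing P (B u) v₀ φ₀ y z) ∧
      ∃ e' : CHNS.Y Ω M → CHNS.Y Ω M →L[ℝ] CHNS.Z Ω M,
        (∀ y, HasFDerivAt e (e' y) y) ∧
        (∀ y d (z : Fin M → CHNS.TestSpace Ω),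
          ∑ m, e' y d m (z m) = CHNS.derivPairing P (B u) v₀ φ₀ y d z) ∧
        (∀ y d (m : Fin M),
          (∀ k : Fin M, (k = m ∨ (k : ℕ) + 1 = m) →
            CHNS.Y.v d k = 0 ∧ CHNS.Y.φ d k = 0 ∧ CHNS.Y.μ d k = 0) →
          e' y d m = 0) ∧
        (∀ y d (m : Fin M),
          (∀ k : Fin M, (k : ℕ) + 1 = m → CHNS.Y.v d k = 0) →
          (∀ k : Fin M, (k = m ∨ (k : ℕ) + 1 = m) →
            CHNS.Y.φ d k = 0 ∧ CHNS.Y.μ d k = 0) →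
          ∀ Ψ Φ : CHNS.H1 Ω, e' y d m (0, Ψ, Φ) = 0) := by
  exact CHNS.exists_unique_operator (M := M) P hΩ (B u) v₀ φ₀ hφ₀
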